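/- For a finite simple graph $G$, let $P(G)$ be its continuous point space: it consists of the vertices and of the points $p(u,v,\lambda)$ for $uv\in E(G)$ and $\lambda\in[0,1]$, where $p(u,v,\lambda)=p(v,u,1-\lambda)$, $p(u,v,0)=u$ and $p(u,v,1)=v$. A *walk* in $G$ is a non-empty finite sequence $T=(p_0,\dots,p_z)$ of points of $P(G)$ in which any two consecutive points are distinct and lie on a common edge. Its *length* $\ell(T)$ is the sum of the distances of consecutive points, where the distance of $p(u,v,\lambda)$ and $p(u,v,\mu)$ is $|\lambda-\mu|$. The distance $d(p,q)$ of two points of $P(G)$ is the least length of a walk from $p$ to $q$, and $\infty$ if there is none. A *tour* is a walk with $p_0=p_z$ (a single point is a tour of length $0$). For a real $\delta\ge 0$, a *$\delta$-tour* is a tour $T$ such that every point $p\in P(G)$ has distance at most $\delta$ from the set of points passed by $T$, i.e. from the set of its stopping points $p_0,\dots,p_z$ together with the edge segments between consecutive stopping points. **Theorem.** There are a function $f:\mathbb{R}\times\mathbb{R}\to\mathbb{N}$ and a single algorithm which, given a finite simple graph $G$ with $n$ vertices and reals $\delta,K\ge 0$, decides in at most $\max(n,2)^{f(K,\delta)}$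 steps whether $G$ admits a $\delta$-tour of length at most $K$. Here an algorithm is a program for a unit-cost real RAM with natural-number and real registers and with arrays of natural numbers and of reals indexed by natural numbers. Its instructions are loading constants (natural numbers and rationals), addition, subtraction (truncated at $0$ for natural numbers), and array access; its tests are comparisons of two numbers of the same kind; its control structures are composition, branching and while loops. The input consists of $n$, the adjacency matrix of $G$, and the reals $\delta$ and $K$. -/

import Mathlib

/-! ## The continuous point space of a graph -/

namespace DeltaTour

variable {V : Type*} [Fintype V] [DecidableEq V]

/-- The point `p(u, v, t)` at distance `t` from `u` on the edge `uv`, in barycentric coordinates: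
weight `1 - t` at `u` and weight `t` at `v`.  Hence `p(u, v, t) = p(v, u, 1 - t)`,
`p(u, v, 0)` is the vertex `u`, `p(u, v, 1)` is the vertex `v`, and no other points coincide. -/
def pt (u v : V) (t : ℝ) : V → ℝ :=
  (1 - t) • Pi.single u 1 + t • Pi.single v 1

/-- The point set `P(G)`: all vertices and all points `p(u, v, t)` with `uv ∈ E(G)`, `t ∈ [0, 1]`. -/
def pointSet (G : SimpleGraph V) : Set (V → ℝ) :=
  {x | (∃ v, x = Pi.single v 1) ∨
    ∃ u v, G.Adj u v ∧ ∃ t ∈ Set.Icc (0 : ℝ) 1, x = pt u v t}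

/-- The two points lie on a common edge. -/
def SameEdge (G : SimpleGraph V) (x y : V → ℝ) : Prop :=
  ∃ u v, G.Adj u v ∧ ∃ s ∈ Set.Icc (0 : ℝ) 1, ∃ t ∈ Set.Icc (0 : ℝ) 1,
    x = pt u v s ∧ y = pt u v t

/-- On a common edge, the distance is the difference of the positions.  It is the distance of the
coordinate vectors in the maximum metric, which is the `dist` of `V → ℝ`. -/
theorem dist_pt {u v : V} (h : u ≠ v) (s t : ℝ) : dist (pt u v s) (pt u v t) = |s - t| := by
  apply le_antisymm
  · rw [dist_pi_le_iff (abs_nonneg _)]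
    intro w
    rw [Real.dist_eq]
    by_cases hu : w = u
    · subst hu
      simp [pt, h, abs_sub_comm]
    · by_cases hv : w = v
      · subst hv
        simp [pt, h.symm]
      · simp [pt, hu, hv]
  · have := dist_le_pi_dist (pt u v s) (pt u v t) v
    rw [Real.dist_eq] at this
    simpa [pt, h.symm] using this

/-- A walk: a non-empty sequence `p₀, …, p_z` of points in which any two consecutive points are
distinct and lie on a common edge. -/
def IsWalk (G : SimpleGraph V) (w : List (V → ℝ)) : Prop :=
  w ≠ [] ∧ (∀ x ∈ w, x ∈ pointSet G) ∧ w.IsChain (fun x y => x ≠ y ∧ SameEdge G x y)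

/-- The length of a walk: the sum of the distances of consecutive points. -/
noncomputable def walkLength : List (V → ℝ) → ℝ
  | [] => 0
  | [_] => 0
  | x :: y :: w => dist x y + walkLength (y :: w)

/-- The distance of two points of `P(G)`: the least length of a walk between them, `∞` if there is
none. -/
noncomputable def pointDist (G : SimpleGraph V) (x y : V → ℝ) : ENNReal :=
  ⨅ (w : List (V → ℝ)) (_ : IsWalk G w ∧ w.head? = some x ∧ w.getLast? = some y),
    ENNReal.ofReal (walkLength w)

/-- The edge segment between two points of a common edge. -/
def edgeSegment (G : SimpleGraph V) (x y : V → ℝ) : Set (V → ℝ) :=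
  {z | ∃ u v, G.Adj u v ∧ ∃ s ∈ Set.Icc (0 : ℝ) 1, ∃ t ∈ Set.Icc (0 : ℝ) 1,
    x = pt u v s ∧ y = pt u v t ∧ ∃ r, min s t ≤ r ∧ r ≤ max s t ∧ z = pt u v r}

/-- The set `P(T)` of points passed by a walk: its stopping points and the edge segments between
consecutive stopping points. -/
def passedPoints (G : SimpleGraph V) : List (V → ℝ) → Set (V → ℝ)
  | [] => ∅
  | [x] => {x}
  | x :: y :: w => edgeSegment G x y ∪ passedPoints G (y :: w)

/-- A tour: a walk whose first and last points coincide (a single point is a tour of length `0`). -/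
def IsTour (G : SimpleGraph V) (T : List (V → ℝ)) : Prop :=
  IsWalk G T ∧ T.head? = T.getLast?

/-- A `δ`-tour: a tour such that every point of `P(G)` has distance at most `δ` from `P(T)`. -/
def IsDeltaTour (G : SimpleGraph V) (δ : ℝ) (T : List (V → ℝ)) : Prop :=
  IsTour G T ∧
    ∀ x ∈ pointSet G, (⨅ y ∈ passedPoints G T, pointDist G x y) ≤ ENNReal.ofReal δ

end DeltaTour

/-! ## Programs on a real RAM, with step counts

The machine has natural-number and real registers, and arrays of natural numbers and of reals
that are indexed by the contents of natural-number registers.  Each instruction and each evaluation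
of a test takes one step.  The arithmetic is deliberately restricted to addition, subtraction and
comparison: there is no multiplication, division or rounding. -/

namespace RealRAM

/-- The memory of the machine. -/
structure State where
  /-- natural-number registers -/
  x : ℕ → ℕ
  /-- real registers -/
  r : ℕ → ℝ
  /-- arrays of natural numbers: `a k i` is entry `i` of array `k` -/
  a : ℕ → ℕ → ℕ
  /-- arrays of reals: `b k i` is entry `i` of array `k` -/
  b : ℕ → ℕ → ℝ

/-- The elementary instructions.  Register and array numbers and constants are part of the
program. -/
inductive Instr where
  /-- `x i := c` -/
  | natConst (i c : ℕ)
  /-- `x i := x j + x k` -/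
  | natAdd (i j k : ℕ)
  /-- `x i := max (x j - x k) 0` -/
  | natSub (i j k : ℕ)
  /-- `x i := a k (x j)` -/
  | natLoad (i k j : ℕ)
  /-- `a k (x j) := x i` -/
  | natStore (k j i : ℕ)
  /-- `r i := q` -/
  | realConst (i : ℕ) (q : ℚ)
  /-- `r i := r j + r k` -/
  | realAdd (i j k : ℕ)
  /-- `r i := r j - r k` -/
  | realSub (i j k : ℕ)
  /-- `r i := b k (x j)` -/
  | realLoad (i k j : ℕ)
  /-- `b k (x j) := r i` -/
  | realStore (k j i : ℕ)

/-- The effect of an instruction. -/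
noncomputable def Instr.exec (s : State) : Instr → State
  | natConst i c => { s with x := Function.update s.x i c }
  | natAdd i j k => { s with x := Function.update s.x i (s.x j + s.x k) }
  | natSub i j k => { s with x := Function.update s.x i (s.x j - s.x k) }
  | natLoad i k j => { s with x := Function.update s.x i (s.a k (s.x j)) }
  | natStore k j i =>
      { s with a := Function.update s.a k (Function.update (s.a k) (s.x j) (s.x i)) }
  | realConst i q => { s with r := Function.update s.r i (q : ℝ) }
  | realAdd i j k => { s with r := Function.update s.r i (s.r j + s.r k) }
  | realSub i j k => { s with r := Function.update s.r i (s.r j - s.r k) }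
  | realLoad i k j => { s with r := Function.update s.r i (s.b k (s.x j)) }
  | realStore k j i =>
      { s with b := Function.update s.b k (Function.update (s.b k) (s.x j) (s.r i)) }

/-- The elementary tests: `x i ≤ x j` and `r i ≤ r j`. -/
inductive Test where
  | natLE (i j : ℕ)
  | realLE (i j : ℕ)

/-- The test succeeds in a given state. -/
def Test.Holds (s : State) : Test → Prop
  | natLE i j => s.x i ≤ s.x j
  | realLE i j => s.r i ≤ s.r j

/-- Programs. -/
inductive Prog where
  /-- a single instruction -/
  | instr (c : Instr)
  /-- `p; q` -/
  | seq (p q : Prog)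
  /-- `if c then p else q` -/
  | branch (c : Test) (p q : Prog)
  /-- `while c do p` -/
  | loop (c : Test) (p : Prog)

/-- `Runs p s t s'`: program `p`, started in state `s`, halts after exactly `t` steps in
state `s'`. -/
inductive Runs : Prog → State → ℕ → State → Prop where
  | instr (c : Instr) (s : State) : Runs (.instr c) s 1 (c.exec s)
  | seq {p q : Prog} {s s₁ s₂ : State} {t₁ t₂ : ℕ} :
      Runs p s t₁ s₁ → Runs q s₁ t₂ s₂ → Runs (.seq p q) s (t₁ + t₂) s₂
  | branch_true {c : Test} {p q : Prog} {s s₁ : State} {t : ℕ} :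
      c.Holds s → Runs p s t s₁ → Runs (.branch c p q) s (t + 1) s₁
  | branch_false {c : Test} {p q : Prog} {s s₁ : State} {t : ℕ} :
      ¬ c.Holds s → Runs q s t s₁ → Runs (.branch c p q) s (t + 1) s₁
  | loop_true {c : Test} {p : Prog} {s s₁ s₂ : State} {t₁ t₂ : ℕ} :
      c.Holds s → Runs p s t₁ s₁ → Runs (.loop c p) s₁ t₂ s₂ →
        Runs (.loop c p) s (t₁ + t₂ + 1) s₂
  | loop_false {c : Test} {p : Prog} {s : State} :
      ¬ c.Holds s → Runs (.loop c p) s 1 s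

/-- The number of steps and the final state are determined by the program and the initial state. -/
theorem Runs.deterministic {p : Prog} {s s₁ s₂ : State} {t₁ t₂ : ℕ}
    (h₁ : Runs p s t₁ s₁) (h₂ : Runs p s t₂ s₂) : t₁ = t₂ ∧ s₁ = s₂ := by
  induction h₁ generalizing t₂ s₂ with
  | instr c s => cases h₂; exact ⟨rfl, rfl⟩
  | seq _ _ ih ih' =>
    cases h₂ with
    | seq a b =>
      obtain ⟨rfl, rfl⟩ := ih a
      obtain ⟨rfl, rfl⟩ := ih' b
      exact ⟨rfl, rfl⟩
  | branch_true hc _ ih =>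
    cases h₂ with
    | branch_true _ a => obtain ⟨rfl, rfl⟩ := ih a; exact ⟨rfl, rfl⟩
    | branch_false hn _ => exact absurd hc hn
  | branch_false hn _ ih =>
    cases h₂ with
    | branch_true hc _ => exact absurd hc hn
    | branch_false _ a => obtain ⟨rfl, rfl⟩ := ih a; exact ⟨rfl, rfl⟩
  | loop_true hc _ _ ih ih' =>
    cases h₂ with
    | loop_true _ a b =>
      obtain ⟨rfl, rfl⟩ := ih a
      obtain ⟨rfl, rfl⟩ := ih' b
      exact ⟨rfl, rfl⟩
    | loop_false hn => exact absurd hc hn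
  | loop_false hn =>
    cases h₂ with
    | loop_true hc _ _ => exact absurd hc hn
    | loop_false _ => exact ⟨rfl, rfl⟩

open scoped Classical in
/-- The initial state for the input `(G, δ, K)`: register `x 0` holds the number `n` of vertices,
`r 0` holds `δ`, `r 1` holds `K`, array `a 0` holds the adjacency matrix of `G` row by row, and
everything else is `0`. -/
noncomputable def inputState {n : ℕ} (G : SimpleGraph (Fin n)) (δ K : ℝ) : State where
  x i := if i = 0 then n else 0
  r i := if i = 0 then δ else if i = 1 then K else 0
  a k m := if k = 0 ∧ ∃ i j : Fin n, G.Adj i j ∧ m = i.val * n + j.val then 1 else 0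
  b _ _ := 0

end RealRAM

/-! A tour may be replaced by one that is no longer and passes at least the same points. By
`Trail.decompose` this leaves two shapes: a closed walk in the graph with detours, each from a
vertex `u` of the walk to a point `pt u v α` and back, or a run back and forth over a segment of a
single edge. For these shapes coverage is combinatorial. An edge (other than the one carrying the
segment) is covered exactly if the parts reached from its two ends overlap, which means `1 + D + D'
≤ α + α' + 2δ`, where `α`, `α'` are detour lengths or `1` and `D`, `D'` are natural numbers counting
graph steps (`edgeCovered_of_covers`, `segment_criterion`, `EdgeCovered.exists_within`).

So the detour lengths matter only through inequalities `m ≤ α + α' + 2δ` with `m` an integer, and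
through their sum. `exists_rounding` moves all of them simultaneously to numbers `(i - 2jδ)/2` with
`j ∈ {0, 1, 2}`, keeping `0`, `1` and every such inequality and not increasing the sum. It averages
over a family of monotone step functions that commute with the reflections `x ↦ m - x`.

After rounding, the lengths lie on a finite grid depending on `δ` alone. Its positive elements have
a positive minimum, so the budget `K` bounds the number of detours, and it bounds the length of the
walk as well. A certificate is then a sequence of vertices and grid indices whose length is bounded
in terms of `K` and `δ`. Written in base `n`, it is a number below a power of `n` with such an
exponent, and exhaustive search suffices (`Inst.HasCode`, `Inst.hasCode_iff`).

On the machine side no program is written for the whole search. The functions and predicates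
computable in the required time (`NatComp`, `Dec`) are shown to be closed under primitive recursion,
hence under arithmetic and bounded quantifiers, and to contain adjacency and linear comparisons of
`1`, `δ`, `K`. Quantities depending only on `K` and `δ`, such as the grid size, are found by search
(`NatComp.search`). Their cost is harmless because `m ≤ max n 2 ^ m`. -/

namespace RealRAM

/-! ### Total correctness with a step bound -/

/-- Started in `s`, the program halts within `T` steps in a state that satisfies `Q`. -/
def Spec (p : Prog) (s : State) (T : ℕ) (Q : State → Prop) : Prop :=
  ∃ t s', Runs p s t s' ∧ t ≤ T ∧ Q s'

theorem Spec.instr {c : Instr} {s : State} {Q : State → Prop} (h : Q (c.exec s)) :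
    Spec (.instr c) s 1 Q :=
  ⟨1, _, .instr c s, le_rfl, h⟩

theorem Spec.seq {p q : Prog} {s : State} {T₁ T₂ : ℕ} {R Q : State → Prop}
    (hp : Spec p s T₁ R) (hq : ∀ s', R s' → Spec q s' T₂ Q) :
    Spec (.seq p q) s (T₁ + T₂) Q := by
  obtain ⟨t, s₁, h₁, ht, hR⟩ := hp
  obtain ⟨t', s₂, h₂, ht', hQ⟩ := hq _ hR
  exact ⟨_, _, .seq h₁ h₂, by omega, hQ⟩

theorem Spec.instr_seq {c : Instr} {q : Prog} {s : State} {T : ℕ} {Q : State → Prop}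
    (hq : Spec q (c.exec s) T Q) : Spec (.seq (.instr c) q) s (1 + T) Q := by
  obtain ⟨t, s', h, ht, hQ⟩ := hq
  exact ⟨_, _, .seq (.instr c s) h, by omega, hQ⟩

theorem Spec.mono {p : Prog} {s : State} {T T' : ℕ} {Q Q' : State → Prop}
    (hp : Spec p s T Q) (hT : T ≤ T') (hQ : ∀ s', Q s' → Q' s') : Spec p s T' Q' := by
  obtain ⟨t, s', h, ht, hq⟩ := hp
  exact ⟨t, s', h, ht.trans hT, hQ _ hq⟩

theorem Spec.branch {c : Test} {p q : Prog} {s : State} {T : ℕ} {Q : State → Prop}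
    (hp : c.Holds s → Spec p s T Q) (hq : ¬ c.Holds s → Spec q s T Q) :
    Spec (.branch c p q) s (T + 1) Q := by
  by_cases h : c.Holds s
  · obtain ⟨t, s', h', ht, hQ⟩ := hp h
    exact ⟨_, _, .branch_true h h', by omega, hQ⟩
  · obtain ⟨t, s', h', ht, hQ⟩ := hq h
    exact ⟨_, _, .branch_false h h', by omega, hQ⟩

/-- The index of `Inv` is the number of rounds still to come, so termination and the step bound come
out of one induction. -/
theorem Spec.loop {c : Test} {p : Prog} {T : ℕ} {Q : State → Prop} (Inv : ℕ → State → Prop)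
    (hstep : ∀ j s, Inv (j + 1) s → c.Holds s ∧ Spec p s T (Inv j))
    (hend : ∀ s, Inv 0 s → ¬ c.Holds s ∧ Q s) :
    ∀ (N : ℕ) (s : State), Inv N s → Spec (.loop c p) s (N * (T + 1) + 1) Q := by
  intro N
  induction N with
  | zero =>
    intro s hs
    exact ⟨1, s, .loop_false (hend s hs).1, by omega, (hend s hs).2⟩
  | succ N ih =>
    intro s hs
    obtain ⟨hc, t, s₁, h₁, ht, hI⟩ := hstep N s hs
    obtain ⟨t', s₂, h₂, ht', hQ⟩ := ih s₁ hI
    refine ⟨_, _, .loop_true hc h₁ h₂, ?_, hQ⟩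
    rw [Nat.succ_mul]
    omega

/-! ### Instances, contexts and functions computable within slicewise polynomial time -/

/-- An input of the decision problem. -/
structure Inst where
  n : ℕ
  G : SimpleGraph (Fin n)
  δ : ℝ
  K : ℝ
  δ_nonneg : 0 ≤ δ
  K_nonneg : 0 ≤ K

/-- A type `Γ` of parameter values of a computation: an instance together with finitely many
natural-number variables.  Only the values satisfying `ok` occur. -/
structure Ctx (Γ : Type) where
  nv : ℕ
  var : ℕ → Γ → ℕ
  inst : Γ → Inst
  ok : Γ → Prop

/-- Bounded by a power of `max n 2` whose exponent depends on `K` and `δ` only. -/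
def XPB {Γ : Type} (c : Ctx Γ) (T : Γ → ℕ) : Prop :=
  ∃ f : ℝ → ℝ → ℕ, ∀ γ, c.ok γ → T γ ≤ max (c.inst γ).n 2 ^ f (c.inst γ).K (c.inst γ).δ

/-- The memory `s` holds the instance and the variables, variable `j` in register `loc j`. -/
def Enc {Γ : Type} (c : Ctx Γ) (loc : ℕ → ℕ) (γ : Γ) (s : State) : Prop :=
  (∀ j < c.nv, s.x (loc j) = c.var j γ) ∧ s.r 0 = (c.inst γ).δ ∧ s.r 1 = (c.inst γ).K ∧
    s.a = (inputState (c.inst γ).G (c.inst γ).δ (c.inst γ).K).a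

/-- The natural-number registers below `k`, the real input registers and the arrays of natural
numbers are unchanged. -/
def Pres (k : ℕ) (s s' : State) : Prop :=
  (∀ j < k, s'.x j = s.x j) ∧ s'.r 0 = s.r 0 ∧ s'.r 1 = s.r 1 ∧ s'.a = s.a

/-- `f` is bounded by, and computable in, slicewise polynomial time: the value can be put into any
register `k` above the registers of the variables, without changing the registers below `k`. -/
def NatComp {Γ : Type} (c : Ctx Γ) (f : Γ → ℕ) : Prop :=
  XPB c f ∧ ∃ T, XPB c T ∧ ∀ (loc : ℕ → ℕ) (k : ℕ), (∀ j < c.nv, loc j < k) →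
    ∃ p, ∀ γ s, c.ok γ → Enc c loc γ s → Spec p s (T γ) fun s' => Pres k s s' ∧ s'.x k = f γ

open scoped Classical in
/-- `φ` is decidable in slicewise polynomial time. -/
def Dec {Γ : Type} (c : Ctx Γ) (φ : Γ → Prop) : Prop :=
  NatComp c fun γ => if φ γ then 1 else 0

/-! ### Arithmetic of slicewise polynomial bounds. -/

section XPB

variable {Γ : Type} {c : Ctx Γ} {S T : Γ → ℕ}

theorem XPB.mono (hT : XPB c T) (h : ∀ γ, c.ok γ → S γ ≤ T γ) : XPB c S := by
  obtain ⟨f, hf⟩ := hT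
  exact ⟨f, fun γ hγ => (h γ hγ).trans (hf γ hγ)⟩

/-- Since `m ≤ 2 ^ m` and the base is at least 2, a quantity depending only on `K` and `δ`, however
large, can be absorbed into the exponent. -/
theorem XPB.param (g : ℝ → ℝ → ℕ) (h : ∀ γ, c.ok γ → T γ ≤ g (c.inst γ).K (c.inst γ).δ) :
    XPB c T := by
  refine ⟨g, fun γ hγ => (h γ hγ).trans ?_⟩
  exact (Nat.lt_two_pow_self.le).trans (Nat.pow_le_pow_left (le_max_right _ _) _)

theorem XPB.const (m : ℕ) : XPB c fun _ => m :=
  .param (fun _ _ => m) fun _ _ => le_rfl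

theorem XPB.size : XPB c fun γ => (c.inst γ).n :=
  ⟨fun _ _ => 1, fun γ _ => by simp⟩

theorem XPB.mul (hS : XPB c S) (hT : XPB c T) : XPB c fun γ => S γ * T γ := by
  obtain ⟨f, hf⟩ := hS
  obtain ⟨g, hg⟩ := hT
  refine ⟨fun a b => f a b + g a b, fun γ hγ => ?_⟩
  rw [pow_add]
  exact Nat.mul_le_mul (hf γ hγ) (hg γ hγ)

theorem XPB.add (hS : XPB c S) (hT : XPB c T) : XPB c fun γ => S γ + T γ := by
  obtain ⟨f, hf⟩ := hS
  obtain ⟨g, hg⟩ := hT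
  refine ⟨fun a b => f a b + g a b + 1, fun γ hγ => ?_⟩
  -- The extra 1 in the exponent pays for the factor 2 that arises when both summands are bounded by
  -- the same power.
  have h2 : 2 ≤ max (c.inst γ).n 2 := le_max_right _ _
  have h1 : 1 ≤ max (c.inst γ).n 2 := by omega
  have hf' := (hf γ hγ).trans (Nat.pow_le_pow_right h1
    (Nat.le_add_right _ (g (c.inst γ).K (c.inst γ).δ)))
  have hg' := (hg γ hγ).trans (Nat.pow_le_pow_right h1
    (Nat.le_add_left _ (f (c.inst γ).K (c.inst γ).δ)))
  calc S γ + T γ ≤ _ := Nat.add_le_add hf' hg'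
    _ ≤ _ := by rw [pow_succ]; nlinarith

theorem XPB.pow (hS : XPB c S) (g : ℝ → ℝ → ℕ)
    (h : ∀ γ, c.ok γ → T γ ≤ g (c.inst γ).K (c.inst γ).δ) : XPB c fun γ => S γ ^ T γ := by
  obtain ⟨f, hf⟩ := hS
  refine ⟨fun a b => f a b * g a b, fun γ hγ => ?_⟩
  have h1 : 1 ≤ max (c.inst γ).n 2 := by omega
  calc S γ ^ T γ ≤ (max (c.inst γ).n 2 ^ f (c.inst γ).K (c.inst γ).δ) ^ T γ :=
        Nat.pow_le_pow_left (hf γ hγ) _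
    _ ≤ _ := by
        rw [← pow_mul]
        exact Nat.pow_le_pow_right h1 (Nat.mul_le_mul_left _ (h γ hγ))

end XPB

/-- The context with one more variable, which ranges below `b`. -/
def Ctx.ext {Γ : Type} (c : Ctx Γ) (b : Γ → ℕ) : Ctx (Γ × ℕ) where
  nv := c.nv + 1
  var j p := if j = c.nv then p.2 else c.var j p.1
  inst p := c.inst p.1
  ok p := c.ok p.1 ∧ p.2 < b p.1

/-! ### Closure of computability under arithmetic, primitive recursion and search. -/

section Closure

variable {Γ : Type} {c : Ctx Γ} {b f g : Γ → ℕ} {φ ψ : Γ → Prop}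

theorem XPB.lift {T : Γ → ℕ} (hT : XPB c T) : XPB (c.ext b) fun p => T p.1 := by
  obtain ⟨f, hf⟩ := hT
  exact ⟨f, fun p hp => hf p.1 hp.1⟩

/-- The exponent depends on `K` and `δ` only, so a bound in the extended context is uniform in the
new variable. This turns the cost of a loop body into a cost per round. -/
theorem XPB.descend {T : Γ × ℕ → ℕ} (hT : XPB (c.ext b) T) :
    ∃ S, XPB c S ∧ ∀ γ i, c.ok γ → i < b γ → T (γ, i) ≤ S γ := by
  obtain ⟨f, hf⟩ := hT
  exact ⟨fun γ => max (c.inst γ).n 2 ^ f (c.inst γ).K (c.inst γ).δ, ⟨f, fun _ _ => le_rfl⟩,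
    fun γ i hγ hi => hf (γ, i) ⟨hγ, hi⟩⟩

theorem Pres.refl (k : ℕ) (s : State) : Pres k s s := ⟨fun _ _ => rfl, rfl, rfl, rfl⟩

theorem Pres.trans {k l : ℕ} {s₁ s₂ s₃ : State} (h : Pres k s₁ s₂) (h' : Pres l s₂ s₃)
    (hkl : k ≤ l) : Pres k s₁ s₃ :=
  ⟨fun j hj => (h'.1 j (by omega)).trans (h.1 j hj), h'.2.1.trans h.2.1,
    h'.2.2.1.trans h.2.2.1, h'.2.2.2.trans h.2.2.2⟩

theorem Pres.update {k i v : ℕ} {s s' : State} (h : Pres k s s') (hi : k ≤ i) :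
    Pres k s { s' with x := Function.update s'.x i v } := by
  refine ⟨fun j hj => ?_, h.2⟩
  rw [← h.1 j hj]
  exact Function.update_of_ne (by omega) _ _

theorem Enc.pres {loc : ℕ → ℕ} {γ : Γ} {k : ℕ} {s s' : State} (h : Enc c loc γ s)
    (hp : Pres k s s') (hl : ∀ j < c.nv, loc j < k) : Enc c loc γ s' :=
  ⟨fun j hj => (hp.1 _ (hl j hj)).trans (h.1 j hj), hp.2.1.trans h.2.1, hp.2.2.1.trans h.2.2.1,
    hp.2.2.2.trans h.2.2.2⟩

theorem NatComp.congr (hf : NatComp c f) (h : ∀ γ, c.ok γ → g γ = f γ) : NatComp c g := by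
  obtain ⟨hX, T, hT, H⟩ := hf
  refine ⟨hX.mono fun γ hγ => (h γ hγ).le, T, hT, fun loc k hl => ?_⟩
  obtain ⟨p, hp⟩ := H loc k hl
  refine ⟨p, fun γ s hγ hs => ?_⟩
  rw [h γ hγ]
  exact hp γ s hγ hs

theorem Dec.congr (hf : Dec c φ) (h : ∀ γ, c.ok γ → (ψ γ ↔ φ γ)) : Dec c ψ :=
  NatComp.congr hf fun γ hγ => by by_cases hh : φ γ <;> simp [h γ hγ, hh]

theorem NatComp.lift (hf : NatComp c f) : NatComp (c.ext b) fun p => f p.1 := by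
  obtain ⟨hX, T, hT, H⟩ := hf
  refine ⟨hX.lift, _, hT.lift, fun loc k hl => ?_⟩
  obtain ⟨p, hp⟩ := H loc k fun j hj => hl j (Nat.lt_succ_of_lt hj)
  refine ⟨p, fun γ s hγ hs => hp γ.1 s hγ.1 ⟨fun j hj => ?_, hs.2⟩⟩
  rw [hs.1 j (Nat.lt_succ_of_lt hj)]
  exact if_neg hj.ne

theorem NatComp.var {i : ℕ} (hi : i < c.nv) (hX : XPB c (c.var i)) : NatComp c (c.var i) := by
  refine ⟨hX, fun _ => 1 + 1, XPB.const _, fun loc k hl => ?_⟩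
  -- The machine has no move instruction; a register is copied by adding it to 0.
  refine ⟨.seq (.instr (.natConst k 0)) (.instr (.natAdd k (loc i) k)), fun γ s _ hs => ?_⟩
  refine Spec.instr_seq (Spec.instr ⟨?_, ?_⟩)
  · exact Pres.update ((Pres.refl k s).update le_rfl) le_rfl
  · have := (hl i hi).ne
    simp [Instr.exec, this, hs.1 i hi]

theorem NatComp.last (hb : XPB c b) : NatComp (c.ext b) fun p => p.2 := by
  have h : (c.ext b).var c.nv = fun p => p.2 := by
    funext p
    exact if_pos rfl
  rw [← h]
  refine NatComp.var (Nat.lt_succ_self _) ?_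
  rw [h]
  exact hb.lift.mono fun p hp => hp.2.le

theorem NatComp.const (m : ℕ) : NatComp c fun _ => m := by
  refine ⟨XPB.const m, fun _ => 1, XPB.const _, fun loc k _ => ?_⟩
  refine ⟨.instr (.natConst k m), fun γ s _ _ => Spec.instr ⟨?_, ?_⟩⟩
  · exact (Pres.refl k s).update le_rfl
  · simp [Instr.exec]

/-- The values of two computations in the consecutive registers `k`, `k + 1`, followed by a
program that works on these. -/
theorem NatComp.binary {h : Γ → ℕ} (hf : NatComp c f) (hg : NatComp c g) (hh : XPB c h)
    (T : ℕ) (q : ℕ → Prog)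
    (hq : ∀ k γ s, c.ok γ → s.x k = f γ → s.x (k + 1) = g γ →
      s.a = (inputState (c.inst γ).G (c.inst γ).δ (c.inst γ).K).a →
      Spec (q k) s T fun s' => Pres k s s' ∧ s'.x k = h γ) :
    NatComp c h := by
  obtain ⟨-, S₁, hS₁, H₁⟩ := hf
  obtain ⟨-, S₂, hS₂, H₂⟩ := hg
  refine ⟨hh, _, hS₁.add (hS₂.add (XPB.const T)), fun loc k hl => ?_⟩
  have hl' : ∀ j < c.nv, loc j < k + 1 := fun j hj => Nat.lt_succ_of_lt (hl j hj)
  obtain ⟨p₁, h₁⟩ := H₁ loc k hl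
  obtain ⟨p₂, h₂⟩ := H₂ loc (k + 1) hl'
  refine ⟨.seq p₁ (.seq p₂ (q k)), fun γ s hγ hs => ?_⟩
  refine Spec.seq (h₁ γ s hγ hs) fun s₁ hs₁ => ?_
  have he₁ := hs.pres hs₁.1 hl
  refine Spec.seq (h₂ γ s₁ hγ he₁) fun s₂ hs₂ => ?_
  have he₂ := he₁.pres hs₂.1 hl'
  refine (hq k γ s₂ hγ ((hs₂.1.1 k (Nat.lt_succ_self k)).trans hs₁.2) hs₂.2 he₂.2.2.2).mono le_rfl
    fun s₃ hs₃ => ⟨?_, hs₃.2⟩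
  exact (hs₁.1.trans hs₂.1 (Nat.le_succ k)).trans hs₃.1 le_rfl

theorem NatComp.add (hf : NatComp c f) (hg : NatComp c g) : NatComp c fun γ => f γ + g γ := by
  refine hf.binary hg (hf.1.add hg.1) 1 (fun k => .instr (.natAdd k k (k + 1))) ?_
  intro k γ s _ h₁ h₂ _
  refine Spec.instr ⟨(Pres.refl k s).update le_rfl, ?_⟩
  simp [Instr.exec, h₁, h₂]

theorem NatComp.sub (hf : NatComp c f) (hg : NatComp c g) : NatComp c fun γ => f γ - g γ := by
  refine hf.binary hg (hf.1.mono fun _ _ => Nat.sub_le _ _) 1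
    (fun k => .instr (.natSub k k (k + 1))) ?_
  intro k γ s _ h₁ h₂ _
  refine Spec.instr ⟨(Pres.refl k s).update le_rfl, ?_⟩
  simp [Instr.exec, h₁, h₂]

open scoped Classical in
theorem XPB.ite : XPB c fun γ => if φ γ then 1 else 0 :=
  (XPB.const 1).mono fun γ _ => by split_ifs <;> simp

theorem Dec.le (hf : NatComp c f) (hg : NatComp c g) : Dec c fun γ => f γ ≤ g γ := by
  refine hf.binary hg XPB.ite 2
    (fun k => .branch (.natLE k (k + 1)) (.instr (.natConst k 1)) (.instr (.natConst k 0))) ?_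
  intro k γ s _ h₁ h₂ _
  refine Spec.branch (fun h => ?_) (fun h => ?_)
  all_goals
    refine Spec.instr ⟨(Pres.refl k s).update le_rfl, ?_⟩
    simp only [Test.Holds, h₁, h₂] at h
    simp [Instr.exec, h]

theorem Dec.not (hf : Dec c φ) : Dec c fun γ => ¬ φ γ :=
  ((NatComp.const 1).sub hf).congr fun γ _ => by by_cases h : φ γ <;> simp [h]

theorem Dec.and (hf : Dec c φ) (hg : Dec c ψ) : Dec c fun γ => φ γ ∧ ψ γ :=
  (Dec.le (NatComp.const 2) (hf.add hg)).congr fun γ _ => by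
    by_cases h : φ γ <;> by_cases h' : ψ γ <;> simp [h, h']

theorem Dec.or (hf : Dec c φ) (hg : Dec c ψ) : Dec c fun γ => φ γ ∨ ψ γ :=
  (hf.not.and hg.not).not.congr fun γ _ => by tauto

theorem Dec.imp (hf : Dec c φ) (hg : Dec c ψ) : Dec c fun γ => φ γ → ψ γ :=
  (hf.not.or hg).congr fun γ _ => by tauto

theorem Dec.lt (hf : NatComp c f) (hg : NatComp c g) : Dec c fun γ => f γ < g γ :=
  (Dec.le (hf.add (NatComp.const 1)) hg).congr fun _ _ => Iff.rfl

theorem Dec.eq (hf : NatComp c f) (hg : NatComp c g) : Dec c fun γ => f γ = g γ :=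
  ((Dec.le hf hg).and (Dec.le hg hf)).congr fun _ _ => le_antisymm_iff

/-- Primitive recursion. -/
theorem NatComp.primrec {init C : Γ → ℕ} {step : (Γ × ℕ) × ℕ → ℕ} (hb : NatComp c b)
    (hi : NatComp c init) (hC : XPB c C)
    (hs : NatComp ((c.ext b).ext fun p => C p.1 + 1) step)
    (hle : ∀ γ, c.ok γ → ∀ i ≤ b γ,
      Nat.rec (motive := fun _ => ℕ) (init γ) (fun i a => step ((γ, i), a)) i ≤ C γ) :
    NatComp c fun γ =>
      Nat.rec (motive := fun _ => ℕ) (init γ) (fun i a => step ((γ, i), a)) (b γ) := by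
  set F : Γ → ℕ → ℕ := fun γ =>
    Nat.rec (motive := fun _ => ℕ) (init γ) (fun i a => step ((γ, i), a)) with hF
  obtain ⟨hbX, S₁, hS₁, H₁⟩ := hb
  obtain ⟨-, S₂, hS₂, H₂⟩ := hi
  obtain ⟨-, S₃, hS₃, H₃⟩ := hs
  obtain ⟨S₄, hS₄, hS₃₄⟩ := hS₃.descend
  obtain ⟨S, hS, hS₄S⟩ := hS₄.descend
  refine ⟨hC.mono fun γ hγ => hle γ hγ _ le_rfl, fun γ =>
    S₂ γ + (S₁ γ + (1 + (1 + (b γ * ((S γ + 4) + 1) + 1)))), ?_, fun loc k hl => ?_⟩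
  · exact hS₂.add (hS₁.add ((XPB.const 1).add ((XPB.const 1).add
      ((hbX.mul ((hS.add (XPB.const 4)).add (XPB.const 1))).add (XPB.const 1)))))
  obtain ⟨p₂, h₂⟩ := H₂ loc k hl
  obtain ⟨p₁, h₁⟩ := H₁ loc (k + 2) fun j hj => by have := hl j hj; omega
  -- Register `k` holds the accumulator, `k + 1` the index, `k + 2` the number of remaining rounds
  -- and `k + 3` the constant 1. The step function sees the first two as its new variables and works
  -- from `k + 4` upwards.
  set loc' : ℕ → ℕ := fun j => if j < c.nv then loc j else if j = c.nv then k + 1 else k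
    with hloc'
  have hl' : ∀ j < (((c.ext b).ext fun p => C p.1 + 1)).nv, loc' j < k + 4 := by
    intro j _
    simp only [hloc']
    split_ifs with h
    · have := hl j h; omega
    · omega
    · omega
  obtain ⟨p₃, h₃⟩ := H₃ loc' (k + 4) hl'
  refine ⟨.seq p₂ (.seq p₁ (.seq (.instr (.natConst (k + 1) 0)) (.seq (.instr (.natConst (k + 3) 1))
    (.loop (.natLE (k + 3) (k + 2)) (.seq p₃ (.seq (.instr (.natConst k 0))
      (.seq (.instr (.natAdd k k (k + 4))) (.seq (.instr (.natAdd (k + 1) (k + 1) (k + 3)))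
        (.instr (.natSub (k + 2) (k + 2) (k + 3))))))))))), fun γ s hγ hs => ?_⟩
  refine Spec.seq (h₂ γ s hγ hs) fun s₂ hs₂ => ?_
  refine Spec.seq (h₁ γ s₂ hγ (hs.pres hs₂.1 hl)) fun s₁ hs₁ => ?_
  refine Spec.instr_seq (Spec.instr_seq ?_)
  have hp : Pres k s s₁ := hs₂.1.trans hs₁.1 (by omega)
  refine Spec.loop (fun j s' => j ≤ b γ ∧ Pres k s s' ∧ s'.x k = F γ (b γ - j) ∧
    s'.x (k + 1) = b γ - j ∧ s'.x (k + 2) = j ∧ s'.x (k + 3) = 1) ?_ ?_ _ _ ?_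
  · rintro j s' ⟨hj, hp', hk, hk1, hk2, hk3⟩
    refine ⟨by simp only [Test.Holds, hk2, hk3]; omega, ?_⟩
    have hok : ((c.ext b).ext fun p => C p.1 + 1).ok ((γ, b γ - (j + 1)), F γ (b γ - (j + 1))) :=
      ⟨⟨hγ, by simp only; omega⟩, Nat.lt_succ_of_le (hle γ hγ _ (by omega))⟩
    have henc : Enc ((c.ext b).ext fun p => C p.1 + 1) loc'
        ((γ, b γ - (j + 1)), F γ (b γ - (j + 1))) s' := by
      have he := hs.pres hp' hl
      refine ⟨fun i hi => ?_, he.2⟩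
      simp only [Ctx.ext] at hi ⊢
      simp only [hloc']
      rcases lt_trichotomy i c.nv with h | h | h
      · rw [if_pos h, if_neg (by omega), if_neg (by omega)]
        exact he.1 i h
      · rw [if_neg (by omega), if_pos h, if_neg (by omega), if_pos h, hk1]
      · rw [if_neg (by omega), if_neg (by omega), if_pos (by omega), hk]
    refine Spec.mono (T := S₃ ((γ, b γ - (j + 1)), F γ (b γ - (j + 1))) + (1 + (1 + (1 + 1))))
      ?_ ?_ fun _ h => h
    · refine Spec.seq (h₃ _ s' hok henc) fun s₃ hs₃ => ?_
      refine Spec.instr_seq (Spec.instr_seq (Spec.instr_seq (Spec.instr ?_)))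
      have e0 := hs₃.2
      have e1 := hs₃.1.1 (k + 1) (by omega)
      have e2 := hs₃.1.1 (k + 2) (by omega)
      have e3 := hs₃.1.1 (k + 3) (by omega)
      refine ⟨by omega, ?_, ?_, ?_, ?_, ?_⟩
      · have := hp'.trans hs₃.1 (by omega)
        exact ((((this.update le_rfl).update le_rfl).update (by omega)).update (by omega))
      · have : b γ - j = (b γ - (j + 1)) + 1 := by omega
        rw [this]
        simp [Instr.exec, e0, hF]
      · simp [Instr.exec, e1, e3, hk1, hk3]
        omega
      · simp [Instr.exec, e2, e3, hk2, hk3]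
      · simp [Instr.exec, e3, hk3]
    · have h1 := hS₄S γ (b γ - (j + 1)) hγ (by omega)
      have h2 := hS₃₄ (γ, b γ - (j + 1)) (F γ (b γ - (j + 1))) hok.1 hok.2
      omega
  · rintro s' ⟨-, hp', hk, -, hk2, hk3⟩
    refine ⟨by simp [Test.Holds, hk2, hk3], hp', hk⟩
  · refine ⟨le_rfl, ?_, ?_, ?_, ?_, ?_⟩
    · exact (hp.update (by omega)).update (by omega)
    · have := hs₁.1.1 k (by omega)
      simp [Instr.exec, this, hs₂.2, hF]
    · simp [Instr.exec]
    · simp [Instr.exec, hs₁.2]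
    · simp [Instr.exec]

/-- Unbounded search with a guaranteed bound on the result. -/
theorem NatComp.search {ψ : Γ × ℕ → Prop} (hf : XPB c f)
    (hψ : Dec (c.ext fun γ => f γ + 1) ψ) (hno : ∀ γ, c.ok γ → ∀ i < f γ, ¬ ψ (γ, i))
    (hyes : ∀ γ, c.ok γ → ψ (γ, f γ)) : NatComp c f := by
  classical
  obtain ⟨-, S₃, hS₃, H₃⟩ := hψ
  obtain ⟨S, hS, hS₃S⟩ := hS₃.descend
  refine ⟨hf, fun γ => 1 + (1 + (1 + (1 + (S γ + (f γ * (1 + S γ + 1) + 1))))), ?_,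
    fun loc k hl => ?_⟩
  · exact (XPB.const 1).add ((XPB.const 1).add ((XPB.const 1).add ((XPB.const 1).add (hS.add
      ((hf.mul (((XPB.const 1).add hS).add (XPB.const 1))).add (XPB.const 1))))))
  -- Register `k` holds the candidate, `k + 1` the constant 0, `k + 2` the constant 1; the truth
  -- value of the test appears in `k + 3`, and the loop runs as long as it is 0.
  set loc' : ℕ → ℕ := fun j => if j < c.nv then loc j else k with hloc'
  have hl' : ∀ j < (c.ext fun γ => f γ + 1).nv, loc' j < k + 3 := by
    intro j _
    simp only [hloc']
    split_ifs with h
    · have := hl j h; omega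
    · omega
  obtain ⟨p₃, h₃⟩ := H₃ loc' (k + 3) hl'
  refine ⟨.seq (.instr (.natConst k 0)) (.seq (.instr (.natConst (k + 1) 0))
    (.seq (.instr (.natConst (k + 2) 1)) (.seq (.instr (.natConst (k + 1) 0)) (.seq p₃
      (.loop (.natLE (k + 3) (k + 1)) (.seq (.instr (.natAdd k k (k + 2))) p₃)))))),
    fun γ s hγ hs => ?_⟩
  have hbody : ∀ i s', i ≤ f γ → Pres k s s' → s'.x k = i →
      s'.x (k + 1) = 0 → s'.x (k + 2) = 1 → Spec p₃ s' (S γ) fun s'' =>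
        Pres k s s'' ∧ s''.x k = i ∧ s''.x (k + 1) = 0 ∧ s''.x (k + 2) = 1 ∧
          s''.x (k + 3) = if ψ (γ, i) then 1 else 0 := by
    intro i s' hi hp' hk hk1 hk2
    have hok : (c.ext fun γ => f γ + 1).ok (γ, i) := ⟨hγ, Nat.lt_succ_of_le hi⟩
    have henc : Enc (c.ext fun γ => f γ + 1) loc' (γ, i) s' := by
      have he := hs.pres hp' hl
      refine ⟨fun j hj => ?_, he.2⟩
      simp only [Ctx.ext] at hj ⊢
      simp only [hloc']
      rcases lt_or_ge j c.nv with h | h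
      · rw [if_pos h, if_neg (by omega)]
        exact he.1 j h
      · rw [if_neg (by omega), if_pos (by omega), hk]
    refine (h₃ _ s' hok henc).mono (hS₃S _ _ hγ (Nat.lt_succ_of_le hi)) fun s'' hs'' => ?_
    refine ⟨hp'.trans hs''.1 (by omega), ?_, ?_, ?_, ?_⟩
    · rw [hs''.1.1 k (by omega), hk]
    · rw [hs''.1.1 (k + 1) (by omega), hk1]
    · rw [hs''.1.1 (k + 2) (by omega), hk2]
    · rw [hs''.2]
  refine Spec.instr_seq (Spec.instr_seq (Spec.instr_seq (Spec.instr_seq ?_)))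
  refine Spec.seq (hbody 0 _ (Nat.zero_le _) ?_ ?_ ?_ ?_) fun s₁ hs₁ => ?_
  · exact ((((Pres.refl k s).update le_rfl).update (by omega)).update (by omega)).update (by omega)
  · simp [Instr.exec]
  · simp [Instr.exec]
  · simp [Instr.exec]
  refine Spec.loop (fun j s' => j ≤ f γ ∧ Pres k s s' ∧ s'.x k = f γ - j ∧
    s'.x (k + 1) = 0 ∧ s'.x (k + 2) = 1 ∧
      s'.x (k + 3) = if ψ (γ, f γ - j) then 1 else 0) ?_ ?_ _ _ ?_
  · rintro j s' ⟨hj, hp', hk, hk1, hk2, hk3⟩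
    rw [if_neg (hno γ hγ _ (by omega))] at hk3
    refine ⟨by simp [Test.Holds, hk3], ?_⟩
    refine Spec.instr_seq ((hbody (f γ - j) _ (by omega) (hp'.update le_rfl) ?_ ?_ ?_).mono le_rfl
      fun s'' hs'' => ⟨by omega, hs''⟩)
    · simp [hk, hk2]
      omega
    · simp [hk1]
    · simp [hk2]
  · rintro s' ⟨-, hp', hk, hk1, -, hk3⟩
    rw [Nat.sub_zero, if_pos (hyes γ hγ)] at hk3
    exact ⟨by simp [Test.Holds, hk1, hk3], hp', by simpa using hk⟩
  · refine ⟨le_rfl, hs₁.1, ?_⟩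
    rw [Nat.sub_self]
    exact hs₁.2

end Closure

end RealRAM

namespace RealRAM

/-! ### Bounded sums and quantifiers, products, quotients, powers and digits. -/

section Arith

variable {Γ : Type} {c : Ctx Γ} {b f g : Γ → ℕ} {φ ψ : Γ → Prop}

/-- The sum is a primitive recursion whose accumulator never exceeds the number of terms times a
uniform bound on them. Bounded quantifiers, products and quotients are all derived from it. -/
theorem NatComp.sum {h : Γ × ℕ → ℕ} (hb : NatComp c b) (hh : NatComp (c.ext b) h) :
    NatComp c fun γ => ∑ i ∈ Finset.range (b γ), h (γ, i) := by
  obtain ⟨S, hS, hhS⟩ := hh.1.descend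
  have key : ∀ γ i, Nat.rec (motive := fun _ => ℕ) 0
      (fun i a => (fun q : (Γ × ℕ) × ℕ => q.2 + h q.1) ((γ, i), a)) i =
      ∑ i ∈ Finset.range i, h (γ, i) := by
    intro γ i
    induction i with
    | zero => rfl
    | succ i ih => rw [Finset.sum_range_succ, ← ih]
  have hC : XPB c fun γ => b γ * S γ := hb.1.mul hS
  refine (NatComp.primrec hb (NatComp.const 0) hC
    (step := fun q => q.2 + h q.1) ((NatComp.last ?_).add hh.lift) ?_).congr ?_
  · exact (hC.add (XPB.const 1)).lift
  · intro γ hγ i hi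
    rw [key]
    calc _ ≤ ∑ _i ∈ Finset.range i, S γ := Finset.sum_le_sum fun j hj =>
          hhS γ j hγ (by have := Finset.mem_range.1 hj; omega)
      _ ≤ b γ * S γ := by
          rw [Finset.sum_const, Finset.card_range, smul_eq_mul]
          exact Nat.mul_le_mul_right _ hi
  · intro γ _
    rw [key]

theorem Dec.bex {χ : Γ × ℕ → Prop} (hb : NatComp c b) (hh : Dec (c.ext b) χ) :
    Dec c fun γ => ∃ i < b γ, χ (γ, i) := by
  classical
  refine (Dec.le (NatComp.const 1) (NatComp.sum hb hh)).congr fun γ _ => ?_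
  rw [Nat.one_le_iff_ne_zero, Ne, Finset.sum_eq_zero_iff]
  simp

theorem Dec.ball {χ : Γ × ℕ → Prop} (hb : NatComp c b) (hh : Dec (c.ext b) χ) :
    Dec c fun γ => ∀ i < b γ, χ (γ, i) :=
  (Dec.bex hb hh.not).not.congr fun γ _ => by push Not; rfl

theorem NatComp.mul (hf : NatComp c f) (hg : NatComp c g) : NatComp c fun γ => f γ * g γ :=
  (NatComp.sum hf hg.lift).congr fun γ _ => by simp

/-- The quotient is the number of `i < f γ` with `(i + 1) * g γ ≤ f γ`. The test `1 ≤ g γ` yields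
the value 0 for division by 0. -/
theorem NatComp.div (hf : NatComp c f) (hg : NatComp c g) : NatComp c fun γ => f γ / g γ := by
  classical
  have hl : NatComp (c.ext f) fun p => p.2 := .last hf.1
  refine (NatComp.sum hf (((Dec.le (.const 1) hg.lift).and
    (Dec.le ((hl.add (.const 1)).mul hg.lift) hf.lift)))).congr fun γ _ => ?_
  rcases Nat.eq_zero_or_pos (g γ) with h0 | h0
  · simp [h0]
  · dsimp only
    have h2 := Nat.div_le_self (f γ) (g γ)
    rw [Finset.sum_congr rfl (g := fun i => if i < f γ / g γ then 1 else 0), Finset.sum_boole,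
      Finset.range_eq_Ico, Finset.Ico_filter_lt, Nat.card_Ico, Nat.cast_id, Nat.min_eq_right h2,
      Nat.sub_zero]
    intro i _
    have h1 := Nat.le_div_iff_mul_le (x := i + 1) (y := f γ) h0
    have h3 : (1 ≤ g γ ∧ (i + 1) * g γ ≤ f γ) ↔ i < f γ / g γ := by
      rw [← h1]
      omega
    by_cases h : i < f γ / g γ
    · rw [if_pos h, if_pos (h3.2 h)]
    · rw [if_neg h, if_neg (mt h3.1 h)]

theorem NatComp.mod (hf : NatComp c f) (hg : NatComp c g) : NatComp c fun γ => f γ % g γ :=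
  (hf.sub (hg.mul (hf.div hg))).congr fun γ _ => by
    have := Nat.mod_add_div (f γ) (g γ)
    omega

/-- Bounded in terms of `K` and `δ` alone. -/
def ParamBdd {Γ : Type} (c : Ctx Γ) (f : Γ → ℕ) : Prop :=
  ∃ h : ℝ → ℝ → ℕ, ∀ γ, c.ok γ → f γ ≤ h (c.inst γ).K (c.inst γ).δ

theorem ParamBdd.lift (hf : ParamBdd c f) : ParamBdd (c.ext b) fun p => f p.1 := by
  obtain ⟨h, hh⟩ := hf
  exact ⟨h, fun p hp => hh p.1 hp.1⟩

theorem ParamBdd.last (hb : ParamBdd c b) : ParamBdd (c.ext b) fun p => p.2 := by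
  obtain ⟨h, hh⟩ := hb
  exact ⟨h, fun p hp => hp.2.le.trans (hh p.1 hp.1)⟩

theorem ParamBdd.mono (hf : ParamBdd c f) (h : ∀ γ, c.ok γ → g γ ≤ f γ) : ParamBdd c g := by
  obtain ⟨k, hk⟩ := hf
  exact ⟨k, fun γ hγ => (h γ hγ).trans (hk γ hγ)⟩

theorem ParamBdd.const (m : ℕ) : ParamBdd c fun _ => m :=
  ⟨fun _ _ => m, fun _ _ => le_rfl⟩

theorem ParamBdd.add (hf : ParamBdd c f) (hg : ParamBdd c g) :
    ParamBdd c fun γ => f γ + g γ := by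
  obtain ⟨h, hh⟩ := hf
  obtain ⟨k, hk⟩ := hg
  exact ⟨fun x y => h x y + k x y, fun γ hγ => Nat.add_le_add (hh γ hγ) (hk γ hγ)⟩

theorem ParamBdd.xpb (hf : ParamBdd c f) : XPB c f := by
  obtain ⟨h, hh⟩ := hf
  exact .param h hh

/-- The exponent has to be bounded by the parameters alone, since otherwise the value itself would
leave the class of admissible bounds. -/
theorem NatComp.pow (hf : NatComp c f) (hg : NatComp c g) (hgp : ParamBdd c g) :
    NatComp c fun γ => f γ ^ g γ := by
  obtain ⟨h, hh⟩ := hgp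
  have key : ∀ γ i, Nat.rec (motive := fun _ => ℕ) 1
      (fun i a => (fun q : (Γ × ℕ) × ℕ => q.2 * f q.1.1) ((γ, i), a)) i = f γ ^ i := by
    intro γ i
    induction i with
    | zero => rfl
    | succ i ih => rw [pow_succ, ← ih]
  -- The base is `f γ + 1` because all intermediate powers must be bounded by the last one, and for
  -- `f γ = 0` the powers of `f γ` are not monotone in the exponent.
  have hC : XPB c fun γ => (f γ + 1) ^ g γ := (hf.1.add (.const 1)).pow h hh
  refine (NatComp.primrec hg (NatComp.const 1) hC
    (step := fun q => q.2 * f q.1.1) ((NatComp.last ?_).mul hf.lift.lift) ?_).congr ?_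
  · exact (hC.add (XPB.const 1)).lift
  · intro γ hγ i hi
    rw [key]
    exact (Nat.pow_le_pow_left (Nat.le_succ _) _).trans (Nat.pow_le_pow_right (Nat.succ_pos _) hi)
  · intro γ _
    rw [key]

/-- The digit of `N` at place `k` in base `B`. -/
def dig (B N k : ℕ) : ℕ := N / B ^ k % B

theorem dig_lt {B : ℕ} (hB : 0 < B) (N k : ℕ) : dig B N k < B := Nat.mod_lt _ hB

/-- Positional notation: a search over all `N < B ^ L` is a search over all sequences of length `L`
of digits below `B`. -/
theorem exists_dig {B L : ℕ} {f : ℕ → ℕ} (hf : ∀ k < L, f k < B) :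
    ∃ N < B ^ L, ∀ k < L, dig B N k = f k := by
  let F : Fin L → Fin B := fun k => ⟨f k, hf k k.2⟩
  refine ⟨finFunctionFinEquiv F, (finFunctionFinEquiv F).2, fun k hk => ?_⟩
  have h := congrArg Fin.val (congrFun (finFunctionFinEquiv.symm_apply_apply F) ⟨k, hk⟩)
  rw [finFunctionFinEquiv_symm_apply_val] at h
  exact h

theorem NatComp.dig {B N k : Γ → ℕ} (hB : NatComp c B) (hN : NatComp c N) (hk : NatComp c k)
    (hkp : ParamBdd c k) : NatComp c fun γ => dig (B γ) (N γ) (k γ) :=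
  (hN.div (hB.pow hk hkp)).mod hB

end Arith

/-! ### Atomic tests: adjacency and linear comparisons of reals. -/

section Atoms

variable {Γ : Type} {c : Ctx Γ}

/-- Adjacency of the instance, as a relation on natural numbers. -/
def Inst.E (I : Inst) (u v : ℕ) : Prop :=
  ∃ (hu : u < I.n) (hv : v < I.n), I.G.Adj ⟨u, hu⟩ ⟨v, hv⟩

theorem Dec.adj {u v : Γ → ℕ} (hn : NatComp c fun γ => (c.inst γ).n) (hu : NatComp c u)
    (hv : NatComp c v) : Dec c fun γ => (c.inst γ).E (u γ) (v γ) := by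
  classical
  have hidx : NatComp c fun γ => u γ * (c.inst γ).n + v γ := (hu.mul hn).add hv
  have hload : Dec c fun γ => ∃ i j : Fin (c.inst γ).n, (c.inst γ).G.Adj i j ∧
      u γ * (c.inst γ).n + v γ = i.val * (c.inst γ).n + j.val := by
    refine hidx.binary (.const 0) XPB.ite 1 (fun k => .instr (.natLoad k 0 k)) ?_
    intro k γ s _ h₁ _ ha
    refine Spec.instr ⟨(Pres.refl k s).update le_rfl, ?_⟩
    simp [Instr.exec, h₁, ha, inputState]
  -- Testing `v γ < n` is enough: then the index determines row and column, and `u γ < n` follows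
  -- because the entry is nonzero only for a genuine pair.
  refine ((Dec.lt hv hn).and hload).congr fun γ _ => ⟨?_, ?_⟩
  · rintro ⟨h, h', hadj⟩
    exact ⟨h', _, _, hadj, rfl⟩
  · rintro ⟨h, i, j, hadj, he⟩
    have h1 := congrArg (· % (c.inst γ).n) he
    have h2 := congrArg (· / (c.inst γ).n) he
    have hpos : 0 < (c.inst γ).n := by omega
    simp only [Nat.mul_add_mod_self_right, Nat.mod_eq_of_lt h, Nat.mod_eq_of_lt j.2] at h1
    simp only [Nat.add_comm (_ * _), Nat.add_mul_div_right _ _ hpos, Nat.div_eq_of_lt h,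
      Nat.div_eq_of_lt j.2, Nat.zero_add] at h2
    refine ⟨by rw [h2]; exact i.2, h, ?_⟩
    convert hadj

theorem NatComp.eval_list (fs : List (Γ → ℕ)) (hfs : ∀ f ∈ fs, NatComp c f) :
    ∃ T, XPB c T ∧ ∀ (loc : ℕ → ℕ) (k : ℕ), (∀ j < c.nv, loc j < k) →
      ∃ p, ∀ γ s, c.ok γ → Enc c loc γ s → Spec p s (T γ) fun s' =>
        Pres k s s' ∧ ∀ i (hi : i < fs.length), s'.x (k + i) = fs[i] γ := by
  induction fs with
  | nil =>
    refine ⟨fun _ => 1, XPB.const 1, fun loc k _ => ⟨.instr (.natConst k 0), fun γ s _ _ => ?_⟩⟩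
    exact Spec.instr ⟨(Pres.refl k s).update le_rfl, by simp⟩
  | cons f fs ih =>
    obtain ⟨T, hT, H⟩ := ih fun g hg => hfs g (List.mem_cons_of_mem _ hg)
    obtain ⟨-, S, hS, H'⟩ := hfs f List.mem_cons_self
    refine ⟨_, hS.add hT, fun loc k hl => ?_⟩
    obtain ⟨p, hp⟩ := H' loc k hl
    obtain ⟨q, hq⟩ := H loc (k + 1) fun j hj => Nat.lt_succ_of_lt (hl j hj)
    refine ⟨.seq p q, fun γ s hγ hs => Spec.seq (hp γ s hγ hs) fun s₁ hs₁ => ?_⟩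
    refine (hq γ s₁ hγ (hs.pres hs₁.1 hl)).mono le_rfl fun s₂ hs₂ => ?_
    refine ⟨hs₁.1.trans hs₂.1 (Nat.le_succ k), fun i hi => ?_⟩
    cases i with
    | zero => exact (hs₂.1.1 k (Nat.lt_succ_self k)).trans hs₁.2
    | succ i =>
      have := hs₂.2 i (by simpa using hi)
      rw [Nat.add_right_comm] at this
      simpa [Nat.add_assoc] using this

/-- Adding a real register `e` to the real register `d`, `x a` times. -/
theorem Spec.addTimes {a o d e : ℕ} {s : State} (ho : s.x o = 1) (hao : o ≠ a) (hde : e ≠ d) :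
    Spec (.loop (.natLE o a) (.seq (.instr (.realAdd d d e)) (.instr (.natSub a a o)))) s
      (s.x a * 3 + 1) fun s' => (∀ i, i ≠ a → s'.x i = s.x i) ∧ (∀ i, i ≠ d → s'.r i = s.r i) ∧
        s'.r d = s.r d + s.x a * s.r e ∧ s'.a = s.a := by
  refine Spec.loop (fun j s' => (∀ i, i ≠ a → s'.x i = s.x i) ∧ (∀ i, i ≠ d → s'.r i = s.r i) ∧
    s'.r d + j * s.r e = s.r d + s.x a * s.r e ∧ s'.a = s.a ∧ s'.x a = j) ?_ ?_ _ _ ?_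
  · rintro j s' ⟨hx, hr, hd, ha, hj⟩
    refine ⟨by simp [Test.Holds, hj, hx o hao, ho], ?_⟩
    refine Spec.instr_seq (Spec.instr ⟨fun i hi => ?_, fun i hi => ?_, ?_, ha, ?_⟩)
    · simp [Instr.exec, hi, hx i hi]
    · simp [Instr.exec, hi, hr i hi]
    · simp only [Instr.exec, Function.update_self, hr e hde]
      push_cast at hd
      linarith
    · simp [Instr.exec, hx o hao, ho, hj]
  · rintro s' ⟨hx, hr, hd, ha, hj⟩
    exact ⟨by simp [Test.Holds, hj, hx o hao, ho], hx, hr, by simpa using hd, ha⟩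
  · exact ⟨fun _ _ => rfl, fun _ _ => rfl, rfl, rfl, rfl⟩

/-- Multiplication by a natural number is repeated addition, affordable since the coefficients obey
the same bound as running times. The real registers 2 and 3 accumulate the two sides and 4 holds 1;
`Pres` protects only the real registers 0 and 1. -/
theorem Dec.real {f₁ f₂ f₃ g₁ g₂ g₃ : Γ → ℕ} (hf₁ : NatComp c f₁) (hf₂ : NatComp c f₂)
    (hf₃ : NatComp c f₃) (hg₁ : NatComp c g₁) (hg₂ : NatComp c g₂) (hg₃ : NatComp c g₃) :
    Dec c fun γ => (f₁ γ + f₂ γ * (c.inst γ).δ + f₃ γ * (c.inst γ).K : ℝ) ≤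
      g₁ γ + g₂ γ * (c.inst γ).δ + g₃ γ * (c.inst γ).K := by
  classical
  obtain ⟨T, hT, H⟩ := NatComp.eval_list [f₁, f₂, f₃, g₁, g₂, g₃] (by
    simp only [List.mem_cons, List.not_mem_nil, or_false]
    rintro f (rfl | rfl | rfl | rfl | rfl | rfl) <;> assumption)
  refine ⟨XPB.ite, fun γ => T γ + (1 + (1 + (1 + (1 + ((f₁ γ * 3 + 1) + ((f₂ γ * 3 + 1) +
    ((f₃ γ * 3 + 1) + ((g₁ γ * 3 + 1) + ((g₂ γ * 3 + 1) + ((g₃ γ * 3 + 1) + (1 + 1))))))))))),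
    ?_, fun loc k hl => ?_⟩
  · have h1 : ∀ m, XPB c fun _ => m := XPB.const
    have h3 : ∀ {f : Γ → ℕ}, NatComp c f → XPB c fun γ => f γ * 3 + 1 := fun hf =>
      (hf.1.mul (h1 3)).add (h1 1)
    exact hT.add ((h1 1).add ((h1 1).add ((h1 1).add ((h1 1).add ((h3 hf₁).add ((h3 hf₂).add
      ((h3 hf₃).add ((h3 hg₁).add ((h3 hg₂).add ((h3 hg₃).add ((h1 1).add (h1 1))))))))))))
  obtain ⟨p, hp⟩ := H loc k hl
  let add (a d e : ℕ) : Prog :=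
    .loop (.natLE (k + 6) a) (.seq (.instr (.realAdd d d e)) (.instr (.natSub a a (k + 6))))
  refine ⟨.seq p (.seq (.instr (.natConst (k + 6) 1)) (.seq (.instr (.realConst 2 0))
    (.seq (.instr (.realConst 3 0)) (.seq (.instr (.realConst 4 1))
      (.seq (add k 2 4) (.seq (add (k + 1) 2 0) (.seq (add (k + 2) 2 1)
        (.seq (add (k + 3) 3 4) (.seq (add (k + 4) 3 0) (.seq (add (k + 5) 3 1)
          (.branch (.realLE 2 3) (.instr (.natConst k 1)) (.instr (.natConst k 0))))))))))))),
    fun γ s hγ hs => ?_⟩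
  refine Spec.seq (hp γ s hγ hs) fun s₁ ⟨hp₁, hv⟩ => ?_
  have hδ : s₁.r 0 = (c.inst γ).δ := hp₁.2.1.trans hs.2.1
  have hK : s₁.r 1 = (c.inst γ).K := hp₁.2.2.1.trans hs.2.2.1
  have v0 := hv 0 (by simp)
  have v1 := hv 1 (by simp)
  have v2 := hv 2 (by simp)
  have v3 := hv 3 (by simp)
  have v4 := hv 4 (by simp)
  have v5 := hv 5 (by simp)
  simp only [Nat.add_zero, List.getElem_cons_zero, List.getElem_cons_succ] at v0 v1 v2 v3 v4 v5
  refine Spec.instr_seq (Spec.instr_seq (Spec.instr_seq (Spec.instr_seq ?_)))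
  set s₂ := Instr.exec _ (Instr.realConst 4 1) with hs₂
  have x2 : ∀ i, i ≠ k + 6 → s₂.x i = s₁.x i := fun i hi => by simp [hs₂, Instr.exec, hi]
  have o2 : s₂.x (k + 6) = 1 := by simp [hs₂, Instr.exec]
  have a2 : s₂.a = s₁.a := by simp [hs₂, Instr.exec]
  have r20 : s₂.r 0 = s₁.r 0 := by simp [hs₂, Instr.exec]
  have r21 : s₂.r 1 = s₁.r 1 := by simp [hs₂, Instr.exec]
  have r22 : s₂.r 2 = 0 := by simp [hs₂, Instr.exec]
  have r23 : s₂.r 3 = 0 := by simp [hs₂, Instr.exec]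
  have r24 : s₂.r 4 = 1 := by simp [hs₂, Instr.exec]
  clear_value s₂
  refine Spec.seq ((Spec.addTimes (a := k) (d := 2) (e := 4) o2 (by omega) (by omega)).mono
    (by rw [x2 _ (by omega), v0]) fun _ h => h) fun s₃ ⟨x3, r3, d3, a3⟩ => ?_
  refine Spec.seq ((Spec.addTimes (a := k + 1) (d := 2) (e := 0) (by rw [x3 _ (by omega), o2])
    (by omega) (by omega)).mono (by rw [x3 _ (by omega), x2 _ (by omega), v1]) fun _ h => h)
    fun s₄ ⟨x4, r4, d4, a4⟩ => ?_
  refine Spec.seq ((Spec.addTimes (a := k + 2) (d := 2) (e := 1)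
    (by rw [x4 _ (by omega), x3 _ (by omega), o2])
    (by omega) (by omega)).mono (by rw [x4 _ (by omega), x3 _ (by omega), x2 _ (by omega), v2])
    fun _ h => h) fun s₅ ⟨x5, r5, d5, a5⟩ => ?_
  refine Spec.seq ((Spec.addTimes (a := k + 3) (d := 3) (e := 4)
    (by rw [x5 _ (by omega), x4 _ (by omega), x3 _ (by omega), o2])
    (by omega) (by omega)).mono
    (by rw [x5 _ (by omega), x4 _ (by omega), x3 _ (by omega), x2 _ (by omega), v3])
    fun _ h => h) fun s₆ ⟨x6, r6, d6, a6⟩ => ?_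
  refine Spec.seq ((Spec.addTimes (a := k + 4) (d := 3) (e := 0)
    (by rw [x6 _ (by omega), x5 _ (by omega), x4 _ (by omega), x3 _ (by omega), o2])
    (by omega) (by omega)).mono
    (by rw [x6 _ (by omega), x5 _ (by omega), x4 _ (by omega), x3 _ (by omega), x2 _ (by omega),
      v4]) fun _ h => h) fun s₇ ⟨x7, r7, d7, a7⟩ => ?_
  refine Spec.seq ((Spec.addTimes (a := k + 5) (d := 3) (e := 1)
    (by rw [x7 _ (by omega), x6 _ (by omega), x5 _ (by omega), x4 _ (by omega), x3 _ (by omega),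
      o2])
    (by omega) (by omega)).mono
    (by rw [x7 _ (by omega), x6 _ (by omega), x5 _ (by omega), x4 _ (by omega), x3 _ (by omega),
      x2 _ (by omega), v5]) fun _ h => h) fun s₈ ⟨x8, r8, d8, a8⟩ => ?_
  have hL : s₈.r 2 = f₁ γ + f₂ γ * (c.inst γ).δ + f₃ γ * (c.inst γ).K := by
    rw [r8 2 (by omega), r7 2 (by omega), r6 2 (by omega), d5, d4, d3, r22, r24,
      r4 1 (by omega), r3 1 (by omega), r3 0 (by omega), r20, r21, hδ, hK,
      x4 _ (by omega), x3 _ (by omega), x3 _ (by omega), x2 _ (by omega), x2 _ (by omega),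
      x2 _ (by omega), v0, v1, v2]
    ring
  have hR : s₈.r 3 = g₁ γ + g₂ γ * (c.inst γ).δ + g₃ γ * (c.inst γ).K := by
    rw [d8, d7, d6, r7 1 (by omega), r6 1 (by omega), r6 0 (by omega), r5 0 (by omega),
      r5 1 (by omega), r5 3 (by omega), r5 4 (by omega), r4 0 (by omega), r4 1 (by omega),
      r4 3 (by omega), r4 4 (by omega), r3 0 (by omega), r3 1 (by omega), r3 3 (by omega),
      r3 4 (by omega), r20, r21, r23, r24, hδ, hK,
      x7 _ (by omega), x6 _ (by omega), x6 _ (by omega), x5 _ (by omega), x5 _ (by omega),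
      x5 _ (by omega), x4 _ (by omega), x4 _ (by omega), x4 _ (by omega), x3 _ (by omega),
      x3 _ (by omega), x3 _ (by omega), x2 _ (by omega), x2 _ (by omega), x2 _ (by omega),
      v3, v4, v5]
    ring
  have hP : Pres k s s₈ := by
    refine hp₁.trans (l := k) ⟨fun j hj => ?_, ?_, ?_, ?_⟩ le_rfl
    · rw [x8 _ (by omega), x7 _ (by omega), x6 _ (by omega), x5 _ (by omega), x4 _ (by omega),
        x3 _ (by omega), x2 _ (by omega)]
    · rw [r8 _ (by omega), r7 _ (by omega), r6 _ (by omega), r5 _ (by omega), r4 _ (by omega),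
        r3 _ (by omega), r20]
    · rw [r8 _ (by omega), r7 _ (by omega), r6 _ (by omega), r5 _ (by omega), r4 _ (by omega),
        r3 _ (by omega), r21]
    · rw [a8, a7, a6, a5, a4, a3, a2]
  refine Spec.branch (fun h => ?_) (fun h => ?_)
  all_goals
    refine Spec.instr ⟨hP.update le_rfl, ?_⟩
    simp only [Test.Holds, hL, hR] at h
    simp [Instr.exec, h]

/-- The context without variables, apart from the number of vertices. -/
def baseCtx : Ctx Inst where
  nv := 1
  var _ I := I.n
  inst I := I
  ok _ := True

theorem NatComp.size : NatComp baseCtx fun I => I.n :=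
  NatComp.var (c := baseCtx) (i := 0) Nat.one_pos XPB.size

/-- A decidable property of instances is decided by one program within the required time. -/
theorem Dec.exists_program {φ : Inst → Prop} (h : Dec baseCtx φ) :
    ∃ (A : Prog) (f : ℝ → ℝ → ℕ), ∀ I : Inst, ∃ (t : ℕ) (s : State),
      Runs A (inputState I.G I.δ I.K) t s ∧ t ≤ max I.n 2 ^ f I.K I.δ ∧
        ((φ I ∧ s.x 0 = 1) ∨ (¬ φ I ∧ s.x 0 = 0)) := by
  obtain ⟨-, T, hT, H⟩ := h
  obtain ⟨p, hp⟩ := H id 1 fun j hj => hj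
  obtain ⟨f, hf⟩ := hT.add (XPB.const 2)
  -- The answer is computed in register 1, because register 0 holds `n`, and is then copied to
  -- register 0.
  refine ⟨.seq p (.seq (.instr (.natConst 0 0)) (.instr (.natAdd 0 0 1))), f, fun I => ?_⟩
  have henc : Enc baseCtx id I (inputState I.G I.δ I.K) := by
    refine ⟨fun j hj => ?_, by simp [inputState, baseCtx], by simp [inputState, baseCtx], rfl⟩
    obtain rfl : j = 0 := Nat.lt_one_iff.1 hj
    simp [inputState, baseCtx]
  obtain ⟨t, s, hr, ht, hQ⟩ := Spec.seq (hp I _ trivial henc) fun s' hs' =>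
    Spec.instr_seq (c := .natConst 0 0) (q := .instr (.natAdd 0 0 1)) (s := s')
      (Spec.instr (Q := fun s => (φ I ∧ s.x 0 = 1) ∨ (¬ φ I ∧ s.x 0 = 0)) (by
        by_cases hφ : φ I <;> simp [Instr.exec, hs'.2, hφ]))
  exact ⟨t, s, hr, ht.trans (hf I trivial), hQ⟩

end Atoms

end RealRAM

namespace DeltaTour

/-! ### Rounding to a finite grid -/

section Rounding

open MeasureTheory

theorem intervalIntegrable_floor (a b : ℝ) :
    IntervalIntegrable (fun y : ℝ => (⌊y⌋ : ℝ)) volume a b :=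
  Monotone.intervalIntegrable fun _ _ h => Int.cast_le.2 (Int.floor_mono h)

theorem integral_fract_unit (t : ℝ) : ∫ y in t..t + 1, Int.fract y = 1 / 2 := by
  have hper : Function.Periodic (Int.fract : ℝ → ℝ) 1 := fun x => Int.fract_add_one x
  rw [hper.intervalIntegral_add_eq t 0, zero_add, intervalIntegral.integral_of_le zero_le_one,
    ← integral_Ico_eq_integral_Ioc,
    setIntegral_congr_fun (g := fun y : ℝ => y) measurableSet_Ico
      fun y hy => Int.fract_eq_self.2 hy,
    integral_Ico_eq_integral_Ioc, ← intervalIntegral.integral_of_le zero_le_one, integral_id]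
  norm_num

theorem integral_floor_unit (t : ℝ) : ∫ y in t..t + 1, (⌊y⌋ : ℝ) = t := by
  have h : ∀ y : ℝ, Int.fract y = y - ⌊y⌋ := fun y => (Int.self_sub_floor y).symm
  have := integral_fract_unit t
  simp only [h] at this
  rw [intervalIntegral.integral_sub intervalIntegral.intervalIntegrable_id
    (intervalIntegrable_floor _ _), integral_id] at this
  linarith [this]

/-- Off the countable set of integers, `⌈y⌉ = ⌊y⌋ + 1`. -/
theorem integral_ceil (a b : ℝ) :
    ∫ y in a..b, (⌈y⌉ : ℝ) = (∫ y in a..b, (⌊y⌋ : ℝ)) + (b - a) := by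
  have h : ∀ᵐ y : ℝ, y ∈ Set.uIoc a b → (⌈y⌉ : ℝ) = ⌊y⌋ + 1 := by
    have hc : (Set.range ((↑) : ℤ → ℝ)).Countable := Set.countable_range _
    filter_upwards [hc.ae_notMem volume] with y hy _
    have h1 : (⌊y⌋ : ℝ) < y := lt_of_le_of_ne (Int.floor_le y) fun h => hy ⟨_, h⟩
    have h2 : ⌈y⌉ = ⌊y⌋ + 1 := by
      rw [Int.ceil_eq_iff]
      push_cast
      exact ⟨by linarith, (Int.lt_floor_add_one y).le⟩
    exact_mod_cast h2
  rw [intervalIntegral.integral_congr_ae h, intervalIntegral.integral_add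
    (intervalIntegrable_floor _ _) intervalIntegrable_const]
  simp

/-- A step function that jumps at the points of `ℤ ± τ`. -/
noncomputable def stepFn (τ x : ℝ) : ℤ := ⌈x - τ⌉ + ⌊x + τ⌋

theorem stepFn_intervalIntegrable (x a b : ℝ) :
    IntervalIntegrable (fun τ => (stepFn τ x : ℝ)) volume a b := by
  simp only [stepFn, Int.cast_add]
  refine IntervalIntegrable.add ?_ ?_
  · exact Antitone.intervalIntegrable fun _ _ h =>
      Int.cast_le.2 (Int.ceil_mono (sub_le_sub_left h _))
  · exact Monotone.intervalIntegrable fun _ _ h =>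
      Int.cast_le.2 (Int.floor_mono (add_le_add_right h _))

/-- After substitution the two terms are integrals of ceiling and floor over `[x - 1/2, x]` and `[x,
x + 1/2]`. Replacing ceiling by floor contributes 1/2, and the floor has integral `x - 1/2` over the
unit interval. So `stepFn` is unbiased on average, up to the factor 2. -/
theorem integral_stepFn (x : ℝ) : ∫ τ in (0 : ℝ)..1 / 2, (stepFn τ x : ℝ) = x := by
  simp only [stepFn, Int.cast_add]
  rw [intervalIntegral.integral_add
    (Antitone.intervalIntegrable fun _ _ h => Int.cast_le.2 (Int.ceil_mono (sub_le_sub_left h _)))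
    (Monotone.intervalIntegrable fun _ _ h => Int.cast_le.2 (Int.floor_mono (add_le_add_right h _))),
    intervalIntegral.integral_comp_sub_left (fun y => (⌈y⌉ : ℝ)),
    intervalIntegral.integral_comp_add_left (fun y => (⌊y⌋ : ℝ)), integral_ceil, sub_zero, add_zero]
  have h := intervalIntegral.integral_add_adjacent_intervals
    (intervalIntegrable_floor (x - 1 / 2) x) (intervalIntegrable_floor x (x + 1 / 2))
  have h' := integral_floor_unit (x - 1 / 2)
  rw [show x - 1 / 2 + 1 = x + 1 / 2 by ring] at h'
  linarith

theorem stepFn_mono (τ : ℝ) : Monotone (stepFn τ) := fun _ _ h =>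
  add_le_add (Int.ceil_mono (sub_le_sub_right h _)) (Int.floor_mono (add_le_add_left h _))

/-- Reflection interchanges the ceiling and the floor term. Together with monotonicity, this
symmetry is why rounding respects inequalities `m ≤ x + y` with integral `m`. -/
theorem stepFn_int_sub (τ x : ℝ) (m : ℤ) : stepFn τ (m - x) = 2 * m - stepFn τ x := by
  have h1 : (m : ℝ) - x - τ = m - (x + τ) := by ring
  have h2 : (m : ℝ) - x + τ = m - (x - τ) := by ring
  rw [stepFn, stepFn, h1, h2, sub_eq_add_neg (m : ℝ), sub_eq_add_neg (m : ℝ),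
    Int.ceil_intCast_add, Int.floor_intCast_add, Int.ceil_neg, Int.floor_neg]
  ring

/-- Some value is at most the average. The product form also covers a degenerate interval.
Strictness `τ < b` is needed later to see that `ρ` is fixed by the rounding. -/
theorem exists_mul_le_integral {f : ℝ → ℝ} {a b : ℝ} (hab : a ≤ b)
    (hf : IntervalIntegrable f volume a b) :
    ∃ τ, a ≤ τ ∧ τ ≤ b ∧ (a < b → τ < b) ∧ (b - a) * f τ ≤ ∫ τ in a..b, f τ := by
  rcases hab.eq_or_lt with rfl | h
  · exact ⟨a, le_rfl, le_rfl, fun h => h, by simp⟩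
  · have hf' : IntegrableOn f (Set.Ioo a b) volume :=
      ((intervalIntegrable_iff_integrableOn_Ioc_of_le hab).1 hf).mono_set Set.Ioo_subset_Ioc_self
    obtain ⟨τ, hτ, h'⟩ := exists_le_setAverage (by simp [h]) (by simp) hf'
    refine ⟨τ, hτ.1.le, hτ.2.le, fun _ => hτ.2, ?_⟩
    rw [setAverage_eq, ← integral_Ioc_eq_integral_Ioo, ← intervalIntegral.integral_of_le hab,
      smul_eq_mul, Real.volume_real_Ioo_of_le hab] at h'
    have hpos : 0 < b - a := sub_pos.2 h
    calc (b - a) * f τ ≤ (b - a) * ((b - a)⁻¹ * ∫ τ in a..b, f τ) :=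
          mul_le_mul_of_nonneg_left h' hpos.le
      _ = _ := by field_simp

/-- Every value of the rounding function is an integer, a half-integer or at distance `ρ` from an
integer. -/
theorem stepFn_pair {τ₁ τ₂ : ℝ} (h0 : 0 ≤ τ₁) (h12 : τ₁ ≤ τ₂) (h1 : τ₁ < 1 / 2)
    (h2 : τ₂ ≤ 1 / 2) (x : ℝ) : ∃ m : ℤ,
      (stepFn τ₁ x = 2 * m ∧ stepFn τ₂ x = 2 * m) ∨
      (stepFn τ₁ x = 2 * m + 1 ∧ stepFn τ₂ x = 2 * m) ∨
      (stepFn τ₁ x = 2 * m + 1 ∧ stepFn τ₂ x = 2 * m + 1) ∨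
      (stepFn τ₁ x = 2 * m + 1 ∧ stepFn τ₂ x = 2 * m + 2) := by
  simp only [stepFn]
  set p := ⌈x - τ₁⌉ with hp
  set q := ⌊x + τ₁⌋ with hq
  set p' := ⌈x - τ₂⌉ with hp'
  set q' := ⌊x + τ₂⌋ with hq'
  have a1 := Int.le_ceil (x - τ₁)
  have a2 := Int.ceil_lt_add_one (x - τ₁)
  have a3 := Int.le_ceil (x - τ₂)
  have a4 := Int.ceil_lt_add_one (x - τ₂)
  have b1 := Int.floor_le (x + τ₁)
  have b2 := Int.lt_floor_add_one (x + τ₁)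
  have b3 := Int.floor_le (x + τ₂)
  have b4 := Int.lt_floor_add_one (x + τ₂)
  rw [← hp] at a1 a2
  rw [← hp'] at a3 a4
  rw [← hq] at b1 b2
  rw [← hq'] at b3 b4
  have c1 : p' ≤ p := Int.ceil_mono (by linarith)
  have c2 : q ≤ q' := Int.floor_mono (by linarith)
  have c3 : p < q + 2 := by
    have : (p : ℝ) < (q + 2 : ℤ) := by push_cast; linarith
    exact_mod_cast this
  have c4 : q < p + 1 := by
    have : (q : ℝ) < (p + 1 : ℤ) := by push_cast; linarith
    exact_mod_cast this
  have c5 : q' ≤ p' + 1 := by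
    have : (q' : ℝ) ≤ (p' + 1 : ℤ) := by push_cast; linarith
    exact_mod_cast this
  have c6 : p < p' + 2 := by
    have : (p : ℝ) < (p' + 2 : ℤ) := by push_cast; linarith
    exact_mod_cast this
  have c7 : q' < q + 2 := by
    have : (q' : ℝ) < (q + 2 : ℤ) := by push_cast; linarith
    exact_mod_cast this
  -- If `p = q`, the value at `τ₁` is even and passing to `τ₂` changes nothing. If `p = q + 1`, it
  -- is odd, and the ceiling may drop by 1 and the floor may rise by 1.
  rcases (by omega : p = q ∨ p = q + 1) with h | h
  · have e : (p : ℝ) = q := by exact_mod_cast h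
    have d1 : p < p' + 1 := by
      have : (p : ℝ) < (p' + 1 : ℤ) := by push_cast; linarith
      exact_mod_cast this
    have d2 : q' < q + 1 := by
      have : (q' : ℝ) < (q + 1 : ℤ) := by push_cast; linarith
      exact_mod_cast this
    exact ⟨p, by omega⟩
  · exact ⟨q, by omega⟩

/-- First-moment argument. The range `[0, 1/2]` of `τ` is split at `ρ`, the distance of `δ` from the
nearest integer. Each part contains a `τ` at which the sum over the list is at most its mean there,
and weighting by the lengths of the parts gives `R`, with total at most the original one by
`integral_stepFn`. `R` is monotone and satisfies `R (m - x) = m - R x`. The choice of the split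
point makes `R` fix `δ`, and `r` is `R` conjugated by the translation by `δ`. -/
theorem exists_rounding (δ : ℝ) (l : List ℝ) : ∃ r : ℝ → ℝ, r 0 = 0 ∧ r 1 = 1 ∧ Monotone r ∧
    (∀ a b (m : ℤ), m ≤ a + b + 2 * δ → m ≤ r a + r b + 2 * δ) ∧
    (∀ a, ∃ i j : ℤ, 0 ≤ j ∧ j ≤ 2 ∧ 2 * r a = i - 2 * j * δ) ∧ (l.map r).sum ≤ l.sum := by
  set ρ : ℝ := |δ - round δ| with hρ
  have hρ0 : 0 ≤ ρ := abs_nonneg _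
  have hρ1 : ρ ≤ 1 / 2 := abs_sub_round δ
  set S : ℝ → ℝ := fun τ => (l.map fun a => (stepFn τ (a + δ) : ℝ)).sum with hS
  have hSi : ∀ a b, IntervalIntegrable S volume a b ∧
      ∫ τ in a..b, S τ = (l.map fun x => ∫ τ in a..b, (stepFn τ (x + δ) : ℝ)).sum := by
    intro a b
    simp only [hS]
    clear hS
    induction l with
    | nil => exact ⟨by simp, by simp⟩
    | cons x l ih =>
      simp only [List.map_cons, List.sum_cons]
      exact ⟨(stepFn_intervalIntegrable _ _ _).add ih.1,
        by rw [intervalIntegral.integral_add (stepFn_intervalIntegrable _ _ _) ih.1, ih.2]⟩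
  obtain ⟨τ₁, h1, h1', h1'', hI1⟩ := exists_mul_le_integral hρ0 (hSi 0 ρ).1
  obtain ⟨τ₂, h2, h2', -, hI2⟩ := exists_mul_le_integral hρ1 (hSi ρ (1 / 2)).1
  have hτ : τ₁ < 1 / 2 := by
    rcases hρ0.eq_or_lt with h | h
    · linarith
    · linarith [h1'' h]
  set R : ℝ → ℝ := fun x => ρ * stepFn τ₁ x + (1 / 2 - ρ) * stepFn τ₂ x with hR
  have hRmono : Monotone R := fun x y h => add_le_add
    (mul_le_mul_of_nonneg_left (Int.cast_le.2 (stepFn_mono _ h)) hρ0)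
    (mul_le_mul_of_nonneg_left (Int.cast_le.2 (stepFn_mono _ h)) (by linarith))
  have hRsub : ∀ (m : ℤ) x, R (m - x) = m - R x := by
    intro m x
    simp only [hR, stepFn_int_sub]
    push_cast
    ring
  -- For `ρ = 0` and `ρ = 1/2` this is forced by the symmetry. Otherwise `τ₁ < ρ ≤ τ₂` gives the two
  -- step functions the values 1 and 0 at `ρ`, and the weight of the first is `ρ`.
  have hRρ : R ρ = ρ := by
    rcases hρ0.eq_or_lt with h | h
    · have := hRsub 0 0
      rw [Int.cast_zero, sub_zero] at this
      rw [← h]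
      linarith
    rcases hρ1.eq_or_lt with h' | h'
    · have := hRsub 1 (1 / 2)
      rw [Int.cast_one, show (1 : ℝ) - 1 / 2 = 1 / 2 by norm_num] at this
      rw [h']
      linarith
    have h3 := h1'' h
    have e1 : ⌈ρ - τ₁⌉ = 1 := Int.ceil_eq_iff.2 ⟨by push_cast; linarith, by push_cast; linarith⟩
    have e2 : ⌊ρ + τ₁⌋ = 0 := Int.floor_eq_zero_iff.2 ⟨by linarith, by linarith⟩
    have e3 : ⌈ρ - τ₂⌉ = 0 := Int.ceil_eq_iff.2 ⟨by push_cast; linarith, by push_cast; linarith⟩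
    have e4 : ⌊ρ + τ₂⌋ = 0 := Int.floor_eq_zero_iff.2 ⟨by linarith, by linarith⟩
    simp only [hR, stepFn, e1, e2, e3, e4]
    push_cast
    ring
  have hRδ : R δ = δ := by
    rcases abs_cases (δ - round δ) with ⟨h, -⟩ | ⟨h, -⟩
    · have e1 := hRsub (round δ) (-ρ)
      have e2 := hRsub 0 ρ
      rw [show ((round δ : ℤ) : ℝ) - -ρ = δ by rw [hρ, h]; ring] at e1
      rw [show ((0 : ℤ) : ℝ) - ρ = -ρ by simp] at e2
      rw [e1, e2, hRρ, hρ, h]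
      push_cast
      ring
    · have e1 := hRsub (round δ) ρ
      rw [show ((round δ : ℤ) : ℝ) - ρ = δ by rw [hρ, h]; ring] at e1
      rw [e1, hRρ, hρ, h]
      ring
  have hR1 : R (1 + δ) = 1 + δ := by
    have e1 := hRsub 1 (-δ)
    have e2 := hRsub 0 δ
    rw [show ((0 : ℤ) : ℝ) - δ = -δ by simp] at e2
    rw [show ((1 : ℤ) : ℝ) - -δ = 1 + δ by push_cast; ring, e2, hRδ] at e1
    rw [e1]
    push_cast
    ring
  -- The hypothesis `m ≤ a + b + 2δ` reads `m - (b + δ) ≤ a + δ`; applying `R` and reflecting gives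
  -- the same inequality for the rounded values.
  refine ⟨fun a => R (a + δ) - δ, by simp [hRδ], by simp [hR1],
    fun a b h => sub_le_sub_right (hRmono (by linarith)) _, fun a b m h => ?_, fun a => ?_, ?_⟩
  · have := hRmono (show (m : ℝ) - (b + δ) ≤ a + δ by linarith)
    rw [hRsub] at this
    linarith
  -- The four cases are `R = m`, `m + ρ`, `m + 1/2` and `m + 1 - ρ`. Where `ρ` occurs, the sign of
  -- `δ - round δ` decides whether the term in `δ` cancels or doubles.
  · obtain ⟨m, h | h | h | h⟩ := stepFn_pair h1 (h1'.trans h2) hτ h2' (a + δ)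
    · refine ⟨2 * m, 1, by norm_num, by norm_num, ?_⟩
      simp only [hR, h.1, h.2]
      push_cast
      ring
    · rcases abs_cases (δ - round δ) with ⟨h', -⟩ | ⟨h', -⟩
      · refine ⟨2 * m - 2 * round δ, 0, by norm_num, by norm_num, ?_⟩
        simp only [hR, h.1, h.2, hρ, h']
        push_cast
        ring
      · refine ⟨2 * m + 2 * round δ, 2, by norm_num, by norm_num, ?_⟩
        simp only [hR, h.1, h.2, hρ, h']
        push_cast
        ring
    · refine ⟨2 * m + 1, 1, by norm_num, by norm_num, ?_⟩
      simp only [hR, h.1, h.2]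
      push_cast
      ring
    · rcases abs_cases (δ - round δ) with ⟨h', -⟩ | ⟨h', -⟩
      · refine ⟨2 * m + 2 + 2 * round δ, 2, by norm_num, by norm_num, ?_⟩
        simp only [hR, h.1, h.2, hρ, h']
        push_cast
        ring
      · refine ⟨2 * m + 2 - 2 * round δ, 0, by norm_num, by norm_num, ?_⟩
        simp only [hR, h.1, h.2, hρ, h']
        push_cast
        ring
  · have hsum : ∀ l' : List ℝ, (l'.map fun a => R (a + δ) - δ).sum =
        ρ * (l'.map fun a => (stepFn τ₁ (a + δ) : ℝ)).sum +
          (1 / 2 - ρ) * (l'.map fun a => (stepFn τ₂ (a + δ) : ℝ)).sum - l'.length * δ := by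
      intro l'
      induction l' with
      | nil => simp
      | cons a l' ih =>
        rw [List.map_cons, List.sum_cons, ih]
        simp only [List.map_cons, List.sum_cons, List.length_cons, hR]
        push_cast
        ring
    have hint : ∀ l' : List ℝ,
        (l'.map fun x => ∫ τ in (0 : ℝ)..ρ, (stepFn τ (x + δ) : ℝ)).sum +
          (l'.map fun x => ∫ τ in ρ..1 / 2, (stepFn τ (x + δ) : ℝ)).sum =
        l'.sum + l'.length * δ := by
      intro l'
      induction l' with
      | nil => simp
      | cons a l' ih =>
        have := intervalIntegral.integral_add_adjacent_intervals
          (stepFn_intervalIntegrable (a + δ) 0 ρ) (stepFn_intervalIntegrable (a + δ) ρ (1 / 2))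
        rw [integral_stepFn] at this
        simp only [List.map_cons, List.sum_cons, List.length_cons]
        push_cast
        linarith
    rw [(hSi 0 ρ).2] at hI1
    rw [(hSi ρ (1 / 2)).2] at hI2
    have := hint l
    rw [hsum l]
    simp only [sub_zero, hS] at hI1 hI2
    linarith

end Rounding

end DeltaTour

namespace DeltaTour

variable {V : Type*} [DecidableEq V] {G : SimpleGraph V}

/-! ### Points on edges -/

/-- A vertex as a point. -/
def vtx (v : V) : V → ℝ := Pi.single v 1

theorem pt_zero (u v : V) : pt u v 0 = vtx u := by simp [pt, vtx]

theorem pt_one (u v : V) : pt u v 1 = vtx v := by simp [pt, vtx]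

theorem pt_symm (u v : V) (t : ℝ) : pt u v t = pt v u (1 - t) := by
  simp only [pt, sub_sub_cancel]
  rw [add_comm]

theorem vtx_injective : Function.Injective (vtx : V → V → ℝ) := fun u v h => by
  by_contra hne
  have := congrFun h u
  simp [vtx, hne] at this

theorem pt_apply (u v w : V) (t : ℝ) :
    pt u v t w = (1 - t) * (if w = u then 1 else 0) + t * (if w = v then 1 else 0) := by
  simp [pt, Pi.single_apply]

theorem pt_eq_vtx {u v w : V} {t : ℝ} (huv : u ≠ v) (h : pt u v t = vtx w) :
    (t = 0 ∧ u = w) ∨ (t = 1 ∧ v = w) := by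
  have h1 := congrFun h w
  rw [pt_apply, vtx, Pi.single_eq_same] at h1
  by_cases hu : w = u
  · have hv : w ≠ v := hu ▸ huv
    simp only [hu, if_true, huv, if_false] at h1
    exact .inl ⟨by linarith, hu.symm⟩
  · by_cases hv : w = v
    · simp only [hv, if_true, huv.symm, if_false] at h1
      exact .inr ⟨by linarith, hv.symm⟩
    · simp [hu, hv] at h1

theorem pt_eq_cases {u v x y : V} {a b : ℝ} (huv : u ≠ v) (hxy : x ≠ y)
    (h : pt u v a = pt x y b) :
    (u = x ∧ v = y ∧ a = b) ∨ (u = y ∧ v = x ∧ a = 1 - b) ∨ ∃ w, pt u v a = vtx w := by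
  by_cases ha0 : a = 0
  · exact .inr (.inr ⟨u, by rw [ha0, pt_zero]⟩)
  by_cases ha1 : a = 1
  · exact .inr (.inr ⟨v, by rw [ha1, pt_one]⟩)
  have ha1' : (1 : ℝ) - a ≠ 0 := fun h => ha1 (by linarith)
  have hu := congrFun h u
  have hv := congrFun h v
  simp only [pt_apply, if_true, huv, huv.symm, if_false, mul_one, mul_zero, add_zero,
    zero_add] at hu hv
  by_cases h1 : u = x
  · subst h1
    have h2 : v = y := by
      by_contra h2
      simp [huv.symm, h2] at hv
      exact ha0 hv
    subst h2
    simp [huv.symm] at hv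
    exact .inl ⟨rfl, rfl, hv⟩
  · have h2 : u = y := by
      by_contra h2
      simp [h1, h2] at hu
      exact ha1' hu
    subst h2
    have h3 : v = x := by
      by_contra h3
      simp [huv.symm, h3] at hv
      exact ha0 hv
    subst h3
    simp [huv.symm] at hv
    exact .inr (.inl ⟨rfl, rfl, hv⟩)

theorem pt_injective {u v : V} (h : u ≠ v) : Function.Injective (pt u v) := fun a b hab => by
  have := congrFun hab v
  simpa [pt_apply, h.symm] using this

theorem vtx_mem_pointSet (v : V) : vtx v ∈ pointSet G := .inl ⟨v, rfl⟩

theorem pt_mem_pointSet {u v : V} (h : G.Adj u v) {t : ℝ} (ht : t ∈ Set.Icc (0 : ℝ) 1) :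
    pt u v t ∈ pointSet G := .inr ⟨u, v, h, t, ht, rfl⟩

theorem one_sub_mem {t : ℝ} (ht : t ∈ Set.Icc (0 : ℝ) 1) : 1 - t ∈ Set.Icc (0 : ℝ) 1 :=
  ⟨by linarith [ht.2], by linarith [ht.1]⟩

/-- The parametrizations of an edge through a vertex can be turned so that the vertex is the
origin. -/
theorem SameEdge.of_vtx {c : V} {q : V → ℝ} (h : SameEdge G (vtx c) q) :
    ∃ w, G.Adj c w ∧ ∃ μ ∈ Set.Icc (0 : ℝ) 1, q = pt c w μ := by
  obtain ⟨u, v, huv, s, hs, t, ht, hx, rfl⟩ := h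
  rcases pt_eq_vtx huv.ne hx.symm with ⟨-, rfl⟩ | ⟨-, rfl⟩
  · exact ⟨v, huv, t, ht, rfl⟩
  · exact ⟨u, huv.symm, 1 - t, one_sub_mem ht, pt_symm _ _ _⟩

theorem SameEdge.symm {p q : V → ℝ} (h : SameEdge G p q) : SameEdge G q p := by
  obtain ⟨u, v, huv, s, hs, t, ht, hx, hy⟩ := h
  exact ⟨u, v, huv, t, ht, s, hs, hy, hx⟩

theorem SameEdge.of_inner {u v : V} {a : ℝ} {q : V → ℝ} (huv : G.Adj u v)
    (hn : ∀ w, pt u v a ≠ vtx w) (h : SameEdge G (pt u v a) q) :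
    ∃ μ ∈ Set.Icc (0 : ℝ) 1, q = pt u v μ := by
  obtain ⟨x, y, hxy, s, hs, t, ht, hx, rfl⟩ := h
  rcases pt_eq_cases huv.ne hxy.ne hx with ⟨rfl, rfl, -⟩ | ⟨rfl, rfl, -⟩ | ⟨w, hw⟩
  · exact ⟨t, ht, rfl⟩
  · exact ⟨1 - t, one_sub_mem ht, pt_symm _ _ _⟩
  · exact absurd hw (hn w)

theorem SameEdge.cases {x y : V} {t : ℝ} {q : V → ℝ} (hxy : G.Adj x y)
    (h : SameEdge G (pt x y t) q) :
    (∃ μ ∈ Set.Icc (0 : ℝ) 1, q = pt x y μ) ∨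
      (t = 0 ∧ ∃ z, G.Adj x z ∧ ∃ μ ∈ Set.Icc (0 : ℝ) 1, q = pt x z μ) ∨
      (t = 1 ∧ ∃ z, G.Adj y z ∧ ∃ μ ∈ Set.Icc (0 : ℝ) 1, q = pt y z μ) := by
  by_cases hn : ∃ w, pt x y t = vtx w
  · obtain ⟨w, hw⟩ := hn
    rw [hw] at h
    rcases pt_eq_vtx hxy.ne hw with ⟨h0, rfl⟩ | ⟨h0, rfl⟩
    · exact .inr (.inl ⟨h0, h.of_vtx⟩)
    · exact .inr (.inr ⟨h0, h.of_vtx⟩)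
  · push Not at hn
    exact .inl (h.of_inner hxy hn)

theorem mem_edgeSegment_left {p q : V → ℝ} (h : SameEdge G p q) : p ∈ edgeSegment G p q := by
  obtain ⟨u, v, huv, s, hs, t, ht, hx, hy⟩ := h
  exact ⟨u, v, huv, s, hs, t, ht, hx, hy, s, min_le_left _ _, le_max_left _ _, hx⟩

theorem pt_mem_edgeSegment {u v : V} (huv : G.Adj u v) {s t r : ℝ} (hs : s ∈ Set.Icc (0 : ℝ) 1)
    (ht : t ∈ Set.Icc (0 : ℝ) 1) (h1 : min s t ≤ r) (h2 : r ≤ max s t) :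
    pt u v r ∈ edgeSegment G (pt u v s) (pt u v t) :=
  ⟨u, v, huv, s, hs, t, ht, rfl, rfl, r, h1, h2, rfl⟩

/-- Two distinct points determine the edge they lie on, so all parametrizations admitted in
`edgeSegment` describe the same segment up to reversal. -/
theorem edgeSegment_subset {u v : V} (huv : G.Adj u v) {s t : ℝ} (hst : s ≠ t) {z : V → ℝ}
    (hz : z ∈ edgeSegment G (pt u v s) (pt u v t)) :
    ∃ r, min s t ≤ r ∧ r ≤ max s t ∧ z = pt u v r := by
  obtain ⟨x, y, hxy, s', hs', t', ht', h1, h2, r, hr1, hr2, rfl⟩ := hz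
  have key : (u = x ∧ v = y) ∨ (u = y ∧ v = x) := by
    rcases pt_eq_cases huv.ne hxy.ne h1 with h | h | ⟨w, hw⟩
    · exact .inl ⟨h.1, h.2.1⟩
    · exact .inr ⟨h.1, h.2.1⟩
    rcases pt_eq_cases huv.ne hxy.ne h2 with h | h | ⟨w', hw'⟩
    · exact .inl ⟨h.1, h.2.1⟩
    · exact .inr ⟨h.1, h.2.1⟩
    have e1 := pt_eq_vtx hxy.ne (h1 ▸ hw)
    have e2 := pt_eq_vtx hxy.ne (h2 ▸ hw')
    have e3 := pt_eq_vtx huv.ne hw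
    have e4 := pt_eq_vtx huv.ne hw'
    have n1 := huv.ne
    have n2 := hxy.ne
    grind
  rcases key with ⟨rfl, rfl⟩ | ⟨rfl, rfl⟩
  · have i1 : s = s' := pt_injective huv.ne h1
    have i2 : t = t' := pt_injective huv.ne h2
    subst i1 i2
    exact ⟨r, hr1, hr2, rfl⟩
  · rw [pt_symm v u] at h1 h2
    have i1 : s = 1 - s' := pt_injective huv.ne h1
    have i2 : t = 1 - t' := pt_injective huv.ne h2
    refine ⟨1 - r, ?_, ?_, pt_symm _ _ _⟩
    · rw [min_le_iff]
      rcases le_max_iff.1 hr2 with h | h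
      · left; linarith
      · right; linarith
    · rw [le_max_iff]
      rcases min_le_iff.1 hr1 with h | h
      · left; linarith
      · right; linarith

end DeltaTour

namespace DeltaTour

variable {V : Type*} [DecidableEq V] {G : SimpleGraph V}

section

variable [Fintype V]

/-! ### Walks as an inductive relation -/

/-- There is a walk from one point to another with the given length and set of passed points. -/
inductive Trail (G : SimpleGraph V) : (V → ℝ) → (V → ℝ) → ℝ → Set (V → ℝ) → Prop
  | nil {x : V → ℝ} (hx : x ∈ pointSet G) : Trail G x x 0 {x}
  | cons {x y z : V → ℝ} {ℓ : ℝ} {P : Set (V → ℝ)} (hx : x ∈ pointSet G) (hne : x ≠ y)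
      (h : SameEdge G x y) (ht : Trail G y z ℓ P) :
      Trail G x z (dist x y + ℓ) (edgeSegment G x y ∪ P)

theorem trail_of_isWalk : ∀ (w : List (V → ℝ)) (x y : V → ℝ), IsWalk G w → w.head? = some x →
    w.getLast? = some y → Trail G x y (walkLength w) (passedPoints G w)
  | [], x, y, _, h, _ => by simp at h
  | [a], x, y, hw, h, h' => by
    simp only [List.head?_cons, Option.some.injEq, List.getLast?_singleton] at h h'
    subst h h'
    exact .nil (hw.2.1 a List.mem_cons_self)
  | a :: b :: w, x, y, hw, h, h' => by
    simp only [List.head?_cons, Option.some.injEq] at h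
    subst h
    have hc := List.isChain_cons_cons.1 hw.2.2
    refine .cons (hw.2.1 a List.mem_cons_self) hc.1.1 hc.1.2 (trail_of_isWalk (b :: w) b y
      ⟨List.cons_ne_nil _ _, fun z hz => hw.2.1 z (List.mem_cons_of_mem _ hz), hc.2⟩ rfl ?_)
    rw [← h', List.getLast?_cons_cons]

theorem Trail.exists_list {x y : V → ℝ} {ℓ : ℝ} {P : Set (V → ℝ)} (h : Trail G x y ℓ P) :
    ∃ w, IsWalk G w ∧ w.head? = some x ∧ w.getLast? = some y ∧ walkLength w = ℓ ∧
      passedPoints G w = P := by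
  induction h with
  | nil hx =>
    exact ⟨[_], ⟨List.cons_ne_nil _ _, by simpa using hx, List.isChain_singleton _⟩, rfl, rfl, rfl,
      rfl⟩
  | @cons x y z ℓ P hx hne hs _ ih =>
    obtain ⟨w, hw, hh, hl, rfl, rfl⟩ := ih
    obtain _ | ⟨a, w⟩ := w
    · simp at hh
    simp only [List.head?_cons, Option.some.injEq] at hh
    subst hh
    refine ⟨x :: a :: w, ⟨List.cons_ne_nil _ _, ?_, List.isChain_cons_cons.2 ⟨⟨hne, hs⟩, hw.2.2⟩⟩,
      rfl, ?_, rfl, rfl⟩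
    · intro p hp
      rcases List.mem_cons.1 hp with rfl | hp
      · exact hx
      · exact hw.2.1 p hp
    · rw [List.getLast?_cons_cons, hl]

theorem Trail.length_nonneg {x y : V → ℝ} {ℓ : ℝ} {P : Set (V → ℝ)} (h : Trail G x y ℓ P) :
    0 ≤ ℓ := by
  induction h with
  | nil => exact le_rfl
  | cons _ _ _ _ ih => exact add_nonneg dist_nonneg ih

theorem Trail.start_mem {x y : V → ℝ} {ℓ : ℝ} {P : Set (V → ℝ)} (h : Trail G x y ℓ P) :
    x ∈ P := by
  cases h with
  | nil => rfl
  | cons _ _ hs _ => exact .inl (mem_edgeSegment_left hs)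

theorem Trail.trans {x y z : V → ℝ} {ℓ ℓ' : ℝ} {P P' : Set (V → ℝ)} (h : Trail G x y ℓ P)
    (h' : Trail G y z ℓ' P') : Trail G x z (ℓ + ℓ') (P ∪ P') := by
  induction h with
  | nil =>
    rw [zero_add, Set.singleton_union, Set.insert_eq_of_mem h'.start_mem]
    exact h'
  | cons hx hne hs _ ih =>
    rw [add_assoc, Set.union_assoc]
    exact .cons hx hne hs (ih h')

theorem Trail.edge {u v : V} (huv : G.Adj u v) {s t : ℝ} (hs : s ∈ Set.Icc (0 : ℝ) 1)
    (ht : t ∈ Set.Icc (0 : ℝ) 1) :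
    ∃ P, Trail G (pt u v s) (pt u v t) |s - t| P ∧
      ∀ r, min s t ≤ r → r ≤ max s t → pt u v r ∈ P := by
  by_cases hst : s = t
  · subst hst
    refine ⟨_, by simpa using Trail.nil (pt_mem_pointSet huv hs), fun r h1 h2 => ?_⟩
    rw [min_self] at h1
    rw [max_self] at h2
    rw [le_antisymm h2 h1]
    rfl
  · have := Trail.cons (pt_mem_pointSet huv hs) (fun h => hst (pt_injective huv.ne h))
      ⟨u, v, huv, s, hs, t, ht, rfl, rfl⟩ (Trail.nil (pt_mem_pointSet huv ht))
    rw [add_zero, dist_pt huv.ne] at this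
    exact ⟨_, this, fun r h1 h2 => .inl (pt_mem_edgeSegment huv hs ht h1 h2)⟩

theorem Trail.edge_vtx {u v : V} (huv : G.Adj u v) :
    ∃ P, Trail G (vtx u) (vtx v) 1 P ∧ ∀ r, 0 ≤ r → r ≤ 1 → pt u v r ∈ P := by
  obtain ⟨P, hP, h⟩ := Trail.edge huv (s := 0) (t := 1) (by simp) (by simp)
  rw [pt_zero, pt_one] at hP
  exact ⟨P, by simpa using hP, fun r h0 h1 => h r (by simpa) (by simpa)⟩

/-- A trail passing a vertex has it as a stopping point. -/
theorem Trail.split_vtx {x y : V → ℝ} {ℓ : ℝ} {P : Set (V → ℝ)} (h : Trail G x y ℓ P) {c : V}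
    (hc : vtx c ∈ P) : ∃ ℓ₁ P₁ ℓ₂ P₂, Trail G x (vtx c) ℓ₁ P₁ ∧ Trail G (vtx c) y ℓ₂ P₂ ∧
      ℓ = ℓ₁ + ℓ₂ ∧ P ⊆ P₁ ∪ P₂ := by
  induction h with
  | @nil x hx =>
    rw [Set.mem_singleton_iff] at hc
    subst hc
    exact ⟨_, _, _, _, .nil hx, .nil hx, by simp, by simp⟩
  | @cons x y z ℓ P hx hne hs ht ih =>
    have hxy : vtx c = x ∨ vtx c ∈ P := by
      rcases hc with ⟨u, v, huv, s, hs', t, ht', rfl, rfl, r, h1, h2, hr⟩ | hc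
      -- A vertex has position 0 or 1, the extreme positions of an edge, so within a segment it can
      -- only be an end.
      · have hst : r = s ∨ r = t := by
          rcases pt_eq_vtx huv.ne hr.symm with ⟨rfl, -⟩ | ⟨rfl, -⟩
          · rcases min_le_iff.1 h1 with h | h
            · exact .inl (le_antisymm hs'.1 h)
            · exact .inr (le_antisymm ht'.1 h)
          · rcases le_max_iff.1 h2 with h | h
            · exact .inl (le_antisymm h hs'.2)
            · exact .inr (le_antisymm h ht'.2)
        rcases hst with rfl | rfl
        · exact .inl hr
        · exact .inr (hr ▸ ht.start_mem)
      · exact .inr hc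
    rcases hxy with rfl | hc'
    · exact ⟨_, _, _, _, .nil hx, .cons hx hne hs ht, by simp, Set.subset_union_right⟩
    · obtain ⟨ℓ₁, P₁, ℓ₂, P₂, h₁, h₂, rfl, hP⟩ := ih hc'
      refine ⟨_, _, _, _, .cons hx hne hs h₁, h₂, by ring, ?_⟩
      rw [Set.union_assoc]
      exact Set.union_subset_union_right _ hP

/-- A trail either passes a vertex or stays in the interior of an edge. -/
theorem Trail.vtx_or_inner {x z : V → ℝ} {ℓ : ℝ} {P : Set (V → ℝ)} (h : Trail G x z ℓ P) :
    (∃ c : V, vtx c ∈ P) ∨ ∃ u v a b s t, G.Adj u v ∧ 0 ≤ s ∧ s ≤ a ∧ a ≤ t ∧ s ≤ b ∧ b ≤ t ∧ t ≤ 1 ∧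
      x = pt u v a ∧ z = pt u v b ∧ (∀ w, x ≠ vtx w) ∧ 2 * (t - s) - |a - b| ≤ ℓ ∧
        ∀ p ∈ P, ∃ r, s ≤ r ∧ r ≤ t ∧ p = pt u v r := by
  induction h with
  | @nil x hx =>
    rcases hx with ⟨v, rfl⟩ | ⟨u, v, huv, t, ht, rfl⟩
    · exact .inl ⟨v, rfl⟩
    · by_cases hn : ∃ w, pt u v t = vtx w
      · obtain ⟨w, hw⟩ := hn
        exact .inl ⟨w, hw.symm⟩
      · push Not at hn
        refine .inr ⟨u, v, t, t, t, t, huv, ht.1, le_rfl, le_rfl, le_rfl, le_rfl, ht.2, rfl,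
          rfl, hn, by simp, ?_⟩
        rintro p rfl
        exact ⟨t, le_rfl, le_rfl, rfl⟩
  | @cons x y z ℓ P hx hne hs ht ih =>
    rcases ih with ⟨c, hc⟩ | ⟨u, v, a, b, s, t, huv, h0, hsa, hat, hsb, hbt, h1, rfl, rfl, hn,
      hℓ, hP⟩
    · exact .inl ⟨c, .inr hc⟩
    by_cases hv : ∃ w, x = vtx w
    · obtain ⟨w, rfl⟩ := hv
      exact .inl ⟨w, .inl (mem_edgeSegment_left hs)⟩
    push Not at hv
    obtain ⟨a', ha', rfl⟩ := hs.symm.of_inner huv hn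
    have haa : a' ≠ a := fun h => hne (h ▸ rfl)
    -- The interval `[s, t]` is the range of positions visited so far. What lies outside the stretch
    -- between the first position and the last is traversed at least twice, whence the bound `2 * (t
    -- - s) - |a - b|`.
    refine .inr ⟨u, v, a', b, min s a', max t a', huv, le_min h0 ha'.1, min_le_right _ _,
      le_max_right _ _, (min_le_left _ _).trans hsb, hbt.trans (le_max_left _ _), max_le h1 ha'.2,
      rfl, rfl, hv, ?_, ?_⟩
    · rw [dist_pt huv.ne]
      have e1 := abs_sub_le a a' b
      rw [abs_sub_comm a a'] at e1
      rcases le_total a' s with h | h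
      · rw [min_eq_right h, max_eq_left (by linarith)]
        have : |a' - a| = a - a' := by rw [abs_sub_comm, abs_of_nonneg]; linarith
        cases abs_cases (a' - b) <;> cases abs_cases (a - b) <;> linarith
      · rw [min_eq_left h]
        rcases le_total a' t with h' | h'
        · rw [max_eq_left h']
          linarith
        · rw [max_eq_right h']
          have : |a' - a| = a' - a := abs_of_nonneg (by linarith)
          cases abs_cases (a' - b) <;> cases abs_cases (a - b) <;> linarith
    · rintro p (hp | hp)
      · obtain ⟨r, hr1, hr2, rfl⟩ := edgeSegment_subset huv haa hp
        refine ⟨r, le_trans (le_min (min_le_right _ _) ?_) hr1, hr2.trans (max_le ?_ ?_), rfl⟩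
        · exact (min_le_left _ _).trans hsa
        · exact le_max_right _ _
        · exact hat.trans (le_max_left _ _)
      · obtain ⟨r, hr1, hr2, rfl⟩ := hP p hp
        exact ⟨r, (min_le_left _ _).trans hr1, hr2.trans (le_max_left _ _), rfl⟩

end

/-! ### Decomposition of a walk into edge traversals and detours into edges -/

/-- The points that lie on one of the vertices `vs`, on one of the edges `tr`, or on one of the
initial pieces `dg u v α` of edges, from `u` to `pt u v α`. -/
def skeleton (vs : V → Prop) (tr : V → V → Prop) (dg : V → V → ℝ → Prop) : Set (V → ℝ) :=
  {z | (∃ w, vs w ∧ z = vtx w) ∨ (∃ x y, tr x y ∧ ∃ r ∈ Set.Icc (0 : ℝ) 1, z = pt x y r) ∨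
    ∃ u v α, dg u v α ∧ ∃ r ∈ Set.Icc 0 α, z = pt u v r}

/-- The skeleton of a graph walk with a list of detours. -/
def walkSkeleton {c d : V} (W : G.Walk c d) (l : List (V × V × ℝ)) : Set (V → ℝ) :=
  skeleton (· ∈ W.support) (fun x y => s(x, y) ∈ W.edges) fun u v α => (u, v, α) ∈ l

/-- The detours start on the walk. -/
def Detours {c d : V} (W : G.Walk c d) (l : List (V × V × ℝ)) : Prop :=
  ∀ u v α, (u, v, α) ∈ l → u ∈ W.support ∧ G.Adj u v ∧ α ∈ Set.Icc (0 : ℝ) 1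

/-- The length of a tour along a graph walk with detours. -/
def cost {c d : V} (W : G.Walk c d) (l : List (V × V × ℝ)) : ℝ :=
  W.length + 2 * (l.map fun p => p.2.2).sum

theorem walkSkeleton_cons_list {c d : V} (W : G.Walk c d) (l : List (V × V × ℝ))
    (p : V × V × ℝ) : walkSkeleton W l ⊆ walkSkeleton W (p :: l) := by
  rintro z (h | h | ⟨u, v, α, h, h'⟩)
  · exact .inl h
  · exact .inr (.inl h)
  · exact .inr (.inr ⟨u, v, α, List.mem_cons_of_mem _ h, h'⟩)

theorem walkSkeleton_cons_walk {b c d : V} (h : G.Adj b c) (W : G.Walk c d)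
    (l : List (V × V × ℝ)) : walkSkeleton W l ⊆ walkSkeleton (.cons h W) l := by
  rintro z (⟨w, hw, hz⟩ | ⟨x, y, hxy, hz⟩ | hz)
  · exact .inl ⟨w, by simp only [SimpleGraph.Walk.support_cons, List.mem_cons]; exact .inr hw, hz⟩
  · exact .inr (.inl ⟨x, y,
      by simp only [SimpleGraph.Walk.edges_cons, List.mem_cons]; exact .inr hxy, hz⟩)
  · exact .inr (.inr hz)

/-- A walk to the vertex `d` that starts at the position `a` of an edge is at least as long as one
that goes on to the position `α` and then leaves the edge through its origin. -/
def Leaves (G : SimpleGraph V) (d : V) (x : V → ℝ) (ℓ : ℝ) (P : Set (V → ℝ)) : Prop :=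
  ∃ (u v : V) (a α : ℝ) (W : G.Walk u d) (l : List (V × V × ℝ)), 0 ≤ a ∧ a ≤ α ∧ α ≤ 1 ∧
    x = pt u v a ∧ (G.Adj u v ∨ α = 0) ∧ Detours W l ∧ 2 * α - a + cost W l ≤ ℓ ∧
      ∀ p ∈ P, (∃ r ∈ Set.Icc 0 α, p = pt u v r) ∨ p ∈ walkSkeleton W l

/-- A vertex has position 0 or 1 on the edge. At 0, the excursion to `α` is a detour of cost `2 *
α`. At 1, also `α = 1`, and the remaining cost `2 * α - a = 1` is that of crossing the edge, which
becomes a new first step of the walk. -/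
theorem Leaves.resolve {d c : V} {ℓ : ℝ} {P : Set (V → ℝ)} (h : Leaves G d (vtx c) ℓ P) :
    ∃ (W : G.Walk c d) (l : List (V × V × ℝ)), Detours W l ∧ cost W l ≤ ℓ ∧
      P ⊆ walkSkeleton W l := by
  obtain ⟨u, v, a, α, W, l, h0, haα, hα1, hx, hadj, hl, hℓ, hP⟩ := h
  rcases hadj with hadj | rfl
  · rcases pt_eq_vtx hadj.ne hx.symm with ⟨rfl, rfl⟩ | ⟨rfl, rfl⟩
    · refine ⟨W, (u, v, α) :: l, ?_, ?_, fun p hp => ?_⟩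
      · intro u' v' α' h
        rcases List.mem_cons.1 h with h | h
        · simp only [Prod.mk.injEq] at h
          obtain ⟨rfl, rfl, rfl⟩ := h
          exact ⟨W.start_mem_support, hadj, haα, hα1⟩
        · exact hl _ _ _ h
      · simp only [cost, List.map_cons, List.sum_cons] at hℓ ⊢
        linarith
      · rcases hP p hp with ⟨r, hr, rfl⟩ | h
        · exact .inr (.inr ⟨u, v, α, List.mem_cons_self, r, hr, rfl⟩)
        · exact walkSkeleton_cons_list _ _ _ h
    · have hα : α = 1 := le_antisymm hα1 haα
      subst hα
      refine ⟨.cons hadj.symm W, l, fun u' v' α' h => ?_, ?_, fun p hp => ?_⟩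
      · obtain ⟨h1, h2⟩ := hl _ _ _ h
        exact ⟨by simp only [SimpleGraph.Walk.support_cons, List.mem_cons]; exact .inr h1, h2⟩
      · simp only [cost, SimpleGraph.Walk.length_cons] at hℓ ⊢
        push_cast
        linarith
      · rcases hP p hp with ⟨r, hr, rfl⟩ | h
        · refine .inr (.inl ⟨u, v, ?_, r, hr, rfl⟩)
          simp [SimpleGraph.Walk.edges_cons, Sym2.eq_swap]
        · exact walkSkeleton_cons_walk _ _ _ h
  · have ha : a = 0 := le_antisymm haα h0
    subst ha
    rw [pt_zero] at hx
    obtain rfl := vtx_injective hx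
    refine ⟨W, l, hl, by linarith, fun p hp => ?_⟩
    rcases hP p hp with ⟨r, hr, rfl⟩ | h
    · refine .inl ⟨c, W.start_mem_support, ?_⟩
      rw [le_antisymm hr.2 hr.1, pt_zero]
    · exact h

variable [Fintype V]

/-- Induction from the end of the trail. Stopping points inside the current edge only enlarge the
farthest position `α`. When a vertex is met, what was collected is resolved into the walk and its
detours, and a new edge is opened there. -/
theorem Trail.leaves {d : V} {x z : V → ℝ} {ℓ : ℝ} {P : Set (V → ℝ)} (h : Trail G x z ℓ P)
    (hz : z = vtx d) : Leaves G d x ℓ P := by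
  induction h with
  | @nil x hx =>
    subst hz
    refine ⟨d, d, 0, 0, .nil, [], le_rfl, le_rfl, zero_le_one, by rw [pt_zero], .inr rfl, ?_, ?_,
      ?_⟩
    · simp [Detours]
    · simp [cost]
    · rintro p rfl
      exact .inl ⟨0, by simp, by rw [pt_zero]⟩
  | @cons x y z ℓ P hx hne hs ht ih =>
    specialize ih hz
    by_cases hv : ∃ c, y = vtx c
    · obtain ⟨c, rfl⟩ := hv
      obtain ⟨W, l, hl, hℓ, hP⟩ := ih.resolve
      obtain ⟨w, hcw, b, hb, rfl⟩ := hs.symm.of_vtx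
      have hb0 : b ≠ 0 := by
        rintro rfl
        exact hne (pt_zero _ _)
      -- The new edge is oriented away from `c`, so it is left through its origin and nothing beyond
      -- the starting position `b` is visited.
      refine ⟨c, w, b, b, W, l, hb.1, le_rfl, hb.2, rfl, .inl hcw, hl, ?_, ?_⟩
      · rw [← pt_zero c w, dist_pt hcw.ne, sub_zero, abs_of_nonneg hb.1]
        linarith
      · rintro p (hp | hp)
        · rw [← pt_zero c w] at hp
          obtain ⟨r, hr1, hr2, rfl⟩ := edgeSegment_subset hcw hb0 hp
          rw [min_eq_right hb.1] at hr1
          rw [max_eq_left hb.1] at hr2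
          exact .inl ⟨r, ⟨hr1, hr2⟩, rfl⟩
        · exact .inr (hP hp)
    · push Not at hv
      obtain ⟨u, v, a, α, W, l, h0, haα, hα1, rfl, hadj, hl, hℓ, hP⟩ := ih
      have huv : G.Adj u v := by
        rcases hadj with h | rfl
        · exact h
        · rw [le_antisymm haα h0, pt_zero] at hv
          exact absurd rfl (hv u)
      obtain ⟨a', ha', rfl⟩ := hs.symm.of_inner huv hv
      have haa : a' ≠ a := fun h => hne (h ▸ rfl)
      refine ⟨u, v, a', max α a', W, l, ha'.1, le_max_right _ _, max_le hα1 ha'.2, rfl, .inl huv,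
        hl, ?_, ?_⟩
      · rw [dist_pt huv.ne]
        have := neg_le_abs (a' - a)
        have := le_abs_self (a' - a)
        rcases le_total α a' with h | h
        · rw [max_eq_right h]
          linarith
        · rw [max_eq_left h]
          linarith
      · rintro p (hp | hp)
        · obtain ⟨r, hr1, hr2, rfl⟩ := edgeSegment_subset huv haa hp
          refine .inl ⟨r, ⟨le_trans (le_min ha'.1 h0) hr1, hr2.trans (max_le ?_ ?_)⟩, rfl⟩
          · exact le_max_right _ _
          · exact haα.trans (le_max_left _ _)
        · rcases hP p hp with ⟨r, hr, rfl⟩ | h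
          · exact .inl ⟨r, ⟨hr.1, hr.2.trans (le_max_left _ _)⟩, rfl⟩
          · exact .inr h

/-- Every closed trail is dominated by a closed graph walk with detours, or by a segment of an
edge. -/
theorem Trail.decompose {x : V → ℝ} {ℓ : ℝ} {P : Set (V → ℝ)} (h : Trail G x x ℓ P) :
    (∃ (c : V) (W : G.Walk c c) (l : List (V × V × ℝ)), Detours W l ∧ cost W l ≤ ℓ ∧
      P ⊆ walkSkeleton W l) ∨
    ∃ u v s t, G.Adj u v ∧ 0 ≤ s ∧ s ≤ t ∧ t ≤ 1 ∧ 2 * (t - s) ≤ ℓ ∧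
      ∀ p ∈ P, ∃ r, s ≤ r ∧ r ≤ t ∧ p = pt u v r := by
  rcases h.vtx_or_inner with ⟨c, hc⟩ | ⟨u, v, a, b, s, t, huv, h0, hsa, hat, -, -, h1, hx, hx', -, hℓ,
    hP⟩
  · obtain ⟨ℓ₁, P₁, ℓ₂, P₂, h₁, h₂, rfl, hP⟩ := h.split_vtx hc
    -- The closed trail is rotated so that it begins and ends at the vertex `c`.
    obtain ⟨W, l, hl, hc, hP'⟩ := ((h₂.trans h₁).leaves rfl).resolve
    refine .inl ⟨c, W, l, hl, by linarith, fun p hp => hP' ?_⟩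
    rw [Set.union_comm]
    exact hP hp
  · refine .inr ⟨u, v, s, t, huv, h0, hsa.trans hat, h1, ?_, hP⟩
    have : a = b := pt_injective huv.ne (hx.symm.trans hx')
    rw [this, sub_self, abs_zero, sub_zero] at hℓ
    exact hℓ

/-! ### Tours from walks with detours -/

theorem Trail.of_walk {c d : V} (W : G.Walk c d) :
    ∃ P, Trail G (vtx c) (vtx d) W.length P ∧ walkSkeleton W [] ⊆ P := by
  induction W with
  | @nil c =>
    refine ⟨_, by simpa using Trail.nil (vtx_mem_pointSet c), ?_⟩
    rintro z (⟨w, hw, rfl⟩ | ⟨x, y, hxy, -⟩ | ⟨u, v, α, h, -⟩)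
    · simp only [SimpleGraph.Walk.support_nil, List.mem_singleton] at hw
      rw [hw]
      rfl
    · simp at hxy
    · simp at h
  | @cons b c d h W ih =>
    obtain ⟨P, hP, hW⟩ := ih
    obtain ⟨Q, hQ, hbc⟩ := Trail.edge_vtx h
    refine ⟨Q ∪ P, ?_, ?_⟩
    · rw [SimpleGraph.Walk.length_cons]
      push_cast
      rw [add_comm]
      exact hQ.trans hP
    rintro z (⟨w, hw, rfl⟩ | ⟨x, y, hxy, r, hr, rfl⟩ | ⟨u, v, α, h, -⟩)
    · simp only [SimpleGraph.Walk.support_cons, List.mem_cons] at hw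
      rcases hw with rfl | hw
      · exact .inl hQ.start_mem
      · exact .inr (hW (.inl ⟨w, hw, rfl⟩))
    · simp only [SimpleGraph.Walk.edges_cons, List.mem_cons] at hxy
      rcases hxy with hxy | hxy
      · left
        rcases Sym2.eq_iff.1 hxy with ⟨rfl, rfl⟩ | ⟨rfl, rfl⟩
        · exact hbc r hr.1 hr.2
        · rw [pt_symm]
          exact hbc _ (one_sub_mem hr).1 (one_sub_mem hr).2
      · exact .inr (hW (.inr (.inl ⟨x, y, hxy, r, hr, rfl⟩)))
    · simp at h

/-- The detours are spliced in one at a time: the trail is cut at the vertex where the detour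
starts, which is one of its stopping points by `Trail.split_vtx`. -/
theorem Trail.of_walk_detours {c : V} (W : G.Walk c c) (l : List (V × V × ℝ))
    (hl : Detours W l) : ∃ P, Trail G (vtx c) (vtx c) (cost W l) P ∧ walkSkeleton W l ⊆ P := by
  induction l with
  | nil => simpa [cost] using Trail.of_walk W
  | cons p l ih =>
    obtain ⟨u, v, α⟩ := p
    obtain ⟨P, hP, hW⟩ := ih fun u v α h => hl u v α (List.mem_cons_of_mem _ h)
    obtain ⟨hu, huv, hα⟩ := hl u v α List.mem_cons_self
    obtain ⟨ℓ₁, P₁, ℓ₂, P₂, h₁, h₂, he, hs⟩ := hP.split_vtx (hW (.inl ⟨u, hu, rfl⟩))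
    obtain ⟨Q, hQ, hr⟩ := Trail.edge huv (s := 0) (t := α) (by simp) hα
    obtain ⟨Q', hQ', -⟩ := Trail.edge huv (s := α) (t := 0) hα (by simp)
    rw [pt_zero] at hQ hQ'
    rw [sub_zero, abs_of_nonneg hα.1] at hQ'
    rw [zero_sub, abs_neg, abs_of_nonneg hα.1] at hQ
    have := h₁.trans ((hQ.trans hQ').trans h₂)
    have hc : cost W ((u, v, α) :: l) = ℓ₁ + (α + α + ℓ₂) := by
      simp only [cost, List.map_cons, List.sum_cons] at he ⊢
      linarith
    rw [← hc] at this
    refine ⟨_, this, ?_⟩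
    have hsub : P ⊆ P₁ ∪ (Q ∪ Q' ∪ P₂) := fun z hz => by
      rcases hs hz with h | h
      · exact .inl h
      · exact .inr (.inr h)
    rintro z (h | h | ⟨u', v', α', h, r, hr', rfl⟩)
    · exact hsub (hW (.inl h))
    · exact hsub (hW (.inr (.inl h)))
    · rcases List.mem_cons.1 h with h | h
      · simp only [Prod.mk.injEq] at h
        obtain ⟨rfl, rfl, rfl⟩ := h
        exact .inr (.inl (.inl (hr r (by simpa [hα.1] using hr'.1) (by simpa [hα.1] using hr'.2))))
      · exact hsub (hW (.inr (.inr ⟨u', v', α', h, r, hr', rfl⟩)))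

theorem Trail.of_segment {u v : V} (huv : G.Adj u v) {s t : ℝ} (h0 : 0 ≤ s) (hst : s ≤ t)
    (h1 : t ≤ 1) : ∃ P, Trail G (pt u v s) (pt u v s) (2 * (t - s)) P ∧
      ∀ r, s ≤ r → r ≤ t → pt u v r ∈ P := by
  have hs : s ∈ Set.Icc (0 : ℝ) 1 := ⟨h0, hst.trans h1⟩
  have ht : t ∈ Set.Icc (0 : ℝ) 1 := ⟨h0.trans hst, h1⟩
  obtain ⟨P, hP, hr⟩ := Trail.edge huv hs ht
  obtain ⟨Q, hQ, -⟩ := Trail.edge huv ht hs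
  have := hP.trans hQ
  rw [abs_sub_comm, abs_of_nonneg (sub_nonneg.2 hst), ← two_mul] at this
  exact ⟨_, this, fun r h1 h2 => .inl (hr r (by simpa [hst] using h1) (by simpa [hst] using h2))⟩

end DeltaTour

namespace DeltaTour

variable {V : Type*} [Fintype V] [DecidableEq V] {G : SimpleGraph V}

/-! ### Distances and coverage -/

/-- There is a walk of length at most `ℓ` between the points. -/
def Within (G : SimpleGraph V) (p q : V → ℝ) (ℓ : ℝ) : Prop :=
  ∃ ℓ' ≤ ℓ, ∃ P, Trail G p q ℓ' P

/-- All points are at distance at most `δ` from `P`. -/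
def Covers (G : SimpleGraph V) (δ : ℝ) (P : Set (V → ℝ)) : Prop :=
  ∀ x ∈ pointSet G, (⨅ y ∈ P, pointDist G x y) ≤ ENNReal.ofReal δ

theorem Within.trans {p q r : V → ℝ} {a b : ℝ} (h : Within G p q a) (h' : Within G q r b) :
    Within G p r (a + b) := by
  obtain ⟨a', ha, P, hP⟩ := h
  obtain ⟨b', hb, Q, hQ⟩ := h'
  exact ⟨_, add_le_add ha hb, _, hP.trans hQ⟩

theorem Within.mono {p q : V → ℝ} {a b : ℝ} (h : Within G p q a) (hab : a ≤ b) :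
    Within G p q b := by
  obtain ⟨a', ha, P, hP⟩ := h
  exact ⟨a', ha.trans hab, P, hP⟩

theorem Within.edge {u v : V} (huv : G.Adj u v) {s t : ℝ} (hs : s ∈ Set.Icc (0 : ℝ) 1)
    (ht : t ∈ Set.Icc (0 : ℝ) 1) : Within G (pt u v s) (pt u v t) |s - t| := by
  obtain ⟨P, hP, -⟩ := Trail.edge huv hs ht
  exact ⟨_, le_rfl, P, hP⟩

theorem Within.walk {c d : V} (W : G.Walk c d) : Within G (vtx c) (vtx d) W.length := by
  obtain ⟨P, hP, -⟩ := Trail.of_walk W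
  exact ⟨_, le_rfl, P, hP⟩

theorem Within.pointDist_le {p q : V → ℝ} {ℓ : ℝ} (h : Within G p q ℓ) :
    pointDist G p q ≤ ENNReal.ofReal ℓ := by
  obtain ⟨ℓ', hℓ, P, hP⟩ := h
  obtain ⟨w, hw, hh, hl, rfl, -⟩ := hP.exists_list
  exact (iInf₂_le w ⟨hw, hh, hl⟩).trans (ENNReal.ofReal_le_ofReal hℓ)

theorem iInf_pointDist_le {p q : V → ℝ} {P : Set (V → ℝ)} {δ : ℝ} (hq : q ∈ P)
    (h : Within G p q δ) : (⨅ y ∈ P, pointDist G p y) ≤ ENNReal.ofReal δ :=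
  (iInf₂_le q hq).trans h.pointDist_le

/-- The distance is an infimum over points and walks, and its attainment is not established here;
hence the slack `ε`. It disappears in `exists_overlap`, where only discretely many reaches compete.
-/
theorem exists_within_of_iInf_le {p : V → ℝ} {P : Set (V → ℝ)} {δ ε : ℝ} (hδ : 0 ≤ δ)
    (hε : 0 < ε) (h : (⨅ y ∈ P, pointDist G p y) ≤ ENNReal.ofReal δ) :
    ∃ q ∈ P, ∃ ℓ < δ + ε, ∃ Q, Trail G p q ℓ Q := by
  have h' := h.trans_lt ((ENNReal.ofReal_lt_ofReal_iff (q := δ + ε) (by linarith)).2 (by linarith))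
  simp only [iInf_lt_iff] at h'
  obtain ⟨q, hq, h'⟩ := h'
  simp only [pointDist, iInf_lt_iff] at h'
  obtain ⟨w, ⟨hw, hh, hl⟩, h'⟩ := h'
  exact ⟨q, hq, _, (ENNReal.ofReal_lt_ofReal_iff (by linarith)).1 h', _,
    trail_of_isWalk w p q hw hh hl⟩

theorem exists_deltaTour_iff {δ K : ℝ} : (∃ T, IsDeltaTour G δ T ∧ walkLength T ≤ K) ↔
    ∃ x ℓ P, Trail G x x ℓ P ∧ ℓ ≤ K ∧ Covers G δ P := by
  constructor
  · rintro ⟨T, ⟨⟨hw, hc⟩, hcov⟩, hK⟩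
    obtain _ | ⟨x, T⟩ := T
    · exact absurd rfl hw.1
    · exact ⟨x, _, _, trail_of_isWalk _ x x hw rfl hc.symm, hK, hcov⟩
  · rintro ⟨x, ℓ, P, hT, hK, hcov⟩
    obtain ⟨w, hw, hh, hl, rfl, rfl⟩ := hT.exists_list
    exact ⟨w, ⟨⟨hw, hh.trans hl.symm⟩, hcov⟩, hK⟩

/-! ### The combinatorial criterion for coverage -/

/-- The vertex `x` has distance at most `D - α` from the skeleton, along a graph walk from a vertex
of `vs` (then `α = 1`) or from the far end `v` of an edge that is passed up to `pt u v α`. -/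
def Anchored (G : SimpleGraph V) (vs : V → Prop) (dg : V → V → ℝ → Prop) (x : V) (α : ℝ)
    (D : ℕ) : Prop :=
  (∃ w, vs w ∧ α = 1 ∧ ∃ p : G.Walk w x, D = p.length + 1) ∨
    ∃ u v, dg u v α ∧ ∃ p : G.Walk v x, D = p.length + 1

/-- The edge from `x` to `y` is passed from `x` up to the position `α`. -/
def Direct (tr : V → V → Prop) (dg : V → V → ℝ → Prop) (x y : V) (α : ℝ) : Prop :=
  dg x y α ∨ tr x y ∧ α = 1

/-- The points of the edge `xy` up to the position `α - D + δ` are covered from the side of `x`. -/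
def Reaches (G : SimpleGraph V) (vs : V → Prop) (tr : V → V → Prop) (dg : V → V → ℝ → Prop)
    (x y : V) (α : ℝ) (D : ℕ) : Prop :=
  (D = 0 ∧ Direct tr dg x y α) ∨ Anchored G vs dg x α D

/-- The parts of the edge `xy` covered from both ends overlap. -/
def EdgeCovered (G : SimpleGraph V) (vs : V → Prop) (tr : V → V → Prop) (dg : V → V → ℝ → Prop)
    (δ : ℝ) (x y : V) : Prop :=
  ∃ α D α' D', Reaches G vs tr dg x y α D ∧ Reaches G vs tr dg y x α' D' ∧
    (1 + D + D' : ℝ) ≤ α + α' + 2 * δ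

variable {vs : V → Prop} {tr : V → V → Prop} {dg : V → V → ℝ → Prop} {δ : ℝ} {P : Set (V → ℝ)}

theorem Anchored.exists_within (hvs : ∀ w, vs w → vtx w ∈ P)
    (hdg : ∀ u v α, dg u v α → G.Adj u v ∧ α ∈ Set.Icc (0 : ℝ) 1 ∧ pt u v α ∈ P) {x : V} {α : ℝ}
    {D : ℕ} (h : Anchored G vs dg x α D) : ∃ q ∈ P, Within G (vtx x) q (D - α) := by
  rcases h with ⟨w, hw, rfl, p, rfl⟩ | ⟨u, v, h, p, rfl⟩
  · refine ⟨_, hvs w hw, ?_⟩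
    have := Within.walk p.reverse
    rw [SimpleGraph.Walk.length_reverse] at this
    exact this.mono (by push_cast; linarith)
  · obtain ⟨huv, hα, hP⟩ := hdg u v α h
    refine ⟨_, hP, ?_⟩
    have h1 := Within.walk p.reverse
    rw [SimpleGraph.Walk.length_reverse] at h1
    have h2 := Within.edge huv (s := 1) (by simp) hα
    rw [pt_one, abs_of_nonneg (by linarith [hα.2])] at h2
    exact (h1.trans h2).mono (by push_cast; linarith)

theorem Reaches.exists_within (hvs : ∀ w, vs w → vtx w ∈ P)
    (hdg : ∀ u v α, dg u v α → G.Adj u v ∧ α ∈ Set.Icc (0 : ℝ) 1 ∧ pt u v α ∈ P) {x y : V}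
    (hxy : G.Adj x y)
    (hd : ∀ α, Direct tr dg x y α → α ∈ Set.Icc (0 : ℝ) 1 ∧ ∀ r ∈ Set.Icc 0 α, pt x y r ∈ P)
    (hδ : 0 ≤ δ) {α : ℝ} {D : ℕ} (h : Reaches G vs tr dg x y α D) {t : ℝ}
    (ht : t ∈ Set.Icc (0 : ℝ) 1) (hle : t ≤ α - D + δ) :
    ∃ q ∈ P, Within G (pt x y t) q δ := by
  rcases h with ⟨rfl, h⟩ | h
  · obtain ⟨hα, hr⟩ := hd α h
    rcases le_total t α with h' | h'
    · refine ⟨_, hr t ⟨ht.1, h'⟩, (Within.edge hxy ht ht).mono ?_⟩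
      simpa using hδ
    · refine ⟨_, hr α ⟨hα.1, le_rfl⟩, (Within.edge hxy ht hα).mono ?_⟩
      rw [abs_of_nonneg (by linarith)]
      push_cast at hle
      linarith
  · obtain ⟨q, hq, h'⟩ := h.exists_within hvs hdg
    refine ⟨q, hq, ?_⟩
    have h1 := Within.edge hxy ht (t := 0) (by simp)
    rw [pt_zero, sub_zero, abs_of_nonneg ht.1] at h1
    exact (h1.trans h').mono (by linarith)

/-- A position `t` beyond the reach `α - D + δ` from `x` is, by the overlap inequality, within the
reach from `y`. -/
theorem EdgeCovered.exists_within (hvs : ∀ w, vs w → vtx w ∈ P)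
    (hdg : ∀ u v α, dg u v α → G.Adj u v ∧ α ∈ Set.Icc (0 : ℝ) 1 ∧ pt u v α ∈ P) {x y : V}
    (hxy : G.Adj x y)
    (hd : ∀ α, Direct tr dg x y α → α ∈ Set.Icc (0 : ℝ) 1 ∧ ∀ r ∈ Set.Icc 0 α, pt x y r ∈ P)
    (hd' : ∀ α, Direct tr dg y x α → α ∈ Set.Icc (0 : ℝ) 1 ∧ ∀ r ∈ Set.Icc 0 α, pt y x r ∈ P)
    (hδ : 0 ≤ δ) (h : EdgeCovered G vs tr dg δ x y) {t : ℝ} (ht : t ∈ Set.Icc (0 : ℝ) 1) :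
    ∃ q ∈ P, Within G (pt x y t) q δ := by
  obtain ⟨α, D, α', D', h1, h2, hle⟩ := h
  rcases le_or_gt t (α - D + δ) with h | h
  · exact h1.exists_within hvs hdg hxy hd hδ ht h
  · rw [pt_symm]
    exact h2.exists_within hvs hdg hxy.symm hd' hδ (one_sub_mem ht) (by linarith)

/-- Lower bounds for distances from a set `S`.  Here `M x ℓ` bounds the distance of the vertex `x`
from `S` by `ℓ`, and `E` describes the distances along a single edge. -/
theorem Trail.lower_bound {M : V → ℝ → Prop} {E : V → V → ℝ → ℝ → Prop} {S : Set (V → ℝ)}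
    (hM : ∀ x a b, a ≤ b → M x a → M x b) (hMadj : ∀ x y a, G.Adj x y → M x a → M y (a + 1))
    (hElip : ∀ x y s t ℓ, E x y s ℓ → E x y t (|t - s| + ℓ))
    (hEvtx : ∀ x y ℓ, 0 ≤ ℓ → G.Adj x y → E x y 0 ℓ → M x ℓ)
    (hbase : ∀ x y t, G.Adj x y → t ∈ Set.Icc (0 : ℝ) 1 → pt x y t ∈ S →
      M x (0 - t) ∨ M y (0 - (1 - t)) ∨ E x y t 0)
    {q z : V → ℝ} {ℓ : ℝ} {P : Set (V → ℝ)} (h : Trail G q z ℓ P) (hz : z ∈ S) :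
    ∀ x y t, G.Adj x y → t ∈ Set.Icc (0 : ℝ) 1 → q = pt x y t →
      M x (ℓ - t) ∨ M y (ℓ - (1 - t)) ∨ E x y t ℓ := by
  induction h with
  | nil hx =>
    rintro x y t hxy ht rfl
    exact hbase x y t hxy ht hz
  | @cons q p z ℓ P hq hne hs htr ih =>
    specialize ih hz
    have hℓ := htr.length_nonneg
    -- At a vertex the trail may continue on any incident edge, so each of the three possible bounds
    -- on that edge has to be converted into a bound at the vertex itself.
    have main : ∀ x y, G.Adj x y → q = vtx x → M x (dist q p + ℓ) := by
      rintro x y hxy rfl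
      obtain ⟨w, hxw, μ, hμ, rfl⟩ := hs.of_vtx
      have hd : dist (vtx x) (pt x w μ) = μ := by
        rw [← pt_zero x w, dist_pt hxw.ne, zero_sub, abs_neg, abs_of_nonneg hμ.1]
      rw [hd]
      rcases ih x w μ hxw hμ rfl with h | h | h
      · exact hM _ _ _ (by linarith [hμ.1]) h
      · exact hM _ _ _ (by linarith) (hMadj w x _ hxw.symm h)
      · refine hEvtx x w _ (by linarith [hμ.1]) hxw ?_
        have := hElip x w μ 0 ℓ h
        rwa [zero_sub, abs_neg, abs_of_nonneg hμ.1] at this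
    rintro x y t hxy ht rfl
    rcases hs.cases hxy with ⟨μ, hμ, rfl⟩ | ⟨rfl, -⟩ | ⟨rfl, -⟩
    · rw [dist_pt hxy.ne]
      have h1 := le_abs_self (t - μ)
      have h2 := neg_le_abs (t - μ)
      rcases ih x y μ hxy hμ rfl with h | h | h
      · exact .inl (hM _ _ _ (by linarith) h)
      · exact .inr (.inl (hM _ _ _ (by linarith) h))
      · exact .inr (.inr (hElip _ _ _ _ _ h))
    · left
      rw [sub_zero]
      exact main x y hxy (pt_zero x y)
    · right
      left
      rw [sub_self, sub_zero]
      exact main y x hxy.symm (pt_one x y)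

end DeltaTour

/-! ### Necessity of the combinatorial criterion for coverage. -/

namespace DeltaTour

/-- Above any given element of `A` there are only finitely many numbers `f - d`, because `F` is
bounded above and `d` is natural. -/
theorem exists_greatest_of_finite_sub_nat {F A : Set ℝ} (hF : F.Finite)
    (hA : ∀ a ∈ A, ∃ f ∈ F, ∃ d : ℕ, a = f - d) (hne : A.Nonempty) :
    ∃ a ∈ A, ∀ a' ∈ A, a' ≤ a := by
  obtain ⟨a₀, ha₀⟩ := hne
  obtain ⟨c, hc⟩ := hF.bddAbove
  have hfin : (A ∩ Set.Ici a₀).Finite := by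
    refine ((hF.prod (Set.finite_Iic ⌈c - a₀⌉₊)).image
      fun p : ℝ × ℕ => p.1 - (p.2 : ℝ)).subset ?_
    rintro a ⟨ha, ha'⟩
    obtain ⟨f, hf, d, rfl⟩ := hA a ha
    refine ⟨(f, d), ⟨hf, ?_⟩, rfl⟩
    have h1 := hc hf
    have h2 : a₀ ≤ f - d := ha'
    have h3 : (d : ℝ) ≤ ⌈c - a₀⌉₊ := le_trans (by linarith) (Nat.le_ceil _)
    exact_mod_cast h3
  obtain ⟨a, ha, hmax⟩ := Set.exists_max_image _ id hfin ⟨a₀, ha₀, Set.mem_Ici.2 le_rfl⟩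
  refine ⟨a, ha.1, fun a' ha' => ?_⟩
  rcases le_total a₀ a' with h | h
  · exact hmax a' ⟨ha', h⟩
  · exact h.trans ha.2

/-- Take the farthest reaches `a` and `b` from the two ends. They differ by at most 1, since going
along the edge carries a reach to the other end at a loss of 1. If they left a gap, its midpoint
would be a position in `[0, 1]` that is not covered. -/
theorem exists_overlap {F A B : Set ℝ} {δ : ℝ} (hF : F.Finite)
    (hA : ∀ a ∈ A, ∃ f ∈ F, ∃ d : ℕ, a = f - d) (hB : ∀ b ∈ B, ∃ f ∈ F, ∃ d : ℕ, b = f - d)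
    (hAB : ∀ a ∈ A, a - 1 ∈ B) (hBA : ∀ b ∈ B, b - 1 ∈ A)
    (hcov : ∀ t ∈ Set.Icc (0 : ℝ) 1, ∀ ε > 0,
      (∃ a ∈ A, t < a + δ + ε) ∨ ∃ b ∈ B, 1 - t < b + δ + ε) :
    ∃ a ∈ A, ∃ b ∈ B, 1 ≤ a + b + 2 * δ := by
  have hne : A.Nonempty ∧ B.Nonempty := by
    rcases hcov 0 (by simp) 1 one_pos with ⟨a, ha, -⟩ | ⟨b, hb, -⟩
    · exact ⟨⟨a, ha⟩, ⟨_, hAB a ha⟩⟩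
    · exact ⟨⟨_, hBA b hb⟩, ⟨b, hb⟩⟩
  obtain ⟨a, ha, hamax⟩ := exists_greatest_of_finite_sub_nat hF hA hne.1
  obtain ⟨b, hb, hbmax⟩ := exists_greatest_of_finite_sub_nat hF hB hne.2
  refine ⟨a, ha, b, hb, ?_⟩
  by_contra hlt
  push Not at hlt
  have h1 := hbmax _ (hAB a ha)
  have h2 := hamax _ (hBA b hb)
  -- The midpoint of the gap between `a + δ` and `1 - b - δ`, with `ε` half the width of the gap.
  rcases hcov ((1 + a - b) / 2) ⟨by linarith, by linarith⟩ ((1 - a - b - 2 * δ) / 2)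
    (by linarith) with ⟨a', ha', h⟩ | ⟨b', hb', h⟩
  · linarith [hamax a' ha']
  · linarith [hbmax b' hb']

variable {V : Type*} {G : SimpleGraph V}

variable {vs : V → Prop} {tr : V → V → Prop} {dg : V → V → ℝ → Prop} {δ : ℝ} {P : Set (V → ℝ)}

theorem Anchored.adj {x y : V} {α : ℝ} {D : ℕ} (h : Anchored G vs dg x α D) (hxy : G.Adj x y) :
    Anchored G vs dg y α (D + 1) := by
  rcases h with ⟨w, hw, hα, p, rfl⟩ | ⟨u, v, h, p, rfl⟩
  · exact .inl ⟨w, hw, hα, p.concat hxy, by rw [SimpleGraph.Walk.length_concat]⟩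
  · exact .inr ⟨u, v, h, p.concat hxy, by rw [SimpleGraph.Walk.length_concat]⟩

/-- Following the whole edge costs one more step. A direct reach becomes one anchored at the far
end, with `D = 1`. -/
theorem Reaches.swap (htr : ∀ x y, tr x y → vs y) {x y : V} {α : ℝ} {D : ℕ}
    (h : Reaches G vs tr dg x y α D) (hxy : G.Adj x y) : Reaches G vs tr dg y x α (D + 1) := by
  rcases h with ⟨rfl, h | ⟨h, rfl⟩⟩ | h
  · exact .inr (.inr ⟨x, y, h, .nil, rfl⟩)
  · exact .inr (.inl ⟨y, htr x y h, rfl, .nil, rfl⟩)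
  · exact .inr (h.adj hxy)

/-- The vertex `x` has distance at most `ℓ` from the skeleton. -/
def VtxNear (G : SimpleGraph V) (vs : V → Prop) (dg : V → V → ℝ → Prop) (x : V) (ℓ : ℝ) : Prop :=
  ∃ α D, Anchored G vs dg x α D ∧ D ≤ α + ℓ

theorem VtxNear.mono {x : V} {a b : ℝ} (hab : a ≤ b) (h : VtxNear G vs dg x a) :
    VtxNear G vs dg x b := by
  obtain ⟨α, D, h, hD⟩ := h
  exact ⟨α, D, h, by linarith⟩

theorem VtxNear.adj {x y : V} {a : ℝ} (hxy : G.Adj x y) (h : VtxNear G vs dg x a) :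
    VtxNear G vs dg y (a + 1) := by
  obtain ⟨α, D, h, hD⟩ := h
  exact ⟨α, D + 1, h.adj hxy, by push_cast; linarith⟩

theorem VtxNear.of_vs {x : V} (hx : vs x) : VtxNear G vs dg x 0 :=
  ⟨1, 1, .inl ⟨x, hx, rfl, .nil, rfl⟩, by norm_num⟩

theorem VtxNear.of_dg {x y : V} {α ℓ : ℝ} (h : dg x y α) (hℓ : 1 - α ≤ ℓ) :
    VtxNear G vs dg y ℓ :=
  ⟨α, 1, .inr ⟨x, y, h, .nil, rfl⟩, by push_cast; linarith⟩

/-- If every point of the edge is close to its ends or directly covered, its parts covered from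
both ends overlap. -/
theorem edgeCovered_of_near {F : Set ℝ} (hF : F.Finite) (h1F : (1 : ℝ) ∈ F)
    (hdgF : ∀ u v α, dg u v α → α ∈ F) (htr : ∀ x y, tr x y → vs y) {x y : V} (hxy : G.Adj x y)
    (h : ∀ t ∈ Set.Icc (0 : ℝ) 1, ∀ ε > 0, ∃ ℓ < δ + ε,
      VtxNear G vs dg x (ℓ - t) ∨ VtxNear G vs dg y (ℓ - (1 - t)) ∨
        (∃ α, Direct tr dg x y α ∧ t ≤ α + ℓ) ∨ ∃ α, Direct tr dg y x α ∧ 1 - t ≤ α + ℓ) :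
    EdgeCovered G vs tr dg δ x y := by
  have hRF : ∀ x y α D, Reaches G vs tr dg x y α D → α ∈ F := by
    rintro x y α D (⟨-, h | ⟨-, rfl⟩⟩ | ⟨-, -, rfl, -⟩ | ⟨_, _, h, -⟩)
    · exact hdgF _ _ _ h
    · exact h1F
    · exact h1F
    · exact hdgF _ _ _ h
  obtain ⟨a, ⟨α, D, h1, rfl⟩, b, ⟨α', D', h2, rfl⟩, hle⟩ := exists_overlap (δ := δ)
    (A := {a | ∃ α D, Reaches G vs tr dg x y α D ∧ a = α - D})
    (B := {a | ∃ α D, Reaches G vs tr dg y x α D ∧ a = α - D}) hF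
    (fun a ⟨α, D, h, he⟩ => ⟨α, hRF _ _ _ _ h, D, he⟩)
    (fun a ⟨α, D, h, he⟩ => ⟨α, hRF _ _ _ _ h, D, he⟩)
    (fun a ⟨α, D, h, he⟩ => ⟨α, D + 1, h.swap htr hxy, by rw [he]; push_cast; ring⟩)
    (fun a ⟨α, D, h, he⟩ => ⟨α, D + 1, h.swap htr hxy.symm, by rw [he]; push_cast; ring⟩)
    (fun t ht ε hε => by
      obtain ⟨ℓ, hℓ, h⟩ := h t ht ε hε
      rcases h with ⟨α, D, h, hD⟩ | ⟨α, D, h, hD⟩ | ⟨α, h, hD⟩ | ⟨α, h, hD⟩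
      · exact .inl ⟨_, ⟨α, D, .inr h, rfl⟩, by linarith⟩
      · exact .inr ⟨_, ⟨α, D, .inr h, rfl⟩, by linarith⟩
      · exact .inl ⟨_, ⟨α, 0, .inl ⟨rfl, h⟩, rfl⟩, by push_cast; linarith⟩
      · exact .inr ⟨_, ⟨α, 0, .inl ⟨rfl, h⟩, rfl⟩, by push_cast; linarith⟩)
  exact ⟨α, D, α', D', h1, h2, by linarith⟩

variable [Fintype V] [DecidableEq V]

/-- What is covered by a subset of a skeleton satisfies the combinatorial criterion. -/
theorem edgeCovered_of_covers {F : Set ℝ} (hF : F.Finite) (h1F : (1 : ℝ) ∈ F)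
    (hdgF : ∀ u v α, dg u v α → α ∈ F) (htr : ∀ x y, tr x y → G.Adj x y ∧ vs x ∧ vs y ∧ tr y x)
    (hdg : ∀ u v α, dg u v α → vs u ∧ G.Adj u v ∧ α ∈ Set.Icc (0 : ℝ) 1)
    (hP : P ⊆ skeleton vs tr dg) (hδ : 0 ≤ δ) (hcov : Covers G δ P) {x y : V} (hxy : G.Adj x y) :
    EdgeCovered G vs tr dg δ x y := by
  refine edgeCovered_of_near hF h1F hdgF (fun x y h => (htr x y h).2.2.1) hxy fun t ht ε hε => ?_
  obtain ⟨q, hq, ℓ, hℓ, Q, hT⟩ := exists_within_of_iInf_le hδ hε (hcov _ (pt_mem_pointSet hxy ht))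
  refine ⟨ℓ, hℓ, hT.lower_bound (M := VtxNear G vs dg) (S := skeleton vs tr dg)
    (E := fun x y t ℓ => (∃ α, Direct tr dg x y α ∧ t ≤ α + ℓ) ∨
      ∃ α, Direct tr dg y x α ∧ 1 - t ≤ α + ℓ)
    (fun _ _ _ hab h => h.mono hab) (fun _ _ _ hxy h => h.adj hxy) ?_ ?_ ?_ (hP hq) x y t hxy ht
    rfl⟩
  · rintro x y s t ℓ (⟨α, h, hle⟩ | ⟨α, h, hle⟩)
    · exact .inl ⟨α, h, by linarith [le_abs_self (t - s)]⟩
    · exact .inr ⟨α, h, by linarith [neg_le_abs (t - s)]⟩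
  · rintro x y ℓ hℓ hxy (⟨α, h | ⟨h, rfl⟩, hle⟩ | ⟨α, h | ⟨h, rfl⟩, hle⟩)
    · exact (VtxNear.of_vs (hdg _ _ _ h).1).mono hℓ
    · exact (VtxNear.of_vs (htr _ _ h).2.1).mono hℓ
    · exact VtxNear.of_dg h (by linarith)
    · exact (VtxNear.of_vs (htr _ _ h).2.2.1).mono hℓ
  · intro x y t hxy ht hz
    have hvtx : ∀ w, vs w → pt x y t = vtx w →
        VtxNear G vs dg x (0 - t) ∨ VtxNear G vs dg y (0 - (1 - t)) := by
      intro w hw he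
      rcases pt_eq_vtx hxy.ne he with ⟨rfl, rfl⟩ | ⟨rfl, rfl⟩
      · left
        rw [sub_zero]
        exact .of_vs hw
      · right
        rw [sub_self, sub_zero]
        exact .of_vs hw
    rcases hz with ⟨w, hw, he⟩ | ⟨x', y', h, r, hr, he⟩ | ⟨u, v, α, h, r, hr, he⟩
    · exact (hvtx w hw he).imp_right .inl
    · obtain ⟨hadj, hx', hy', -⟩ := htr _ _ h
      rcases pt_eq_cases hxy.ne hadj.ne he with ⟨rfl, rfl, rfl⟩ | ⟨rfl, rfl, rfl⟩ | ⟨w, hw⟩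
      · exact .inr (.inr (.inl ⟨1, .inr ⟨h, rfl⟩, by linarith [hr.2]⟩))
      · exact .inr (.inr (.inr ⟨1, .inr ⟨h, rfl⟩, by linarith [hr.2]⟩))
      · rcases pt_eq_vtx hadj.ne (he ▸ hw) with ⟨-, rfl⟩ | ⟨-, rfl⟩
        · exact (hvtx _ hx' hw).imp_right .inl
        · exact (hvtx _ hy' hw).imp_right .inl
    · obtain ⟨hu, hadj, hα⟩ := hdg _ _ _ h
      rcases pt_eq_cases hxy.ne hadj.ne he with ⟨rfl, rfl, rfl⟩ | ⟨rfl, rfl, rfl⟩ | ⟨w, hw⟩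
      · exact .inr (.inr (.inl ⟨α, .inl h, by linarith [hr.2]⟩))
      · exact .inr (.inr (.inr ⟨α, .inl h, by linarith [hr.2]⟩))
      · rcases pt_eq_vtx hadj.ne (he ▸ hw) with ⟨-, rfl⟩ | ⟨rfl, rfl⟩
        · exact (hvtx _ hu hw).imp_right .inl
        · have h1 : VtxNear G vs dg v 0 := .of_dg h (by linarith [hr.2])
          rcases pt_eq_vtx hxy.ne hw with ⟨rfl, rfl⟩ | ⟨rfl, rfl⟩
          · left
            rwa [sub_zero]
          · right
            left
            rwa [sub_self, sub_zero]

/-- The two pieces of the edge `uv` that start at its ends and overlap in the segment from `s` to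
`t`. -/
def overlapping (u v : V) (s t : ℝ) (x y : V) (α : ℝ) : Prop :=
  (x = u ∧ y = v ∧ α = t) ∨ (x = v ∧ y = u ∧ α = 1 - s)

/-- `Trail.lower_bound` for the segment. The far ends of the two overlapping pieces are the two ends
of the segment, so leaving the edge through `v` costs `1 - t` and through `u` costs `s`. Distances
along the edge itself are recorded separately as a two-sided bound. -/
theorem segment_near {u v : V} (huv : G.Adj u v) {s t : ℝ}
    (hP : ∀ p ∈ P, ∃ r, s ≤ r ∧ r ≤ t ∧ p = pt u v r) {q z : V → ℝ} {ℓ : ℝ} {Q : Set (V → ℝ)}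
    (hT : Trail G q z ℓ Q) (hz : z ∈ P) {x y : V} {a : ℝ} (hxy : G.Adj x y)
    (ha : a ∈ Set.Icc (0 : ℝ) 1) (hq : q = pt x y a) :
    VtxNear G (fun _ => False) (overlapping u v s t) x (ℓ - a) ∨
      VtxNear G (fun _ => False) (overlapping u v s t) y (ℓ - (1 - a)) ∨
        ((x = u ∧ y = v ∧ s - ℓ ≤ a ∧ a ≤ t + ℓ) ∨
          (x = v ∧ y = u ∧ s - ℓ ≤ 1 - a ∧ 1 - a ≤ t + ℓ)) := by
  refine hT.lower_bound (S := {p | ∃ r, s ≤ r ∧ r ≤ t ∧ p = pt u v r})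
    (M := VtxNear G (fun _ => False) (overlapping u v s t))
    (E := fun x y a ℓ => (x = u ∧ y = v ∧ s - ℓ ≤ a ∧ a ≤ t + ℓ) ∨
      (x = v ∧ y = u ∧ s - ℓ ≤ 1 - a ∧ 1 - a ≤ t + ℓ))
    (fun _ _ _ hab h => h.mono hab) (fun _ _ _ hxy h => h.adj hxy) ?_ ?_ ?_ (hP z hz) x y a hxy ha
    hq
  · rintro x y a b ℓ (⟨rfl, rfl, h, h'⟩ | ⟨rfl, rfl, h, h'⟩)
    · exact .inl ⟨rfl, rfl, by linarith [neg_le_abs (b - a)], by linarith [le_abs_self (b - a)]⟩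
    · exact .inr ⟨rfl, rfl, by linarith [le_abs_self (b - a)], by linarith [neg_le_abs (b - a)]⟩
  · rintro x y ℓ hℓ hxy (⟨rfl, rfl, h, h'⟩ | ⟨rfl, rfl, h, h'⟩)
    · exact VtxNear.of_dg (.inr ⟨rfl, rfl, rfl⟩) (by linarith)
    · exact VtxNear.of_dg (.inl ⟨rfl, rfl, rfl⟩) (by linarith)
  · rintro x y a hxy ha ⟨r, hr1, hr2, he⟩
    rcases pt_eq_cases hxy.ne huv.ne he with ⟨rfl, rfl, rfl⟩ | ⟨rfl, rfl, rfl⟩ | ⟨w, hw⟩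
    · exact .inr (.inr (.inl ⟨rfl, rfl, by linarith, by linarith⟩))
    · exact .inr (.inr (.inr ⟨rfl, rfl, by linarith, by linarith⟩))
    · have hw' : VtxNear G (fun _ => False) (overlapping u v s t) w 0 := by
        rcases pt_eq_vtx huv.ne (he ▸ hw) with ⟨rfl, rfl⟩ | ⟨rfl, rfl⟩
        · exact VtxNear.of_dg (.inr ⟨rfl, rfl, rfl⟩) (by linarith)
        · exact VtxNear.of_dg (.inl ⟨rfl, rfl, rfl⟩) (by linarith)
      rcases pt_eq_vtx hxy.ne hw with ⟨rfl, rfl⟩ | ⟨rfl, rfl⟩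
      · left
        rwa [sub_zero]
      · right
        left
        rwa [sub_self, sub_zero]

/-- What is covered by a segment of an edge satisfies the combinatorial criterion. -/
theorem segment_criterion {u v : V} (huv : G.Adj u v) {s t : ℝ} (h0 : 0 ≤ s) (hst : s ≤ t)
    (h1 : t ≤ 1) (hP : ∀ p ∈ P, ∃ r, s ≤ r ∧ r ≤ t ∧ p = pt u v r) (hδ : 0 ≤ δ)
    (hcov : Covers G δ P) : s ≤ δ ∧ 1 - t ≤ δ ∧ ∀ x y, G.Adj x y → s(x, y) ≠ s(u, v) →
      EdgeCovered G (fun _ => False) (fun _ _ => False) (overlapping u v s t) δ x y := by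
  have main : ∀ x y a, G.Adj x y → a ∈ Set.Icc (0 : ℝ) 1 → ∀ ε > 0, ∃ ℓ < δ + ε, 0 ≤ ℓ ∧
      (VtxNear G (fun _ => False) (overlapping u v s t) x (ℓ - a) ∨
      VtxNear G (fun _ => False) (overlapping u v s t) y (ℓ - (1 - a)) ∨
        ((x = u ∧ y = v ∧ s - ℓ ≤ a ∧ a ≤ t + ℓ) ∨
          (x = v ∧ y = u ∧ s - ℓ ≤ 1 - a ∧ 1 - a ≤ t + ℓ))) := by
    intro x y a hxy ha ε hε
    obtain ⟨q, hq, ℓ, hℓ, Q, hT⟩ :=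
      exists_within_of_iInf_le hδ hε (hcov _ (pt_mem_pointSet hxy ha))
    exact ⟨ℓ, hℓ, hT.length_nonneg, segment_near huv hP hT hq hxy ha rfl⟩
  -- Coming to an end of the edge from the other end takes at least one full step, which is never
  -- better than going straight along the edge.
  have walk_pos : ∀ {a b : V} (p : G.Walk a b), a ≠ b → (1 : ℝ) ≤ p.length := by
    intro a b p hab
    rcases p with _ | ⟨h, p⟩
    · exact absurd rfl hab
    · rw [SimpleGraph.Walk.length_cons]
      push_cast
      linarith [(Nat.cast_nonneg p.length : (0 : ℝ) ≤ p.length)]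
  refine ⟨?_, ?_, fun x y hxy hne => ?_⟩
  · refine le_of_forall_pos_le_add fun ε hε => ?_
    obtain ⟨ℓ, hℓ, hℓ0, h⟩ := main u v 0 huv (by simp) ε hε
    refine le_trans ?_ hℓ.le
    rcases h with ⟨α, D, h, hD⟩ | ⟨α, D, h, hD⟩ | ⟨-, -, h, -⟩ | ⟨h, -⟩
    · obtain ⟨w, hw, -⟩ | ⟨a, b, ⟨rfl, rfl, rfl⟩ | ⟨rfl, rfl, rfl⟩, p, rfl⟩ := h
      · exact hw.elim
      · have := walk_pos p huv.ne.symm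
        push_cast at hD
        linarith
      · have : (0 : ℝ) ≤ p.length := Nat.cast_nonneg _
        push_cast at hD
        linarith
    · obtain ⟨w, hw, -⟩ | ⟨a, b, ⟨rfl, rfl, rfl⟩ | ⟨rfl, rfl, rfl⟩, p, rfl⟩ := h
      · exact hw.elim
      all_goals
        have : (0 : ℝ) ≤ p.length := Nat.cast_nonneg _
        push_cast at hD
        linarith
    · linarith
    · exact absurd h huv.ne
  · refine le_of_forall_pos_le_add fun ε hε => ?_
    obtain ⟨ℓ, hℓ, hℓ0, h⟩ := main u v 1 huv (by simp) ε hε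
    refine le_trans ?_ hℓ.le
    rcases h with ⟨α, D, h, hD⟩ | ⟨α, D, h, hD⟩ | ⟨-, -, -, h⟩ | ⟨h, -⟩
    · obtain ⟨w, hw, -⟩ | ⟨a, b, ⟨rfl, rfl, rfl⟩ | ⟨rfl, rfl, rfl⟩, p, rfl⟩ := h
      · exact hw.elim
      all_goals
        have : (0 : ℝ) ≤ p.length := Nat.cast_nonneg _
        push_cast at hD
        linarith
    · obtain ⟨w, hw, -⟩ | ⟨a, b, ⟨rfl, rfl, rfl⟩ | ⟨rfl, rfl, rfl⟩, p, rfl⟩ := h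
      · exact hw.elim
      · have : (0 : ℝ) ≤ p.length := Nat.cast_nonneg _
        push_cast at hD
        linarith
      · have := walk_pos p huv.ne
        push_cast at hD
        linarith
    · linarith
    · exact absurd h huv.ne
  · refine edgeCovered_of_near (F := {1, t, 1 - s}) (Set.toFinite _) (by simp) ?_
      (fun _ _ h => h.elim) hxy fun a ha ε hε => ?_
    · rintro x y α (⟨-, -, rfl⟩ | ⟨-, -, rfl⟩) <;> simp
    · obtain ⟨ℓ, hℓ, -, h⟩ := main x y a hxy ha ε hε
      refine ⟨ℓ, hℓ, ?_⟩
      rcases h with h | h | ⟨rfl, rfl, -⟩ | ⟨rfl, rfl, -⟩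
      · exact .inl h
      · exact .inr (.inl h)
      · exact absurd rfl hne
      · exact absurd Sym2.eq_swap hne

/-- An isolated vertex is covered by itself only. -/
theorem mem_of_covers_isolated {x : V} (hx : ∀ y, ¬ G.Adj x y) (hδ : 0 ≤ δ)
    (hcov : Covers G δ P) : vtx x ∈ P := by
  obtain ⟨q, hq, ℓ, -, Q, hT⟩ :=
    exists_within_of_iInf_le hδ one_pos (hcov _ (vtx_mem_pointSet x))
  cases hT with
  | nil => exact hq
  | cons _ _ hs _ =>
    obtain ⟨w, hw, -⟩ := hs.of_vtx
    exact absurd hw (hx w)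

end DeltaTour

namespace DeltaTour

variable {V : Type*} {G : SimpleGraph V}

/-! ### Certificates on a grid -/

/-- The grid values are the `α` with `2 α = i + 4 δ - 2 j δ - I` for small `i` and `j`. -/
def Grid (δ : ℝ) (I : ℕ) : Set ℝ :=
  {α | ∃ i j : ℕ, i ≤ 2 * I ∧ j ≤ 4 ∧ 2 * α = i + 4 * δ - 2 * j * δ - I}

/-- Shifting `i` by `I` and `j` by 2 makes the indices natural numbers. The bound on `I` suffices
because `i = 2 * α + 2 * j * δ` is at most `2 + 4 * δ`. -/
theorem mem_grid {δ α : ℝ} {I : ℕ} (hδ : 0 ≤ δ) (hI : 2 + 4 * δ ≤ I)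
    (hα : α ∈ Set.Icc (0 : ℝ) 1) {i j : ℤ} (h0 : 0 ≤ j) (h2 : j ≤ 2)
    (h : 2 * α = i - 2 * j * δ) : α ∈ Grid δ I := by
  have hj : (j : ℝ) * δ ≤ 2 * δ := mul_le_mul_of_nonneg_right (by exact_mod_cast h2) hδ
  have hj0 : 0 ≤ (j : ℝ) * δ := mul_nonneg (by exact_mod_cast h0) hδ
  have i0 : 0 ≤ i + I := by
    have : (0 : ℝ) ≤ (i + I : ℤ) := by push_cast; linarith [hα.1]
    exact_mod_cast this
  have i1 : i + I ≤ 2 * I := by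
    have : ((i + I : ℤ) : ℝ) ≤ (2 * I : ℤ) := by push_cast; linarith [hα.2]
    exact_mod_cast this
  obtain ⟨a, ha⟩ := Int.eq_ofNat_of_zero_le i0
  obtain ⟨b, hb⟩ := Int.eq_ofNat_of_zero_le (show 0 ≤ j + 2 by omega)
  refine ⟨a, b, by omega, by omega, ?_⟩
  have ha' : (i : ℝ) + I = a := by exact_mod_cast ha
  have hb' : (j : ℝ) + 2 = b := by exact_mod_cast hb
  rw [← ha', ← hb', h]
  ring

/-- Reflection changes the sign of the coefficient of `δ`. This is why the shifted index `j` ranges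
up to 4 rather than 2. -/
theorem one_sub_mem_grid {δ α : ℝ} {I : ℕ} (hδ : 0 ≤ δ) (hI : 2 + 4 * δ ≤ I)
    (hα : α ∈ Set.Icc (0 : ℝ) 1) {i j : ℤ} (h0 : 0 ≤ j) (h2 : j ≤ 2)
    (h : 2 * α = i - 2 * j * δ) : 1 - α ∈ Grid δ I := by
  have hj : (j : ℝ) * δ ≤ 2 * δ := mul_le_mul_of_nonneg_right (by exact_mod_cast h2) hδ
  have hj0 : 0 ≤ (j : ℝ) * δ := mul_nonneg (by exact_mod_cast h0) hδ
  have i0 : 0 ≤ I + 2 - i := by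
    have : (0 : ℝ) ≤ (I + 2 - i : ℤ) := by push_cast; linarith [hα.2]
    exact_mod_cast this
  have i1 : I + 2 - i ≤ 2 * I := by
    have : ((I + 2 - i : ℤ) : ℝ) ≤ (2 * I : ℤ) := by push_cast; linarith [hα.1]
    exact_mod_cast this
  obtain ⟨a, ha⟩ := Int.eq_ofNat_of_zero_le i0
  obtain ⟨b, hb⟩ := Int.eq_ofNat_of_zero_le (show 0 ≤ 2 - j by omega)
  refine ⟨a, b, by omega, by omega, ?_⟩
  have ha' : (I : ℝ) + 2 - i = a := by exact_mod_cast ha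
  have hb' : (2 : ℝ) - j = b := by exact_mod_cast hb
  rw [← ha', ← hb']
  linarith

/-- The edge `xy` is covered by a graph walk with detours. -/
def WalkCovers {c d : V} (W : G.Walk c d) (l : List (V × V × ℝ)) (δ : ℝ) (x y : V) : Prop :=
  EdgeCovered G (· ∈ W.support) (fun x y => s(x, y) ∈ W.edges) (fun u v α => (u, v, α) ∈ l) δ x y

/-- A graph walk with detours of positive grid lengths that covers everything. -/
def WalkCert (G : SimpleGraph V) (δ K : ℝ) (I : ℕ) : Prop :=
  ∃ (c : V) (W : G.Walk c c) (l : List (V × V × ℝ)), Detours W l ∧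
    (∀ u v α, (u, v, α) ∈ l → 0 < α ∧ α ∈ Grid δ I) ∧ cost W l ≤ K ∧
    (∀ x, x ∈ W.support ∨ ∃ y, G.Adj x y) ∧ ∀ x y, G.Adj x y → WalkCovers W l δ x y

section

variable [DecidableEq V]

/-- A segment of an edge with end points on the grid that covers everything. -/
def SegmentCert (G : SimpleGraph V) (δ K : ℝ) (I : ℕ) : Prop :=
  ∃ u v s t, G.Adj u v ∧ 0 ≤ s ∧ s ≤ t ∧ t ≤ 1 ∧ t ∈ Grid δ I ∧ 1 - s ∈ Grid δ I ∧
    2 * (t - s) ≤ K ∧ s ≤ δ ∧ 1 - t ≤ δ ∧ (∀ x, ∃ y, G.Adj x y) ∧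
    ∀ x y, G.Adj x y → s(x, y) ≠ s(u, v) →
      EdgeCovered G (fun _ => False) (fun _ _ => False) (overlapping u v s t) δ x y

end

/-- The overlap inequality compares a sum of two lengths and `2 * δ` with the integer `1 + D + D'`,
which is what the rounding respects. -/
theorem EdgeCovered.transfer {vs : V → Prop} {tr : V → V → Prop} {dg dg' : V → V → ℝ → Prop}
    {δ : ℝ} {r : ℝ → ℝ} (hr : ∀ a b (m : ℤ), m ≤ a + b + 2 * δ → m ≤ r a + r b + 2 * δ)
    (H : ∀ x y α D, Reaches G vs tr dg x y α D →
      ∃ α' D', Reaches G vs tr dg' x y α' D' ∧ r α - D ≤ α' - D')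
    {x y : V} (h : EdgeCovered G vs tr dg δ x y) : EdgeCovered G vs tr dg' δ x y := by
  obtain ⟨α, D, α', D', h1, h2, hle⟩ := h
  obtain ⟨β, E, h1', h1''⟩ := H _ _ _ _ h1
  obtain ⟨β', E', h2', h2''⟩ := H _ _ _ _ h2
  refine ⟨β, E, β', E', h1', h2', ?_⟩
  have := hr α α' (1 + D + D') (by push_cast; exact hle)
  push_cast at this
  linarith

/-- Detours rounded to 0 are discarded: only a positive lower bound on the remaining lengths can
bound their number. They contribute nothing to the sum. -/
theorem exists_rounded_list (r : ℝ → ℝ) (l : List (V × V × ℝ))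
    (hr : ∀ u v α, (u, v, α) ∈ l → 0 ≤ r α) : ∃ l' : List (V × V × ℝ),
      (∀ u v β, (u, v, β) ∈ l' ↔ 0 < β ∧ ∃ α, (u, v, α) ∈ l ∧ β = r α) ∧
        (l'.map fun p => p.2.2).sum = ((l.map fun p => p.2.2).map r).sum := by
  induction l with
  | nil => exact ⟨[], by simp, by simp⟩
  | cons p l ih =>
    obtain ⟨u, v, α⟩ := p
    obtain ⟨l', hl', hs⟩ := ih fun u v α h => hr u v α (List.mem_cons_of_mem _ h)
    rcases (hr u v α List.mem_cons_self).eq_or_lt with h0 | h0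
    · refine ⟨l', fun u' v' β => ?_, by simp [hs, ← h0]⟩
      rw [hl']
      constructor
      · rintro ⟨hβ, α', h, rfl⟩
        exact ⟨hβ, α', List.mem_cons_of_mem _ h, rfl⟩
      · rintro ⟨hβ, α', h, rfl⟩
        rcases List.mem_cons.1 h with h | h
        · simp only [Prod.mk.injEq] at h
          obtain ⟨-, -, rfl⟩ := h
          exact absurd hβ (by rw [← h0]; exact lt_irrefl _)
        · exact ⟨hβ, α', h, rfl⟩
    · refine ⟨(u, v, r α) :: l', fun u' v' β => ?_, by simp [hs]⟩
      rw [List.mem_cons, hl']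
      constructor
      · rintro (h | ⟨hβ, α', h, rfl⟩)
        · simp only [Prod.mk.injEq] at h
          obtain ⟨rfl, rfl, rfl⟩ := h
          exact ⟨h0, α, List.mem_cons_self, rfl⟩
        · exact ⟨hβ, α', List.mem_cons_of_mem _ h, rfl⟩
      · rintro ⟨hβ, α', h, rfl⟩
        rcases List.mem_cons.1 h with h | h
        · simp only [Prod.mk.injEq] at h
          obtain ⟨rfl, rfl, rfl⟩ := h
          exact .inl rfl
        · exact .inr ⟨hβ, α', h, rfl⟩

theorem isolated_not_mem_skeleton [DecidableEq V] {vs : V → Prop} {tr : V → V → Prop}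
    {dg : V → V → ℝ → Prop} (htr : ∀ x y, tr x y → G.Adj x y) (hdg : ∀ u v α, dg u v α → G.Adj u v)
    {x : V} (hx : ∀ y, ¬ G.Adj x y) (h : vtx x ∈ skeleton vs tr dg) : vs x := by
  have key : ∀ {u v r}, G.Adj u v → vtx x ≠ pt u v r := by
    intro u v r huv he
    rcases pt_eq_vtx huv.ne he.symm with ⟨-, rfl⟩ | ⟨-, rfl⟩
    · exact hx _ huv
    · exact hx _ huv.symm
  rcases h with ⟨w, hw, he⟩ | ⟨u, v, h, r, -, he⟩ | ⟨u, v, α, h, r, -, he⟩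
  · rwa [vtx_injective he]
  · exact absurd he (key (htr _ _ h))
  · exact absurd he (key (hdg _ _ _ h))

variable [Fintype V] [DecidableEq V] {δ K : ℝ} {I : ℕ}

/-- All detours are rounded simultaneously. A detour that vanishes is replaced in the criterion by
its starting vertex, which lies on the walk and gives the same reach. -/
theorem WalkCert.of_walk (hδ : 0 ≤ δ) (hI : 2 + 4 * δ ≤ I) {c : V} (W : G.Walk c c)
    (l : List (V × V × ℝ)) (hl : Detours W l) {P : Set (V → ℝ)} (hP : P ⊆ walkSkeleton W l)
    (hcov : Covers G δ P) (hK : cost W l ≤ K) : WalkCert G δ K I := by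
  obtain ⟨r, r0, r1, rmono, radd, rgrid, rsum⟩ := exists_rounding δ (l.map fun p => p.2.2)
  have hr01 : ∀ α ∈ Set.Icc (0 : ℝ) 1, r α ∈ Set.Icc (0 : ℝ) 1 := fun α hα =>
    ⟨r0 ▸ rmono hα.1, r1 ▸ rmono hα.2⟩
  obtain ⟨l', hl', hsum⟩ := exists_rounded_list r l fun u v α h => (hr01 α (hl u v α h).2.2).1
  have htr : ∀ x y, s(x, y) ∈ W.edges → G.Adj x y := fun x y h => W.adj_of_mem_edges h
  refine ⟨c, W, l', fun u v β h => ?_, fun u v β h => ?_, ?_, fun x => ?_, fun x y hxy => ?_⟩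
  · obtain ⟨-, α, h', rfl⟩ := (hl' u v β).1 h
    obtain ⟨h1, h2, h3⟩ := hl u v α h'
    exact ⟨h1, h2, hr01 α h3⟩
  · obtain ⟨hβ, α, h', rfl⟩ := (hl' u v β).1 h
    obtain ⟨i, j, h0, h2, he⟩ := rgrid α
    exact ⟨hβ, mem_grid hδ hI (hr01 α (hl u v α h').2.2) h0 h2 he⟩
  · simp only [cost, hsum] at hK ⊢
    linarith
  · by_contra! h
    exact h.1 (isolated_not_mem_skeleton htr (fun u v α h => (hl u v α h).2.1) h.2
      (hP (mem_of_covers_isolated h.2 hδ hcov)))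
  · have h := edgeCovered_of_covers (F := insert 1 {α | ∃ p ∈ l, p.2.2 = α})
      ((Set.Finite.image (fun p : V × V × ℝ => p.2.2) (List.finite_toSet l)).insert 1)
      (Set.mem_insert _ _) (fun u v α h => .inr ⟨_, h, rfl⟩)
      (fun x y h => ⟨htr x y h, W.fst_mem_support_of_mem_edges h, W.snd_mem_support_of_mem_edges h,
        by rwa [Sym2.eq_swap]⟩) hl hP hδ hcov hxy
    refine h.transfer radd ?_
    rintro x y α D (⟨rfl, h | ⟨h, rfl⟩⟩ | ⟨w, hw, rfl, p, rfl⟩ | ⟨u, v, h, p, rfl⟩)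
    · rcases (hr01 α (hl _ _ _ h).2.2).1.eq_or_lt with h0 | h0
      -- A vanished detour along this edge has reach `0 - 0`; the vertex `x` itself gives `1 - 1`.
      · exact ⟨1, 1, .inr (.inl ⟨x, (hl _ _ _ h).1, rfl, .nil, rfl⟩), by simp [← h0]⟩
      · exact ⟨r α, 0, .inl ⟨rfl, .inl ((hl' _ _ _).2 ⟨h0, α, h, rfl⟩)⟩, le_rfl⟩
    · exact ⟨1, 0, .inl ⟨rfl, .inr ⟨h, rfl⟩⟩, by rw [r1]⟩
    · exact ⟨1, _, .inr (.inl ⟨w, hw, rfl, p, rfl⟩), by rw [r1]⟩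
    · obtain ⟨hu, huv, hα⟩ := hl _ _ _ h
      rcases (hr01 α hα).1.eq_or_lt with h0 | h0
      -- The path from the far end `v` is prolonged to start at `u`: one more step, but the value 1
      -- instead of 0.
      · refine ⟨1, _, .inr (.inl ⟨u, hu, rfl, .cons huv p, rfl⟩), ?_⟩
        rw [← h0, SimpleGraph.Walk.length_cons]
        push_cast
        linarith
      · exact ⟨r α, _, .inr (.inr ⟨u, v, (hl' _ _ _).2 ⟨h0, α, h, rfl⟩, p, rfl⟩), le_rfl⟩

theorem SegmentCert.of_segment (hδ : 0 ≤ δ) (hI : 2 + 4 * δ ≤ I) {u v : V} {s t : ℝ}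
    (huv : G.Adj u v) (h0 : 0 ≤ s) (hst : s ≤ t) (h1 : t ≤ 1) {P : Set (V → ℝ)}
    (hP : ∀ p ∈ P, ∃ r, s ≤ r ∧ r ≤ t ∧ p = pt u v r) (hcov : Covers G δ P)
    (hK : 2 * (t - s) ≤ K) : SegmentCert G δ K I := by
  obtain ⟨hsδ, htδ, hE⟩ := segment_criterion huv h0 hst h1 hP hδ hcov
  obtain ⟨r, r0, r1, rmono, radd, rgrid, rsum⟩ := exists_rounding δ [t, 1 - s]
  have hr01 : ∀ α ∈ Set.Icc (0 : ℝ) 1, r α ∈ Set.Icc (0 : ℝ) 1 := fun α hα =>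
    ⟨r0 ▸ rmono hα.1, r1 ▸ rmono hα.2⟩
  have ht := hr01 t ⟨h0.trans hst, h1⟩
  have hs := hr01 (1 - s) ⟨by linarith, by linarith⟩
  simp only [List.map_cons, List.map_nil, List.sum_cons, List.sum_nil, add_zero] at rsum
  have hv : ∀ x, ∃ y, G.Adj x y := by
    intro x
    by_contra! h
    obtain ⟨a, -, -, he⟩ := hP _ (mem_of_covers_isolated h hδ hcov)
    rcases pt_eq_vtx huv.ne he.symm with ⟨-, rfl⟩ | ⟨-, rfl⟩
    · exact h _ huv
    · exact h _ huv.symm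
  obtain ⟨i, j, hj0, hj2, he⟩ := rgrid t
  obtain ⟨i', j', hj0', hj2', he'⟩ := rgrid (1 - s)
  -- The condition `s ≤ δ` is doubled to `2 ≤ (1 - s) + (1 - s) + 2 * δ`, an inequality of the kind
  -- preserved by rounding; likewise for `t`.
  have e1 := radd (1 - s) (1 - s) 2 (by push_cast; linarith)
  have e2 := radd t t 2 (by push_cast; linarith)
  push_cast at e1 e2
  have main : ∀ s', 0 ≤ s' → s' ≤ r t → r (1 - s) ≤ 1 - s' → 1 - s' ∈ Grid δ I →
      2 * (r t - s') ≤ K → SegmentCert G δ K I := by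
    intro s' h0' hst' hle hg hK'
    refine ⟨u, v, s', r t, huv, h0', hst', ht.2, mem_grid hδ hI ht hj0 hj2 he, hg, hK', by linarith,
      by linarith, hv, fun x y hxy hne => (hE x y hxy hne).transfer radd ?_⟩
    have hd : ∀ x y α, overlapping u v s t x y α → ∃ α', overlapping u v s' (r t) x y α' ∧
        r α ≤ α' := by
      rintro x y α (⟨rfl, rfl, rfl⟩ | ⟨rfl, rfl, rfl⟩)
      · exact ⟨r α, .inl ⟨rfl, rfl, rfl⟩, le_rfl⟩
      · exact ⟨1 - s', .inr ⟨rfl, rfl, rfl⟩, hle⟩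
    rintro x y α D (⟨rfl, h | ⟨h, rfl⟩⟩ | ⟨w, hw, rfl, p, rfl⟩ | ⟨u, v, h, p, rfl⟩)
    · obtain ⟨α', h', hα⟩ := hd _ _ _ h
      exact ⟨α', 0, .inl ⟨rfl, .inl h'⟩, by linarith⟩
    · exact h.elim
    · exact hw.elim
    · obtain ⟨α', h', hα⟩ := hd _ _ _ h
      exact ⟨α', _, .inr (.inr ⟨_, _, h', p, rfl⟩), by linarith⟩
  -- If the rounded ends have crossed, the segment is replaced by the single point at `r t`, which
  -- reaches at least as far as required in both directions at no cost.
  rcases le_or_gt 1 (r t + r (1 - s)) with h | h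
  · refine main (1 - r (1 - s)) (by linarith [hs.2]) (by linarith) (by linarith) ?_ (by linarith)
    rw [sub_sub_cancel]
    exact mem_grid hδ hI hs hj0' hj2' he'
  · exact main (r t) ht.1 le_rfl (by linarith) (one_sub_mem_grid hδ hI ht hj0 hj2 he)
      (by linarith)

theorem covers_of_edges (P : Set (V → ℝ)) (hδ : 0 ≤ δ)
    (hv : ∀ x, vtx x ∈ P ∨ ∃ y, G.Adj x y)
    (he : ∀ x y t, G.Adj x y → t ∈ Set.Icc (0 : ℝ) 1 → ∃ q ∈ P, Within G (pt x y t) q δ) :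
    Covers G δ P := by
  rintro p (⟨x, rfl⟩ | ⟨x, y, hxy, t, ht, rfl⟩)
  · rcases hv x with h | ⟨y, hxy⟩
    · exact iInf_pointDist_le h ⟨0, hδ, _, .nil (vtx_mem_pointSet x)⟩
    · obtain ⟨q, hq, h⟩ := he x y 0 hxy (by simp)
      rw [pt_zero] at h
      exact iInf_pointDist_le hq h
  · obtain ⟨q, hq, h⟩ := he x y t hxy ht
    exact iInf_pointDist_le hq h

theorem WalkCert.exists_trail (hδ : 0 ≤ δ) (h : WalkCert G δ K I) :
    ∃ x ℓ P, Trail G x x ℓ P ∧ ℓ ≤ K ∧ Covers G δ P := by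
  obtain ⟨c, W, l, hl, -, hK, hv, hE⟩ := h
  obtain ⟨P, hT, hP⟩ := Trail.of_walk_detours W l hl
  refine ⟨_, _, P, hT, hK, covers_of_edges P hδ (fun x => (hv x).imp_left fun h => hP
    (.inl ⟨x, h, rfl⟩)) fun x y t hxy ht => ?_⟩
  have hd : ∀ x y α, Direct (fun x y => s(x, y) ∈ W.edges) (fun u v α => (u, v, α) ∈ l) x y α →
      α ∈ Set.Icc (0 : ℝ) 1 ∧ ∀ r ∈ Set.Icc 0 α, pt x y r ∈ P := by
    rintro x y α (h | ⟨h, rfl⟩)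
    · exact ⟨(hl _ _ _ h).2.2, fun r hr => hP (.inr (.inr ⟨x, y, α, h, r, hr, rfl⟩))⟩
    · exact ⟨by simp, fun r hr => hP (.inr (.inl ⟨x, y, h, r, hr, rfl⟩))⟩
  refine (hE x y hxy).exists_within (fun w hw => hP (.inl ⟨w, hw, rfl⟩)) (fun u v α h => ?_) hxy
    (hd x y) (hd y x) hδ ht
  have := hl _ _ _ h
  exact ⟨this.2.1, this.2.2, hP (.inr (.inr ⟨u, v, α, h, α, ⟨this.2.2.1, le_rfl⟩, rfl⟩))⟩

theorem SegmentCert.exists_trail (hδ : 0 ≤ δ) (h : SegmentCert G δ K I) :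
    ∃ x ℓ P, Trail G x x ℓ P ∧ ℓ ≤ K ∧ Covers G δ P := by
  obtain ⟨u, v, s, t, huv, h0, hst, h1, -, -, hK, hsδ, htδ, hv, hE⟩ := h
  obtain ⟨P, hT, hP⟩ := Trail.of_segment huv h0 hst h1
  have huvP : ∀ a ∈ Set.Icc (0 : ℝ) 1, ∃ q ∈ P, Within G (pt u v a) q δ := by
    intro a ha
    have hs' : s ∈ Set.Icc (0 : ℝ) 1 := ⟨h0, hst.trans h1⟩
    have ht' : t ∈ Set.Icc (0 : ℝ) 1 := ⟨h0.trans hst, h1⟩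
    rcases le_total a s with h | h
    · refine ⟨_, hP s le_rfl hst, (Within.edge huv ha hs').mono ?_⟩
      rw [abs_of_nonpos (by linarith)]
      linarith [ha.1]
    rcases le_total t a with h' | h'
    · refine ⟨_, hP t hst le_rfl, (Within.edge huv ha ht').mono ?_⟩
      rw [abs_of_nonneg (by linarith)]
      linarith [ha.2]
    · exact ⟨_, hP a h h', (Within.edge huv ha ha).mono (by simpa using hδ)⟩
  refine ⟨_, _, P, hT, hK, covers_of_edges P hδ (fun x => .inr (hv x)) fun x y a hxy ha => ?_⟩
  by_cases hne : s(x, y) = s(u, v)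
  · rcases Sym2.eq_iff.1 hne with ⟨rfl, rfl⟩ | ⟨rfl, rfl⟩
    · exact huvP a ha
    · rw [pt_symm]
      exact huvP _ (one_sub_mem ha)
  -- Vacuous: away from the edge `uv` nothing is passed directly. On `uv` it could fail, since the
  -- pieces in `overlapping` are not wholly passed, so that edge is treated separately.
  have hd : ∀ {x y}, s(x, y) ≠ s(u, v) → ∀ α,
      Direct (fun _ _ => False) (overlapping u v s t) x y α →
        α ∈ Set.Icc (0 : ℝ) 1 ∧ ∀ r ∈ Set.Icc 0 α, pt x y r ∈ P := by
    rintro x y hne α ((⟨rfl, rfl, -⟩ | ⟨rfl, rfl, -⟩) | ⟨h, -⟩)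
    · exact absurd rfl hne
    · exact absurd Sym2.eq_swap hne
    · exact h.elim
  refine (hE x y hxy hne).exists_within (fun w hw => hw.elim) ?_ hxy (hd hne)
    (hd (by rwa [Sym2.eq_swap])) hδ ha
  rintro u' v' α (⟨rfl, rfl, rfl⟩ | ⟨rfl, rfl, rfl⟩)
  · exact ⟨huv, ⟨h0.trans hst, h1⟩, hP _ hst le_rfl⟩
  · refine ⟨huv.symm, ⟨by linarith, by linarith⟩, ?_⟩
    rw [pt_symm, sub_sub_cancel]
    exact hP _ le_rfl hst

/-- Tours exist if and only if certificates exist. -/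
theorem exists_deltaTour_iff_cert (hδ : 0 ≤ δ) (hI : 2 + 4 * δ ≤ I) :
    (∃ T, IsDeltaTour G δ T ∧ walkLength T ≤ K) ↔ WalkCert G δ K I ∨ SegmentCert G δ K I := by
  rw [exists_deltaTour_iff]
  constructor
  · rintro ⟨x, ℓ, P, hT, hK, hcov⟩
    rcases hT.decompose with ⟨c, W, l, hl, hc, hP⟩ | ⟨u, v, s, t, huv, h0, hst, h1, hℓ, hP⟩
    · exact .inl (.of_walk hδ hI W l hl hP hcov (hc.trans hK))
    · exact .inr (.of_segment hδ hI huv h0 hst h1 hP hcov (hℓ.trans hK))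
  · rintro (h | h)
    · exact h.exists_trail hδ
    · exact h.exists_trail hδ

end DeltaTour

namespace RealRAM

/-! ### Certificates coded by natural numbers -/

/-- Comparison of integer linear combinations of `1`, `δ` and `K`. -/
def Inst.le (X : Inst) (a b c a' b' c' : ℕ) : Prop :=
  (a + b * X.δ + c * X.K : ℝ) ≤ a' + b' * X.δ + c' * X.K

/-- There is a walk of length `d` from `a` to `b`. -/
def Inst.HasWalk (X : Inst) (d a b : ℕ) : Prop :=
  ∃ N < X.n ^ (d + 1), dig X.n N 0 = a ∧ dig X.n N d = b ∧
    ∀ k < d, X.E (dig X.n N k) (dig X.n N (k + 1))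

/-- A coded skeleton: the digits of `w` are the `M` vertices of a walk, those of `u`, `v`, `i`, `j`
are the ends and the lengths of the `L` detours, with `I` the size of the grid. -/
structure Code where
  I : ℕ
  M : ℕ
  w : ℕ
  L : ℕ
  u : ℕ
  v : ℕ
  i : ℕ
  j : ℕ

/-- The length 1 has the grid indices `I + 2` and `2`. An anchored reach with count `D` uses a walk
of length `D - 1`. -/
def Inst.Reaches (X : Inst) (C : Code) (x y i j D : ℕ) : Prop :=
  (D = 0 ∧ ((∃ k < C.L, dig X.n C.u k = x ∧ dig X.n C.v k = y ∧ dig (2 * C.I + 1) C.i k = i ∧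
        dig 5 C.j k = j) ∨
      ((i = C.I + 2 ∧ j = 2) ∧ ∃ k < C.M - 1, (dig X.n C.w k = x ∧ dig X.n C.w (k + 1) = y) ∨
        (dig X.n C.w k = y ∧ dig X.n C.w (k + 1) = x)))) ∨
    (1 ≤ D ∧ (((i = C.I + 2 ∧ j = 2) ∧ ∃ k < C.M, X.HasWalk (D - 1) (dig X.n C.w k) x) ∨
      ∃ k < C.L, (dig (2 * C.I + 1) C.i k = i ∧ dig 5 C.j k = j) ∧
        X.HasWalk (D - 1) (dig X.n C.v k) x))

/-- The comparison is the overlap inequality multiplied by 2, with negative terms moved to the other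
side so that all coefficients are natural. Restricting to `D ≤ I` loses nothing, as lengths are at
most 1 and thus `D + D' ≤ 1 + 2 * δ`. -/
def Inst.EdgeCovered (X : Inst) (C : Code) (x y : ℕ) : Prop :=
  ∃ i < 2 * C.I + 1, ∃ j < 5, ∃ D < C.I + 1, ∃ i' < 2 * C.I + 1, ∃ j' < 5, ∃ D' < C.I + 1,
    X.Reaches C x y i j D ∧ X.Reaches C y x i' j' D' ∧
      X.le (2 + 2 * D + 2 * D' + 2 * C.I) (2 * j + 2 * j') 0 (i + i') 12 0

def Inst.WalkCert (X : Inst) (C : Code) : Prop :=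
  (1 ≤ C.M ∧ dig X.n C.w 0 = dig X.n C.w (C.M - 1) ∧
    ∀ k < C.M - 1, X.E (dig X.n C.w k) (dig X.n C.w (k + 1))) ∧
  (∀ k < C.L, (∃ k' < C.M, dig X.n C.w k' = dig X.n C.u k) ∧
    X.E (dig X.n C.u k) (dig X.n C.v k) ∧
    ¬ X.le (dig (2 * C.I + 1) C.i k) 4 0 C.I (2 * dig 5 C.j k) 0 ∧
    X.le (dig (2 * C.I + 1) C.i k) 4 0 (C.I + 2) (2 * dig 5 C.j k) 0) ∧
  X.le (C.M - 1 + ∑ k ∈ Finset.range C.L, dig (2 * C.I + 1) C.i k) (4 * C.L) 0 (C.L * C.I)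
    (2 * ∑ k ∈ Finset.range C.L, dig 5 C.j k) 1 ∧
  (∀ x < X.n, (∃ k < C.M, dig X.n C.w k = x) ∨ ∃ y < X.n, X.E x y) ∧
  ∀ x < X.n, ∀ y < X.n, X.E x y → X.EdgeCovered C x y

/-- A segment is coded as an empty walk with two detours, of lengths `t` and `1 - s`, from the two
ends of the edge. So the edge criterion can be shared with walk codes. -/
def Inst.SegmentCert (X : Inst) (C : Code) : Prop :=
  (C.M = 0 ∧ C.L = 2) ∧
  (dig X.n C.u 1 = dig X.n C.v 0 ∧ dig X.n C.v 1 = dig X.n C.u 0 ∧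
    X.E (dig X.n C.u 0) (dig X.n C.v 0)) ∧
  (∀ k < 2, X.le C.I (2 * dig 5 C.j k) 0 (dig (2 * C.I + 1) C.i k) 4 0 ∧
    X.le (dig (2 * C.I + 1) C.i k) 4 0 (C.I + 2) (2 * dig 5 C.j k) 0 ∧
    X.le (2 + C.I) (2 * dig 5 C.j k) 0 (dig (2 * C.I + 1) C.i k) 6 0) ∧
  (X.le (2 + 2 * C.I) (2 * dig 5 C.j 0 + 2 * dig 5 C.j 1) 0
      (dig (2 * C.I + 1) C.i 0 + dig (2 * C.I + 1) C.i 1) 8 0 ∧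
    X.le (dig (2 * C.I + 1) C.i 0 + dig (2 * C.I + 1) C.i 1) 8 0 (2 * C.I + 2)
      (2 * dig 5 C.j 0 + 2 * dig 5 C.j 1) 1) ∧
  (∀ x < X.n, ∃ y < X.n, X.E x y) ∧
  ∀ x < X.n, ∀ y < X.n, X.E x y → ((x = dig X.n C.u 0 ∧ y = dig X.n C.v 0) ∨
    (x = dig X.n C.v 0 ∧ y = dig X.n C.u 0)) ∨ X.EdgeCovered C x y

/-! ### Decidability of the coded certificates. -/

section Dec

variable {Γ : Type} {c : Ctx Γ}

theorem Dec.hasWalk {d a b : Γ → ℕ} (hn : NatComp c fun γ => (c.inst γ).n) (hd : NatComp c d)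
    (hdp : ParamBdd c d) (ha : NatComp c a) (hb : NatComp c b) :
    Dec c fun γ => (c.inst γ).HasWalk (d γ) (a γ) (b γ) := by
  have hB : NatComp c fun γ => (c.inst γ).n ^ (d γ + 1) :=
    hn.pow (hd.add (.const 1)) (hdp.add (.const 1))
  set c' := c.ext fun γ => (c.inst γ).n ^ (d γ + 1) with hc'
  have hn' : NatComp c' fun p => (c'.inst p).n := hn.lift
  have hN : NatComp c' fun p => p.2 := .last hB.1
  have hD : NatComp c' fun p => d p.1 := hd.lift
  have hDp : ParamBdd c' fun p => d p.1 := hdp.lift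
  have hk : NatComp (c'.ext fun p => d p.1) fun q => q.2 := .last hD.1
  have hkp : ParamBdd (c'.ext fun p => d p.1) fun q => q.2 := .last hDp
  exact .bex hB ((Dec.eq (hn'.dig hN (.const 0) (.const 0)) ha.lift).and
    ((Dec.eq (hn'.dig hN hD hDp) hb.lift).and
      (.ball hD (.adj hn'.lift (hn'.lift.dig hN.lift hk hkp)
        (hn'.lift.dig hN.lift (hk.add (.const 1)) (hkp.add (.const 1)))))))

/-- The components of a code are computable. -/
structure CodeComp (c : Ctx Γ) (C : Γ → Code) : Prop where
  n : NatComp c fun γ => (c.inst γ).n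
  I : NatComp c fun γ => (C γ).I
  M : NatComp c fun γ => (C γ).M
  w : NatComp c fun γ => (C γ).w
  L : NatComp c fun γ => (C γ).L
  u : NatComp c fun γ => (C γ).u
  v : NatComp c fun γ => (C γ).v
  i : NatComp c fun γ => (C γ).i
  j : NatComp c fun γ => (C γ).j
  Ip : ParamBdd c fun γ => (C γ).I
  Mp : ParamBdd c fun γ => (C γ).M
  Lp : ParamBdd c fun γ => (C γ).L

variable {C : Γ → Code}

theorem CodeComp.lift {b : Γ → ℕ} (h : CodeComp c C) : CodeComp (c.ext b) fun p => C p.1 :=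
  ⟨h.n.lift, h.I.lift, h.M.lift, h.w.lift, h.L.lift, h.u.lift, h.v.lift, h.i.lift, h.j.lift,
    h.Ip.lift, h.Mp.lift, h.Lp.lift⟩

theorem CodeComp.dw {k : Γ → ℕ} (h : CodeComp c C) (hk : NatComp c k) (hkp : ParamBdd c k) :
    NatComp c fun γ => dig (c.inst γ).n (C γ).w (k γ) := h.n.dig h.w hk hkp

theorem CodeComp.du {k : Γ → ℕ} (h : CodeComp c C) (hk : NatComp c k) (hkp : ParamBdd c k) :
    NatComp c fun γ => dig (c.inst γ).n (C γ).u (k γ) := h.n.dig h.u hk hkp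

theorem CodeComp.dv {k : Γ → ℕ} (h : CodeComp c C) (hk : NatComp c k) (hkp : ParamBdd c k) :
    NatComp c fun γ => dig (c.inst γ).n (C γ).v (k γ) := h.n.dig h.v hk hkp

theorem CodeComp.di {k : Γ → ℕ} (h : CodeComp c C) (hk : NatComp c k) (hkp : ParamBdd c k) :
    NatComp c fun γ => dig (2 * (C γ).I + 1) (C γ).i (k γ) :=
  (((NatComp.const 2).mul h.I).add (.const 1)).dig h.i hk hkp

theorem CodeComp.dj {k : Γ → ℕ} (h : CodeComp c C) (hk : NatComp c k) (hkp : ParamBdd c k) :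
    NatComp c fun γ => dig 5 (C γ).j (k γ) := (NatComp.const 5).dig h.j hk hkp

theorem CodeComp.grid (h : CodeComp c C) : NatComp c fun γ => 2 * (C γ).I + 1 :=
  ((NatComp.const 2).mul h.I).add (.const 1)

theorem ParamBdd.sub_const {f : Γ → ℕ} (hf : ParamBdd c f) (m : ℕ) :
    ParamBdd c fun γ => f γ - m :=
  hf.mono fun _ _ => Nat.sub_le _ _

theorem Dec.reaches {x y i j D : Γ → ℕ} (h : CodeComp c C) (hx : NatComp c x) (hy : NatComp c y)
    (hi : NatComp c i) (hj : NatComp c j) (hD : NatComp c D) (hDp : ParamBdd c D) :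
    Dec c fun γ => (c.inst γ).Reaches (C γ) (x γ) (y γ) (i γ) (j γ) (D γ) := by
  have hM1 : NatComp c fun γ => (C γ).M - 1 := h.M.sub (.const 1)
  have hM1p := h.Mp.sub_const 1
  have hD1 : NatComp c fun γ => D γ - 1 := hD.sub (.const 1)
  have hD1p := hDp.sub_const 1
  have hfull : Dec c fun γ => i γ = (C γ).I + 2 ∧ j γ = 2 :=
    (Dec.eq hi (h.I.add (.const 2))).and (Dec.eq hj (.const 2))
  have kL : NatComp (c.ext fun γ => (C γ).L) fun q => q.2 := .last h.L.1
  have kLp : ParamBdd (c.ext fun γ => (C γ).L) fun q => q.2 := .last h.Lp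
  have kM : NatComp (c.ext fun γ => (C γ).M) fun q => q.2 := .last h.M.1
  have kMp : ParamBdd (c.ext fun γ => (C γ).M) fun q => q.2 := .last h.Mp
  have kM1 : NatComp (c.ext fun γ => (C γ).M - 1) fun q => q.2 := .last hM1.1
  have kM1p : ParamBdd (c.ext fun γ => (C γ).M - 1) fun q => q.2 := .last hM1p
  have w0 := h.lift.dw kM1 kM1p
  have w1 := h.lift.dw (kM1.add (.const 1)) (kM1p.add (.const 1))
  have hij : Dec (c.ext fun γ => (C γ).L) fun q =>
      dig (2 * (C q.1).I + 1) (C q.1).i q.2 = i q.1 ∧ dig 5 (C q.1).j q.2 = j q.1 :=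
    (Dec.eq (h.lift.di kL kLp) hi.lift).and (Dec.eq (h.lift.dj kL kLp) hj.lift)
  have h₁ : Dec (c.ext fun γ => (C γ).L) fun q => dig (c.inst q.1).n (C q.1).u q.2 = x q.1 ∧
      dig (c.inst q.1).n (C q.1).v q.2 = y q.1 ∧
      dig (2 * (C q.1).I + 1) (C q.1).i q.2 = i q.1 ∧ dig 5 (C q.1).j q.2 = j q.1 :=
    (Dec.eq (h.lift.du kL kLp) hx.lift).and ((Dec.eq (h.lift.dv kL kLp) hy.lift).and hij)
  have h₂ : Dec (c.ext fun γ => (C γ).M - 1) fun q =>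
      (dig (c.inst q.1).n (C q.1).w q.2 = x q.1 ∧
        dig (c.inst q.1).n (C q.1).w (q.2 + 1) = y q.1) ∨
      (dig (c.inst q.1).n (C q.1).w q.2 = y q.1 ∧
        dig (c.inst q.1).n (C q.1).w (q.2 + 1) = x q.1) :=
    ((Dec.eq w0 hx.lift).and (Dec.eq w1 hy.lift)).or
      ((Dec.eq w0 hy.lift).and (Dec.eq w1 hx.lift))
  have h₃ : Dec (c.ext fun γ => (C γ).M) fun q =>
      (c.inst q.1).HasWalk (D q.1 - 1) (dig (c.inst q.1).n (C q.1).w q.2) (x q.1) :=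
    .hasWalk h.lift.n hD1.lift hD1p.lift (h.lift.dw kM kMp) hx.lift
  have h₄ : Dec (c.ext fun γ => (C γ).L) fun q =>
      (dig (2 * (C q.1).I + 1) (C q.1).i q.2 = i q.1 ∧ dig 5 (C q.1).j q.2 = j q.1) ∧
        (c.inst q.1).HasWalk (D q.1 - 1) (dig (c.inst q.1).n (C q.1).v q.2) (x q.1) :=
    hij.and (.hasWalk h.lift.n hD1.lift hD1p.lift (h.lift.dv kL kLp) hx.lift)
  exact .or (.and (.eq hD (.const 0)) (.or (.bex h.L h₁) (hfull.and (.bex hM1 h₂))))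
    (.and (.le (.const 1) hD) (.or (hfull.and (.bex h.M h₃)) (.bex h.L h₄)))

theorem Dec.edgeCovered {x y : Γ → ℕ} (h : CodeComp c C) (hx : NatComp c x) (hy : NatComp c y) :
    Dec c fun γ => (c.inst γ).EdgeCovered (C γ) (x γ) (y γ) := by
  have c2 : ∀ {Δ : Type} {d : Ctx Δ} {f : Δ → ℕ}, NatComp d f → NatComp d fun γ => 2 * f γ :=
    fun hf => (NatComp.const 2).mul hf
  -- Each quantifier extends the context by one variable, addressed by iterated first projections;
  -- here six are stacked.
  set c₁ := c.ext fun γ => 2 * (C γ).I + 1 with hc₁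
  have h₁ : CodeComp c₁ fun p => C p.1 := h.lift
  have i₁ : NatComp c₁ fun p => p.2 := .last h.grid.1
  set c₂ := c₁.ext fun _ => 5 with hc₂
  have h₂ : CodeComp c₂ fun p => C p.1.1 := h₁.lift
  have j₂ : NatComp c₂ fun p => p.2 := .last (.const 5)
  set c₃ := c₂.ext fun p => (C p.1.1).I + 1 with hc₃
  have h₃ : CodeComp c₃ fun p => C p.1.1.1 := h₂.lift
  have b₃ : NatComp c₂ fun p => (C p.1.1).I + 1 := h₂.I.add (.const 1)
  have D₃ : NatComp c₃ fun p => p.2 := .last b₃.1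
  have D₃p : ParamBdd c₃ fun p => p.2 := .last (h₂.Ip.add (.const 1))
  set c₄ := c₃.ext fun p => 2 * (C p.1.1.1).I + 1 with hc₄
  have h₄ : CodeComp c₄ fun p => C p.1.1.1.1 := h₃.lift
  have i₄ : NatComp c₄ fun p => p.2 := .last h₃.grid.1
  set c₅ := c₄.ext fun _ => 5 with hc₅
  have h₅ : CodeComp c₅ fun p => C p.1.1.1.1.1 := h₄.lift
  have j₅ : NatComp c₅ fun p => p.2 := .last (.const 5)
  set c₆ := c₅.ext fun p => (C p.1.1.1.1.1).I + 1 with hc₆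
  have h₆ : CodeComp c₆ fun p => C p.1.1.1.1.1.1 := h₅.lift
  have b₆ : NatComp c₅ fun p => (C p.1.1.1.1.1).I + 1 := h₅.I.add (.const 1)
  have D₆ : NatComp c₆ fun p => p.2 := .last b₆.1
  have D₆p : ParamBdd c₆ fun p => p.2 := .last (h₅.Ip.add (.const 1))
  have hx₆ : NatComp c₆ fun p => x p.1.1.1.1.1.1 := hx.lift.lift.lift.lift.lift.lift
  have hy₆ : NatComp c₆ fun p => y p.1.1.1.1.1.1 := hy.lift.lift.lift.lift.lift.lift
  have hi : NatComp c₆ fun p => p.1.1.1.1.1.2 := i₁.lift.lift.lift.lift.lift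
  have hj : NatComp c₆ fun p => p.1.1.1.1.2 := j₂.lift.lift.lift.lift
  have hD : NatComp c₆ fun p => p.1.1.1.2 := D₃.lift.lift.lift
  have hDp : ParamBdd c₆ fun p => p.1.1.1.2 := D₃p.lift.lift.lift
  have hi' : NatComp c₆ fun p => p.1.1.2 := i₄.lift.lift
  have hj' : NatComp c₆ fun p => p.1.2 := j₅.lift
  have main : Dec c₆ fun p =>
      (c₆.inst p).Reaches (C p.1.1.1.1.1.1) (x p.1.1.1.1.1.1) (y p.1.1.1.1.1.1) p.1.1.1.1.1.2
        p.1.1.1.1.2 p.1.1.1.2 ∧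
      (c₆.inst p).Reaches (C p.1.1.1.1.1.1) (y p.1.1.1.1.1.1) (x p.1.1.1.1.1.1) p.1.1.2 p.1.2
        p.2 ∧
      (c₆.inst p).le (2 + 2 * p.1.1.1.2 + 2 * p.2 + 2 * (C p.1.1.1.1.1.1).I)
        (2 * p.1.1.1.1.2 + 2 * p.1.2) 0 (p.1.1.1.1.1.2 + p.1.1.2) 12 0 :=
    (Dec.reaches h₆ hx₆ hy₆ hi hj hD hDp).and ((Dec.reaches h₆ hy₆ hx₆ hi' hj' D₆ D₆p).and
      (Dec.real ((((NatComp.const 2).add (c2 hD)).add (c2 D₆)).add (c2 h₆.I))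
        ((c2 hj).add (c2 hj')) (.const 0) (hi.add hi') (.const 12) (.const 0)))
  exact .bex h.grid (.bex (.const 5) (.bex b₃ (.bex h₃.grid (.bex (.const 5) (.bex b₆ main)))))

theorem Dec.walkCert (h : CodeComp c C) : Dec c fun γ => (c.inst γ).WalkCert (C γ) := by
  have c2 : ∀ {Δ : Type} {d : Ctx Δ} {f : Δ → ℕ}, NatComp d f → NatComp d fun γ => 2 * f γ :=
    fun hf => (NatComp.const 2).mul hf
  have hM1 : NatComp c fun γ => (C γ).M - 1 := h.M.sub (.const 1)
  have hM1p := h.Mp.sub_const 1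
  have kL : NatComp (c.ext fun γ => (C γ).L) fun q => q.2 := .last h.L.1
  have kLp : ParamBdd (c.ext fun γ => (C γ).L) fun q => q.2 := .last h.Lp
  have kM1 : NatComp (c.ext fun γ => (C γ).M - 1) fun q => q.2 := .last hM1.1
  have kM1p : ParamBdd (c.ext fun γ => (C γ).M - 1) fun q => q.2 := .last hM1p
  have di := h.lift.di kL kLp
  have dj := h.lift.dj kL kLp
  have kn : NatComp (c.ext fun γ => (c.inst γ).n) fun q => q.2 := .last h.n.1
  have hn : CodeComp (c.ext fun γ => (c.inst γ).n) fun p => C p.1 := h.lift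
  have knn : NatComp ((c.ext fun γ => (c.inst γ).n).ext fun p => (c.inst p.1).n) fun q => q.2 :=
    .last hn.n.1
  have kML : NatComp ((c.ext fun γ => (C γ).L).ext fun q => (C q.1).M) fun q => q.2 :=
    .last h.lift.M.1
  have kMLp : ParamBdd ((c.ext fun γ => (C γ).L).ext fun q => (C q.1).M) fun q => q.2 :=
    .last h.lift.Mp
  have kMn : NatComp ((c.ext fun γ => (c.inst γ).n).ext fun q => (C q.1).M) fun q => q.2 :=
    .last hn.M.1
  have kMnp : ParamBdd ((c.ext fun γ => (c.inst γ).n).ext fun q => (C q.1).M) fun q => q.2 :=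
    .last hn.Mp
  have cov : Dec (c.ext fun γ => (c.inst γ).n) fun p => ∀ y < (c.inst p.1).n,
      (c.inst p.1).E p.2 y → (c.inst p.1).EdgeCovered (C p.1) p.2 y :=
    .ball hn.n (.imp (.adj hn.lift.n kn.lift knn) (.edgeCovered hn.lift kn.lift knn))
  have vis : Dec (c.ext fun γ => (c.inst γ).n) fun p =>
      (∃ k < (C p.1).M, dig (c.inst p.1).n (C p.1).w k = p.2) ∨
        ∃ y < (c.inst p.1).n, (c.inst p.1).E p.2 y :=
    .or (.bex hn.M (.eq (hn.lift.dw kMn kMnp) kn.lift))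
      (.bex hn.n (.adj hn.lift.n kn.lift knn))
  have mem : Dec (c.ext fun γ => (C γ).L) fun q =>
      ∃ k' < (C q.1).M, dig (c.inst q.1).n (C q.1).w k' = dig (c.inst q.1).n (C q.1).u q.2 :=
    .bex h.lift.M (.eq (h.lift.lift.dw kML kMLp) (h.lift.du kL kLp).lift)
  have det : Dec (c.ext fun γ => (C γ).L) fun q =>
      (∃ k' < (C q.1).M, dig (c.inst q.1).n (C q.1).w k' = dig (c.inst q.1).n (C q.1).u q.2) ∧
      (c.inst q.1).E (dig (c.inst q.1).n (C q.1).u q.2) (dig (c.inst q.1).n (C q.1).v q.2) ∧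
      ¬ (c.inst q.1).le (dig (2 * (C q.1).I + 1) (C q.1).i q.2) 4 0 (C q.1).I
        (2 * dig 5 (C q.1).j q.2) 0 ∧
      (c.inst q.1).le (dig (2 * (C q.1).I + 1) (C q.1).i q.2) 4 0 ((C q.1).I + 2)
        (2 * dig 5 (C q.1).j q.2) 0 :=
    .and mem (.and (.adj h.lift.n (h.lift.du kL kLp) (h.lift.dv kL kLp))
      (.and (.not (.real di (.const 4) (.const 0) h.lift.I (c2 dj) (.const 0)))
        (.real di (.const 4) (.const 0) (h.lift.I.add (.const 2)) (c2 dj) (.const 0))))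
  have adj : Dec (c.ext fun γ => (C γ).M - 1) fun q =>
      (c.inst q.1).E (dig (c.inst q.1).n (C q.1).w q.2)
        (dig (c.inst q.1).n (C q.1).w (q.2 + 1)) :=
    .adj h.lift.n (h.lift.dw kM1 kM1p) (h.lift.dw (kM1.add (.const 1)) (kM1p.add (.const 1)))
  have len : Dec c fun γ => (c.inst γ).le
      ((C γ).M - 1 + ∑ k ∈ Finset.range (C γ).L, dig (2 * (C γ).I + 1) (C γ).i k) (4 * (C γ).L) 0
      ((C γ).L * (C γ).I) (2 * ∑ k ∈ Finset.range (C γ).L, dig 5 (C γ).j k) 1 :=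
    .real (hM1.add (.sum h.L di)) ((NatComp.const 4).mul h.L) (.const 0) (h.L.mul h.I)
      (c2 (.sum h.L dj)) (.const 1)
  exact .and (.and (.le (.const 1) h.M) (.and (.eq (h.dw (.const 0) (.const 0)) (h.dw hM1 hM1p))
    (.ball hM1 adj))) (.and (.ball h.L det) (.and len (.and (.ball h.n vis) (.ball h.n cov))))

theorem Dec.segmentCert (h : CodeComp c C) : Dec c fun γ => (c.inst γ).SegmentCert (C γ) := by
  have c2 : ∀ {Δ : Type} {d : Ctx Δ} {f : Δ → ℕ}, NatComp d f → NatComp d fun γ => 2 * f γ :=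
    fun hf => (NatComp.const 2).mul hf
  have k2 : NatComp (c.ext fun _ => 2) fun q => q.2 := .last (.const 2)
  have k2p : ParamBdd (c.ext fun _ => 2) fun q => q.2 := .last (.const 2)
  have h2 : CodeComp (c.ext fun _ => 2) fun p => C p.1 := h.lift
  have di := h2.di k2 k2p
  have dj := h2.dj k2 k2p
  have kn : NatComp (c.ext fun γ => (c.inst γ).n) fun q => q.2 := .last h.n.1
  have hn : CodeComp (c.ext fun γ => (c.inst γ).n) fun p => C p.1 := h.lift
  have knn : NatComp ((c.ext fun γ => (c.inst γ).n).ext fun p => (c.inst p.1).n) fun q => q.2 :=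
    .last hn.n.1
  have z : ∀ m, ParamBdd c fun _ => m := .const
  have i01 := (h.di (.const 0) (z 0)).add (h.di (.const 1) (z 1))
  have j01 := (c2 (h.dj (.const 0) (z 0))).add (c2 (h.dj (.const 1) (z 1)))
  have hu := h.du (.const 0) (z 0)
  have hv := h.dv (.const 0) (z 0)
  have cov : Dec (c.ext fun γ => (c.inst γ).n) fun p => ∀ y < (c.inst p.1).n,
      (c.inst p.1).E p.2 y → ((p.2 = dig (c.inst p.1).n (C p.1).u 0 ∧
        y = dig (c.inst p.1).n (C p.1).v 0) ∨ (p.2 = dig (c.inst p.1).n (C p.1).v 0 ∧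
        y = dig (c.inst p.1).n (C p.1).u 0)) ∨ (c.inst p.1).EdgeCovered (C p.1) p.2 y :=
    .ball hn.n (.imp (.adj hn.lift.n kn.lift knn) (.or
      (.or (.and (.eq kn.lift hu.lift.lift) (.eq knn hv.lift.lift))
        (.and (.eq kn.lift hv.lift.lift) (.eq knn hu.lift.lift)))
      (.edgeCovered hn.lift kn.lift knn)))
  have vis : Dec (c.ext fun γ => (c.inst γ).n) fun p =>
      ∃ y < (c.inst p.1).n, (c.inst p.1).E p.2 y :=
    .bex hn.n (.adj hn.lift.n kn.lift knn)
  have grd : Dec (c.ext fun _ => 2) fun q =>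
      (c.inst q.1).le (C q.1).I (2 * dig 5 (C q.1).j q.2) 0
        (dig (2 * (C q.1).I + 1) (C q.1).i q.2) 4 0 ∧
      (c.inst q.1).le (dig (2 * (C q.1).I + 1) (C q.1).i q.2) 4 0 ((C q.1).I + 2)
        (2 * dig 5 (C q.1).j q.2) 0 ∧
      (c.inst q.1).le (2 + (C q.1).I) (2 * dig 5 (C q.1).j q.2) 0
        (dig (2 * (C q.1).I + 1) (C q.1).i q.2) 6 0 :=
    .and (.real h2.I (c2 dj) (.const 0) di (.const 4) (.const 0)) (.and
      (.real di (.const 4) (.const 0) (h2.I.add (.const 2)) (c2 dj) (.const 0))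
      (.real ((NatComp.const 2).add h2.I) (c2 dj) (.const 0) di (.const 6) (.const 0)))
  refine .and (.and (.eq h.M (.const 0)) (.eq h.L (.const 2))) (.and (.and
    (.eq (h.du (.const 1) (z 1)) hv) (.and (.eq (h.dv (.const 1) (z 1)) hu) (.adj h.n hu hv)))
      (.and (.ball (.const 2) grd) (.and (.and ?_ ?_) (.and (.ball h.n vis) (.ball h.n cov)))))
  · exact .real ((NatComp.const 2).add (c2 h.I)) j01 (.const 0) i01 (.const 8) (.const 0)
  · exact .real i01 (.const 8) (.const 0) ((c2 h.I).add (.const 2)) j01 (.const 1)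

end Dec

end RealRAM

namespace DeltaTour

variable {V : Type*} {G : SimpleGraph V}

/-! ### Walks as sequences -/

theorem exists_walk_of_seq (f : ℕ → V) (d : ℕ) (h : ∀ k < d, G.Adj (f k) (f (k + 1))) :
    ∃ p : G.Walk (f 0) (f d), p.length = d ∧ ∀ k ≤ d, p.getVert k = f k := by
  induction d generalizing f with
  | zero => exact ⟨.nil, rfl, fun k hk => by simp [Nat.le_zero.1 hk]⟩
  | succ d ih =>
    obtain ⟨p, hp, hk⟩ := ih (fun k => f (k + 1)) fun k hk => h (k + 1) (by omega)
    refine ⟨.cons (h 0 (by omega)) p, by simp [hp], fun k hkd => ?_⟩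
    rcases k with _ | k
    · simp
    · rw [SimpleGraph.Walk.getVert_cons_succ, hk k (by omega)]

theorem mem_edges_iff_exists_getVert {a b x y : V} (p : G.Walk a b) : s(x, y) ∈ p.edges ↔
    ∃ k < p.length, (p.getVert k = x ∧ p.getVert (k + 1) = y) ∨
      (p.getVert k = y ∧ p.getVert (k + 1) = x) := by
  induction p with
  | nil => simp
  | cons h p ih =>
    rw [SimpleGraph.Walk.edges_cons, List.mem_cons, ih, SimpleGraph.Walk.length_cons, Sym2.eq_iff]
    constructor
    · rintro (h | ⟨k, hk, h⟩)
      · refine ⟨0, by omega, ?_⟩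
        rw [SimpleGraph.Walk.getVert_zero, SimpleGraph.Walk.getVert_cons_succ,
          SimpleGraph.Walk.getVert_zero]
        tauto
      · exact ⟨k + 1, by omega, by simpa only [SimpleGraph.Walk.getVert_cons_succ] using h⟩
    · rintro ⟨k, hk, h⟩
      rcases k with _ | k
      · rw [SimpleGraph.Walk.getVert_zero, SimpleGraph.Walk.getVert_cons_succ,
          SimpleGraph.Walk.getVert_zero] at h
        left
        tauto
      · exact .inr ⟨k, by omega, by simpa only [SimpleGraph.Walk.getVert_cons_succ] using h⟩

theorem sum_range_eq_sum_list {β : Type*} (l : List β) (g : β → ℝ) (f : ℕ → ℝ)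
    (h : ∀ k (hk : k < l.length), f k = g l[k]) :
    ∑ k ∈ Finset.range l.length, f k = (l.map g).sum := by
  induction l generalizing f with
  | nil => simp
  | cons a l ih =>
    rw [List.length_cons, Finset.sum_range_succ', ih (fun k => f (k + 1)) fun k hk => by
      rw [h (k + 1) (by simpa using hk), List.getElem_cons_succ]]
    rw [h 0 (by simp), List.map_cons, List.sum_cons, add_comm]
    simp

end DeltaTour

/-! ### Correctness of the coding of walk certificates. -/

namespace RealRAM

open DeltaTour

variable {X : Inst} {C : Code}

theorem Inst.E_iff {a b : Fin X.n} : X.E a b ↔ X.G.Adj a b :=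
  ⟨fun ⟨_, _, h⟩ => h, fun h => ⟨a.2, b.2, h⟩⟩

/-- A number with prescribed digits is an encoded sequence of vertices. -/
theorem exists_code {X : Inst} (L : ℕ) (f : ℕ → Fin X.n) :
    ∃ N < X.n ^ L, ∀ k < L, dig X.n N k = f k :=
  exists_dig fun k _ => (f k).2

theorem Inst.hasWalk_iff {d : ℕ} {a b : Fin X.n} :
    X.HasWalk d a b ↔ ∃ p : X.G.Walk a b, d = p.length := by
  constructor
  · rintro ⟨N, -, ha, hb, h⟩
    have hn : 0 < X.n := a.pos
    obtain ⟨p, hp, -⟩ := exists_walk_of_seq (G := X.G) (fun k => ⟨dig X.n N k, dig_lt hn N k⟩) d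
      fun k hk => Inst.E_iff.1 (h k hk)
    exact ⟨p.copy (Fin.ext ha) (Fin.ext hb), by simp [hp]⟩
  · rintro ⟨p, rfl⟩
    obtain ⟨N, hN, h⟩ := exists_code (p.length + 1) p.getVert
    refine ⟨N, hN, by simp [h 0], by simp [h p.length], fun k hk => ?_⟩
    rw [h k (by omega), h (k + 1) (by omega), Inst.E_iff]
    exact p.adj_getVert_succ hk

/-- The grid value with the indices `i` and `j`. -/
noncomputable def Inst.gridValue (X : Inst) (I i j : ℕ) : ℝ :=
  (i + 4 * X.δ - 2 * j * X.δ - I) / 2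

/-- The code `C` describes the skeleton given by `vs`, `tr` and `dg`. -/
structure Codes (X : Inst) (C : Code) (vs : Fin X.n → Prop) (tr : Fin X.n → Fin X.n → Prop)
    (dg : Fin X.n → Fin X.n → ℝ → Prop) : Prop where
  vs_iff : ∀ x, vs x ↔ ∃ k < C.M, dig X.n C.w k = x
  tr_iff : ∀ x y, tr x y ↔ ∃ k < C.M - 1, (dig X.n C.w k = x ∧ dig X.n C.w (k + 1) = y) ∨
    (dig X.n C.w k = y ∧ dig X.n C.w (k + 1) = x)
  dg_iff : ∀ x y α, dg x y α ↔ ∃ k < C.L, dig X.n C.u k = x ∧ dig X.n C.v k = y ∧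
    α = X.gridValue C.I (dig (2 * C.I + 1) C.i k) (dig 5 C.j k)
  le_one : ∀ x y α, dg x y α → α ≤ 1
  size : 2 + 4 * X.δ ≤ C.I

variable {vs : Fin X.n → Prop} {tr : Fin X.n → Fin X.n → Prop}
  {dg : Fin X.n → Fin X.n → ℝ → Prop}

theorem gridValue_full (I : ℕ) : X.gridValue I (I + 2) 2 = 1 := by
  unfold Inst.gridValue
  push_cast
  ring

theorem Codes.reaches (h : Codes X C vs tr dg) {x y : Fin X.n} {i j D : ℕ}
    (hr : X.Reaches C x y i j D) :
    DeltaTour.Reaches X.G vs tr dg x y (X.gridValue C.I i j) D := by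
  rcases hr with ⟨rfl, ⟨k, hk, hu, hv, rfl, rfl⟩ | ⟨⟨rfl, rfl⟩, hk⟩⟩ | ⟨hD, ⟨⟨rfl, rfl⟩, k, hk, hw⟩ |
    ⟨k, hk, ⟨rfl, rfl⟩, hw⟩⟩
  · exact .inl ⟨rfl, .inl ((h.dg_iff _ _ _).2 ⟨k, hk, hu, hv, rfl⟩)⟩
  · exact .inl ⟨rfl, .inr ⟨(h.tr_iff _ _).2 hk, gridValue_full _⟩⟩
  · obtain ⟨p, hp⟩ := Inst.hasWalk_iff (a := ⟨_, dig_lt x.pos C.w k⟩).1 hw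
    exact .inr (.inl ⟨_, (h.vs_iff _).2 ⟨k, hk, rfl⟩, gridValue_full _, p, by omega⟩)
  · obtain ⟨p, hp⟩ := Inst.hasWalk_iff (a := ⟨_, dig_lt x.pos C.v k⟩).1 hw
    exact .inr (.inr ⟨⟨_, dig_lt x.pos C.u k⟩, _, (h.dg_iff _ _ _).2 ⟨k, hk, rfl, rfl, rfl⟩, p,
      by omega⟩)

theorem Codes.exists_reaches (h : Codes X C vs tr dg) {x y : Fin X.n} {α : ℝ} {D : ℕ}
    (hr : DeltaTour.Reaches X.G vs tr dg x y α D) : ∃ i < 2 * C.I + 1, ∃ j < 5,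
      α = X.gridValue C.I i j ∧ X.Reaches C x y i j D := by
  have hI : (2 : ℝ) ≤ C.I := by linarith [h.size, X.δ_nonneg]
  have hI' : 2 ≤ C.I := by exact_mod_cast hI
  have hlt := fun k => dig_lt (B := 2 * C.I + 1) (by omega) C.i k
  have hlt' := fun k => dig_lt (B := 5) (by omega) C.j k
  rcases hr with ⟨rfl, hd | ⟨ht, rfl⟩⟩ | ⟨w, hw, rfl, p, rfl⟩ | ⟨u, v, hd, p, rfl⟩
  · obtain ⟨k, hk, hu, hv, rfl⟩ := (h.dg_iff _ _ _).1 hd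
    exact ⟨_, hlt k, _, hlt' k, rfl, .inl ⟨rfl, .inl ⟨k, hk, hu, hv, rfl, rfl⟩⟩⟩
  · exact ⟨C.I + 2, by omega, 2, by omega, (gridValue_full _).symm,
      .inl ⟨rfl, .inr ⟨⟨rfl, rfl⟩, (h.tr_iff _ _).1 ht⟩⟩⟩
  · obtain ⟨k, hk, hw⟩ := (h.vs_iff _).1 hw
    exact ⟨C.I + 2, by omega, 2, by omega, (gridValue_full _).symm,
      .inr ⟨by omega, .inl ⟨⟨rfl, rfl⟩, k, hk, by rw [hw]; exact Inst.hasWalk_iff.2 ⟨p, rfl⟩⟩⟩⟩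
  · obtain ⟨k, hk, hu, hv, rfl⟩ := (h.dg_iff _ _ _).1 hd
    exact ⟨_, hlt k, _, hlt' k, rfl, .inr ⟨by omega, .inr ⟨k, hk, ⟨rfl, rfl⟩, by
      rw [hv]; exact Inst.hasWalk_iff.2 ⟨p, rfl⟩⟩⟩⟩

theorem Codes.reaches_le_one (h : Codes X C vs tr dg) {x y : Fin X.n} {α : ℝ} {D : ℕ}
    (hr : DeltaTour.Reaches X.G vs tr dg x y α D) : α ≤ 1 := by
  rcases hr with ⟨-, hd | ⟨-, rfl⟩⟩ | ⟨w, -, rfl, -⟩ | ⟨u, v, hd, -⟩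
  exacts [h.le_one _ _ _ hd, le_rfl, le_rfl, h.le_one _ _ _ hd]

theorem Inst.le_edge_iff (I i j D i' j' D' : ℕ) :
    X.le (2 + 2 * D + 2 * D' + 2 * I) (2 * j + 2 * j') 0 (i + i') 12 0 ↔
      (1 + D + D' : ℝ) ≤ X.gridValue I i j + X.gridValue I i' j' + 2 * X.δ := by
  unfold Inst.le Inst.gridValue
  push_cast
  constructor <;> intro h <;> linarith

theorem Codes.edgeCovered_iff (h : Codes X C vs tr dg) {x y : Fin X.n} :
    X.EdgeCovered C x y ↔ DeltaTour.EdgeCovered X.G vs tr dg X.δ x y := by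
  constructor
  · rintro ⟨i, -, j, -, D, -, i', -, j', -, D', -, h₁, h₂, hle⟩
    exact ⟨_, D, _, D', h.reaches h₁, h.reaches h₂, (Inst.le_edge_iff ..).1 hle⟩
  · rintro ⟨α, D, α', D', h₁, h₂, hle⟩
    have hα := h.reaches_le_one h₁
    have hα' := h.reaches_le_one h₂
    have hs := h.size
    have hδ := X.δ_nonneg
    -- Both lengths are at most 1, so `1 + D + D' ≤ 2 + 2 * δ`, and the size condition on `I` leaves
    -- ample room.
    have hD : D < C.I + 1 := by
      have : (D : ℝ) ≤ C.I := by linarith [Nat.cast_nonneg (α := ℝ) D']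
      exact Nat.lt_succ_of_le (by exact_mod_cast this)
    have hD' : D' < C.I + 1 := by
      have : (D' : ℝ) ≤ C.I := by linarith [Nat.cast_nonneg (α := ℝ) D]
      exact Nat.lt_succ_of_le (by exact_mod_cast this)
    obtain ⟨i, hi, j, hj, rfl, h₃⟩ := h.exists_reaches h₁
    obtain ⟨i', hi', j', hj', rfl, h₄⟩ := h.exists_reaches h₂
    exact ⟨i, hi, j, hj, D, hD, i', hi', j', hj', D', hD', h₃, h₄, (Inst.le_edge_iff ..).2 hle⟩

/-- The code `C` describes the walk `W` with the detours `l`. -/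
structure CodesWalk (X : Inst) (C : Code) {c : Fin X.n} (W : X.G.Walk c c)
    (l : List (Fin X.n × Fin X.n × ℝ)) : Prop where
  M_eq : C.M = W.length + 1
  L_eq : C.L = l.length
  w_eq : ∀ k ≤ W.length, dig X.n C.w k = W.getVert k
  u_eq : ∀ k (hk : k < l.length), dig X.n C.u k = l[k].1
  v_eq : ∀ k (hk : k < l.length), dig X.n C.v k = l[k].2.1
  α_eq : ∀ k (hk : k < l.length),
    X.gridValue C.I (dig (2 * C.I + 1) C.i k) (dig 5 C.j k) = l[k].2.2

variable {c : Fin X.n} {W : X.G.Walk c c} {l : List (Fin X.n × Fin X.n × ℝ)}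

theorem CodesWalk.mem_support_iff (h : CodesWalk X C W l) (x : Fin X.n) :
    x ∈ W.support ↔ ∃ k < C.M, dig X.n C.w k = x := by
  rw [SimpleGraph.Walk.mem_support_iff_exists_getVert, h.M_eq]
  constructor
  · rintro ⟨k, rfl, hk⟩
    exact ⟨k, by omega, h.w_eq k hk⟩
  · rintro ⟨k, hk, hx⟩
    exact ⟨k, Fin.ext ((h.w_eq k (by omega)).symm.trans hx), by omega⟩

theorem CodesWalk.codes (h : CodesWalk X C W l) (hl : ∀ u v α, (u, v, α) ∈ l → α ≤ 1)
    (hI : 2 + 4 * X.δ ≤ C.I) :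
    Codes X C (· ∈ W.support) (fun x y => s(x, y) ∈ W.edges) (fun u v α => (u, v, α) ∈ l) where
  vs_iff := h.mem_support_iff
  tr_iff x y := by
    rw [mem_edges_iff_exists_getVert, h.M_eq, Nat.add_sub_cancel]
    refine exists_congr fun k => and_congr_right fun hk => ?_
    rw [h.w_eq k hk.le, h.w_eq (k + 1) hk]
    simp only [Fin.ext_iff]
  dg_iff x y α := by
    rw [List.mem_iff_getElem, h.L_eq]
    constructor
    · rintro ⟨k, hk, he⟩
      refine ⟨k, hk, ?_⟩
      rw [h.u_eq k hk, h.v_eq k hk, h.α_eq k hk, he]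
      exact ⟨rfl, rfl, rfl⟩
    · rintro ⟨k, hk, hu, hv, hα⟩
      rw [h.u_eq k hk] at hu
      rw [h.v_eq k hk] at hv
      rw [h.α_eq k hk] at hα
      exact ⟨k, hk, Prod.ext (Fin.ext hu) (Prod.ext (Fin.ext hv) hα.symm)⟩
  le_one := hl
  size := hI

theorem Inst.pos_iff (I i j : ℕ) : ¬ X.le i 4 0 I (2 * j) 0 ↔ 0 < X.gridValue I i j := by
  unfold Inst.le Inst.gridValue
  push_cast
  rw [not_le]
  constructor <;> intro h <;> linarith

theorem Inst.le_one_iff (I i j : ℕ) : X.le i 4 0 (I + 2) (2 * j) 0 ↔ X.gridValue I i j ≤ 1 := by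
  unfold Inst.le Inst.gridValue
  push_cast
  constructor <;> intro h <;> linarith

theorem gridValue_mem_grid {I i j : ℕ} (hi : i < 2 * I + 1) (hj : j < 5) :
    X.gridValue I i j ∈ Grid X.δ I :=
  ⟨i, j, by omega, by omega, by unfold Inst.gridValue; ring⟩

theorem CodesWalk.cost_iff (h : CodesWalk X C W l) :
    X.le (C.M - 1 + ∑ k ∈ Finset.range C.L, dig (2 * C.I + 1) C.i k) (4 * C.L) 0 (C.L * C.I)
      (2 * ∑ k ∈ Finset.range C.L, dig 5 C.j k) 1 ↔ cost W l ≤ X.K := by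
  have hs := sum_range_eq_sum_list l (fun p => p.2.2) _ h.α_eq
  have hsum : 2 * (l.map fun p => p.2.2).sum =
      ∑ k ∈ Finset.range C.L, (dig (2 * C.I + 1) C.i k : ℝ) + 4 * X.δ * C.L -
        2 * X.δ * ∑ k ∈ Finset.range C.L, (dig 5 C.j k : ℝ) - C.L * C.I := by
    rw [← hs, h.L_eq, Finset.mul_sum, Finset.mul_sum]
    have : ∀ k, 2 * X.gridValue C.I (dig (2 * C.I + 1) C.i k) (dig 5 C.j k) =
        (dig (2 * C.I + 1) C.i k : ℝ) - 2 * X.δ * (dig 5 C.j k : ℝ) + (4 * X.δ - C.I) := by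
      intro k
      unfold Inst.gridValue
      ring
    simp only [this, Finset.sum_add_distrib, Finset.sum_sub_distrib, Finset.sum_const,
      Finset.card_range, nsmul_eq_mul]
    ring
  unfold cost Inst.le
  rw [hsum, h.M_eq, Nat.add_sub_cancel]
  push_cast
  constructor <;> intro h <;> linarith

theorem CodesWalk.inst_walkCert_iff (h : CodesWalk X C W l) (hI : 2 + 4 * X.δ ≤ C.I) :
    X.WalkCert C ↔ Detours W l ∧ (∀ u v α, (u, v, α) ∈ l → 0 < α ∧ α ∈ Grid X.δ C.I) ∧
      cost W l ≤ X.K ∧ (∀ x, x ∈ W.support ∨ ∃ y, X.G.Adj x y) ∧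
        ∀ x y, X.G.Adj x y → WalkCovers W l X.δ x y := by
  have h1 : 1 ≤ C.M ∧ dig X.n C.w 0 = dig X.n C.w (C.M - 1) ∧
      ∀ k < C.M - 1, X.E (dig X.n C.w k) (dig X.n C.w (k + 1)) := by
    rw [h.M_eq, Nat.add_sub_cancel]
    refine ⟨by omega, by simp [h.w_eq], fun k hk => ?_⟩
    rw [h.w_eq k hk.le, h.w_eq (k + 1) hk, Inst.E_iff]
    exact W.adj_getVert_succ hk
  have h2 : (∀ k < C.L, (∃ k' < C.M, dig X.n C.w k' = dig X.n C.u k) ∧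
      X.E (dig X.n C.u k) (dig X.n C.v k) ∧
      ¬ X.le (dig (2 * C.I + 1) C.i k) 4 0 C.I (2 * dig 5 C.j k) 0 ∧
      X.le (dig (2 * C.I + 1) C.i k) 4 0 (C.I + 2) (2 * dig 5 C.j k) 0) ↔
      Detours W l ∧ ∀ u v α, (u, v, α) ∈ l → 0 < α ∧ α ∈ Grid X.δ C.I := by
    have key : ∀ k (hk : k < l.length), ((∃ k' < C.M, dig X.n C.w k' = dig X.n C.u k) ∧
        X.E (dig X.n C.u k) (dig X.n C.v k) ∧
        ¬ X.le (dig (2 * C.I + 1) C.i k) 4 0 C.I (2 * dig 5 C.j k) 0 ∧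
        X.le (dig (2 * C.I + 1) C.i k) 4 0 (C.I + 2) (2 * dig 5 C.j k) 0) ↔
        l[k].1 ∈ W.support ∧ X.G.Adj l[k].1 l[k].2.1 ∧ 0 < l[k].2.2 ∧ l[k].2.2 ≤ 1 := by
      intro k hk
      rw [Inst.pos_iff, Inst.le_one_iff, h.α_eq k hk, h.u_eq k hk, h.v_eq k hk, Inst.E_iff,
        h.mem_support_iff]
    rw [h.L_eq]
    constructor
    · intro H
      refine ⟨fun u v α hm => ?_, fun u v α hm => ?_⟩ <;>
        obtain ⟨k, hk, he⟩ := List.mem_iff_getElem.1 hm <;>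
        have := (key k hk).1 (H k hk)
      · rw [he] at this
        exact ⟨this.1, this.2.1, this.2.2.1.le, this.2.2.2⟩
      · have hα := h.α_eq k hk
        rw [he] at this hα
        dsimp only at this hα
        exact ⟨this.2.2.1, hα ▸ gridValue_mem_grid (dig_lt (by omega) _ _) (dig_lt (by omega) _ _)⟩
    · rintro ⟨H, H'⟩ k hk
      have a := H _ _ _ (List.getElem_mem hk)
      exact (key k hk).2 ⟨a.1, a.2.1, (H' _ _ _ (List.getElem_mem hk)).1, a.2.2.2⟩
  have h4 : (∀ x < X.n, (∃ k < C.M, dig X.n C.w k = x) ∨ ∃ y < X.n, X.E x y) ↔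
      ∀ x, x ∈ W.support ∨ ∃ y, X.G.Adj x y := by
    rw [Fin.forall_iff]
    refine forall₂_congr fun x hx => ?_
    rw [h.mem_support_iff, Fin.exists_iff]
    exact or_congr_right ⟨fun ⟨y, hy, h⟩ => ⟨y, hy, Inst.E_iff.1 h⟩,
      fun ⟨y, hy, h⟩ => ⟨y, hy, hx, hy, h⟩⟩
  unfold Inst.WalkCert
  rw [h2, h.cost_iff, h4, and_assoc (a := Detours W l)]
  constructor
  · rintro ⟨-, hd, hg, hc, hv, H⟩
    have cd := h.codes (fun u v α hm => (hd u v α hm).2.2.2) hI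
    exact ⟨hd, hg, hc, hv, fun x y hxy => cd.edgeCovered_iff.1 (H x x.2 y y.2 (Inst.E_iff.2 hxy))⟩
  · rintro ⟨hd, hg, hc, hv, H⟩
    have cd := h.codes (fun u v α hm => (hd u v α hm).2.2.2) hI
    refine ⟨h1, hd, hg, hc, hv, fun x hx y hy hxy => ?_⟩
    exact (cd.edgeCovered_iff (x := ⟨x, hx⟩) (y := ⟨y, hy⟩)).2
      (H ⟨x, hx⟩ ⟨y, hy⟩ (Inst.E_iff.1 hxy))

theorem Inst.WalkCert.walkCert (h : X.WalkCert C) (hn : 0 < X.n) (hI : 2 + 4 * X.δ ≤ C.I) :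
    DeltaTour.WalkCert X.G X.δ X.K C.I := by
  obtain ⟨hM, hc, hE⟩ := h.1
  let f : ℕ → ℕ → Fin X.n := fun N k => ⟨dig X.n N k, dig_lt hn N k⟩
  obtain ⟨p, hp, hpk⟩ := exists_walk_of_seq (G := X.G) (f C.w) (C.M - 1) fun k hk =>
    Inst.E_iff.1 (hE k hk)
  have hcc : f C.w (C.M - 1) = f C.w 0 := Fin.ext hc.symm
  let l : List (Fin X.n × Fin X.n × ℝ) := (List.range C.L).map fun k => (f C.u k, f C.v k,
    X.gridValue C.I (dig (2 * C.I + 1) C.i k) (dig 5 C.j k))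
  have cw : CodesWalk X C (p.copy rfl hcc) l :=
    { M_eq := by simp [hp]; omega
      L_eq := by simp [l]
      w_eq := fun k hk => by
        rw [SimpleGraph.Walk.length_copy, hp] at hk
        rw [SimpleGraph.Walk.getVert_copy, hpk k hk]
      u_eq := fun k hk => by simp [l, f]
      v_eq := fun k hk => by simp [l, f]
      α_eq := fun k hk => by simp [l] }
  exact ⟨_, _, _, (cw.inst_walkCert_iff hI).1 h⟩

/-- The number `m` is such that `m` detours of any positive grid length exceed the budget. It bounds
the number of detours and, because 1 is a grid value, also the length of the walk. -/
theorem exists_inst_walkCert {I : ℕ} (h : DeltaTour.WalkCert X.G X.δ X.K I)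
    (hI : 2 + 4 * X.δ ≤ I) {m : ℕ} (hm : ∀ α ∈ Grid X.δ I, 0 < α → X.K < m * (2 * α)) :
    ∃ M < 2 * m + 1, ∃ w < X.n ^ M, ∃ L < m, ∃ u < X.n ^ L, ∃ v < X.n ^ L,
      ∃ i < (2 * I + 1) ^ L, ∃ j < 5 ^ L, X.WalkCert ⟨I, M, w, L, u, v, i, j⟩ := by
  obtain ⟨c, W, l, H⟩ := h
  obtain ⟨hd, hg, hc, -⟩ := id H
  have hδ := X.δ_nonneg
  have hI' : 2 ≤ I := by
    have : (2 : ℝ) ≤ I := by linarith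
    exact_mod_cast this
  have hK2 : X.K < m * 2 := by
    have := hm 1 (gridValue_full (X := X) I ▸ gridValue_mem_grid (by omega) (by omega)) one_pos
    linarith
  have hs0 : 0 ≤ (l.map fun p => p.2.2).sum := List.sum_nonneg fun a ha => by
    obtain ⟨p, hp, rfl⟩ := List.mem_map.1 ha
    exact (hg _ _ _ hp).1.le
  have hlen : W.length + 1 < 2 * m + 1 := by
    have : (W.length : ℝ) < (2 * m : ℕ) := by
      push_cast
      unfold cost at hc
      linarith
    have : W.length < 2 * m := by exact_mod_cast this
    omega
  have hL : l.length < m := by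
    by_contra! hml
    have hm0 : (0 : ℝ) < m := by linarith [X.K_nonneg]
    have hne : l ≠ [] := by
      rintro rfl
      have : (m : ℝ) ≤ 0 := by exact_mod_cast hml
      linarith
    -- Summing `K < m * (2 * α)` over all detours: with at least `m` of them, twice their total
    -- length would exceed `K`.
    have hlt : (l.map fun _ => X.K).sum < (l.map fun p => (m : ℝ) * (2 * p.2.2)).sum :=
      List.sum_lt_sum_of_ne_nil hne _ _ fun p hp => hm _ (hg _ _ _ hp).2 (hg _ _ _ hp).1
    rw [List.sum_map_mul_left, List.sum_map_mul_left] at hlt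
    simp only [List.map_const', List.sum_replicate, nsmul_eq_mul] at hlt
    have h1 : (m : ℝ) * X.K ≤ l.length * X.K :=
      mul_le_mul_of_nonneg_right (by exact_mod_cast hml) X.K_nonneg
    have h2 := lt_of_mul_lt_mul_left (h1.trans_lt hlt) hm0.le
    unfold cost at hc
    linarith [Nat.cast_nonneg (α := ℝ) W.length]
  have hgi : ∀ k : ℕ, ∃ i j : ℕ, i < 2 * I + 1 ∧ j < 5 ∧
      ∀ hk : k < l.length, X.gridValue I i j = l[k].2.2 := by
    intro k
    by_cases hk : k < l.length
    · obtain ⟨i, j, hi, hj, he⟩ := (hg _ _ _ (List.getElem_mem hk)).2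
      refine ⟨i, j, by omega, by omega, fun _ => ?_⟩
      rw [List.get_eq_getElem] at he
      unfold Inst.gridValue
      linarith
    · exact ⟨0, 0, by omega, by omega, fun h => absurd h hk⟩
  choose fi fj hfi hfj hf using hgi
  obtain ⟨w, hw, hwk⟩ := exists_code (W.length + 1) W.getVert
  obtain ⟨u, hu, huk⟩ := exists_code l.length fun k => (l[k]?.map fun p => p.1).getD c
  obtain ⟨v, hv, hvk⟩ := exists_code l.length fun k => (l[k]?.map fun p => p.2.1).getD c
  obtain ⟨i, hi, hik⟩ := exists_dig (L := l.length) fun k _ => hfi k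
  obtain ⟨j, hj, hjk⟩ := exists_dig (L := l.length) fun k _ => hfj k
  have cw : CodesWalk X ⟨I, W.length + 1, w, l.length, u, v, i, j⟩ W l :=
    { M_eq := rfl
      L_eq := rfl
      w_eq := fun k hk => hwk k (by omega)
      u_eq := fun k hk => by simp [huk k hk, hk]
      v_eq := fun k hk => by simp [hvk k hk, hk]
      α_eq := fun k hk => by simp only [hik k hk, hjk k hk, hf k hk] }
  exact ⟨_, hlen, w, hw, _, hL, u, hu, v, hv, i, hi, j, hj, (cw.inst_walkCert_iff hI).2 H⟩

end RealRAM

/-! ### Correctness of the coding of segment certificates. -/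

namespace RealRAM

open DeltaTour

variable {X : Inst} {C : Code}

/-- The code `C` describes the segment from `s` to `t` of the edge `uv`. -/
structure CodesSegment (X : Inst) (C : Code) (u v : Fin X.n) (s t : ℝ) : Prop where
  M_eq : C.M = 0
  L_eq : C.L = 2
  u_zero : dig X.n C.u 0 = u
  v_zero : dig X.n C.v 0 = v
  u_one : dig X.n C.u 1 = v
  v_one : dig X.n C.v 1 = u
  α_zero : X.gridValue C.I (dig (2 * C.I + 1) C.i 0) (dig 5 C.j 0) = t
  α_one : X.gridValue C.I (dig (2 * C.I + 1) C.i 1) (dig 5 C.j 1) = 1 - s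

variable {u v : Fin X.n} {s t : ℝ}

theorem CodesSegment.codes (h : CodesSegment X C u v s t) (hs : 0 ≤ s) (ht : t ≤ 1)
    (hI : 2 + 4 * X.δ ≤ C.I) :
    Codes X C (fun _ => False) (fun _ _ => False) (overlapping u v s t) where
  vs_iff x := by simp [h.M_eq]
  tr_iff x y := by simp [h.M_eq]
  dg_iff x y α := by
    rw [h.L_eq]
    constructor
    · rintro (⟨rfl, rfl, rfl⟩ | ⟨rfl, rfl, rfl⟩)
      · exact ⟨0, by omega, h.u_zero, h.v_zero, h.α_zero.symm⟩
      · exact ⟨1, by omega, h.u_one, h.v_one, h.α_one.symm⟩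
    · rintro ⟨k, hk, hu, hv, rfl⟩
      rcases k with _ | k
      · rw [h.u_zero] at hu
        rw [h.v_zero] at hv
        exact .inl ⟨(Fin.ext hu).symm, (Fin.ext hv).symm, h.α_zero⟩
      · obtain rfl : k = 0 := by omega
        rw [zero_add, h.u_one] at hu
        rw [zero_add, h.v_one] at hv
        exact .inr ⟨(Fin.ext hu).symm, (Fin.ext hv).symm, h.α_one⟩
  le_one x y α := by
    rintro (⟨-, -, rfl⟩ | ⟨-, -, rfl⟩)
    · exact ht
    · linarith
  size := hI

theorem Inst.nonneg_iff (I i j : ℕ) : X.le I (2 * j) 0 i 4 0 ↔ 0 ≤ X.gridValue I i j := by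
  unfold Inst.le Inst.gridValue
  push_cast
  constructor <;> intro h <;> linarith

theorem Inst.one_le_add_iff (I i j : ℕ) :
    X.le (2 + I) (2 * j) 0 i 6 0 ↔ 1 ≤ X.gridValue I i j + X.δ := by
  unfold Inst.le Inst.gridValue
  push_cast
  constructor <;> intro h <;> linarith

theorem Inst.one_le_add_gridValue_iff (I i j i' j' : ℕ) :
    X.le (2 + 2 * I) (2 * j + 2 * j') 0 (i + i') 8 0 ↔
      1 ≤ X.gridValue I i j + X.gridValue I i' j' := by
  unfold Inst.le Inst.gridValue
  push_cast
  constructor <;> intro h <;> linarith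

theorem Inst.segment_length_iff (I i j i' j' : ℕ) :
    X.le (i + i') 8 0 (2 * I + 2) (2 * j + 2 * j') 1 ↔
      2 * (X.gridValue I i j + X.gridValue I i' j' - 1) ≤ X.K := by
  unfold Inst.le Inst.gridValue
  push_cast
  constructor <;> intro h <;> linarith

theorem CodesSegment.inst_segmentCert_iff (h : CodesSegment X C u v s t)
    (hI : 2 + 4 * X.δ ≤ C.I) :
    X.SegmentCert C ↔ X.G.Adj u v ∧ 0 ≤ s ∧ s ≤ t ∧ t ≤ 1 ∧ 2 * (t - s) ≤ X.K ∧ s ≤ X.δ ∧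
      1 - t ≤ X.δ ∧ (∀ x, ∃ y, X.G.Adj x y) ∧ ∀ x y, X.G.Adj x y → s(x, y) ≠ s(u, v) →
        DeltaTour.EdgeCovered X.G (fun _ => False) (fun _ _ => False) (overlapping u v s t)
          X.δ x y := by
  have h5 : (∀ x < X.n, ∃ y < X.n, X.E x y) ↔ ∀ x, ∃ y, X.G.Adj x y := by
    rw [Fin.forall_iff]
    refine forall₂_congr fun x hx => ?_
    rw [Fin.exists_iff]
    exact ⟨fun ⟨y, hy, h⟩ => ⟨y, hy, Inst.E_iff.1 h⟩, fun ⟨y, hy, h⟩ => ⟨y, hy, hx, hy, h⟩⟩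
  have h6 : 0 ≤ s → t ≤ 1 → ((∀ x < X.n, ∀ y < X.n, X.E x y →
      ((x = u ∧ y = v) ∨ (x = v ∧ y = u)) ∨ X.EdgeCovered C x y) ↔
      ∀ x y, X.G.Adj x y → s(x, y) ≠ s(u, v) → DeltaTour.EdgeCovered X.G (fun _ => False)
        (fun _ _ => False) (overlapping u v s t) X.δ x y) := by
    intro hs ht
    have cd := h.codes hs ht hI
    rw [Fin.forall_iff]
    refine forall₂_congr fun x hx => ?_
    rw [Fin.forall_iff]
    refine forall₂_congr fun y hy => ?_
    rw [← cd.edgeCovered_iff, ← Inst.E_iff, Ne, Sym2.eq_iff]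
    simp only [Fin.ext_iff]
    tauto
  unfold Inst.SegmentCert
  rw [Nat.forall_lt_succ_right, Nat.forall_lt_succ_right, Inst.nonneg_iff, Inst.le_one_iff,
    Inst.one_le_add_iff, Inst.nonneg_iff, Inst.le_one_iff, Inst.one_le_add_iff,
    Inst.one_le_add_gridValue_iff, Inst.segment_length_iff, h.α_zero, h.α_one, h.u_zero, h.v_zero,
    h.u_one, h.v_one, h5, Inst.E_iff]
  constructor
  · rintro ⟨-, ⟨-, -, huv⟩, ⟨⟨-, -, h2, h1⟩, -, h3, h4⟩, ⟨h7, h8⟩, hv, H⟩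
    exact ⟨huv, by linarith, by linarith, h2, by linarith, by linarith, by linarith, hv,
      (h6 (by linarith) h2).1 H⟩
  · rintro ⟨huv, h0, hst, h1, hK, hs, ht, hv, H⟩
    exact ⟨⟨h.M_eq, h.L_eq⟩, ⟨rfl, rfl, huv⟩, ⟨⟨by simp, by linarith, h1, by linarith⟩,
      by linarith, by linarith, by linarith⟩, ⟨by linarith, by linarith⟩, hv, (h6 h0 h1).2 H⟩

theorem Inst.SegmentCert.segmentCert (h : X.SegmentCert C) (hI : 2 + 4 * X.δ ≤ C.I) :
    DeltaTour.SegmentCert X.G X.δ X.K C.I := by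
  obtain ⟨⟨hM, hL⟩, ⟨hu, hv, hx, hy, -⟩, -⟩ := id h
  have cs : CodesSegment X C ⟨_, hx⟩ ⟨_, hy⟩
      (1 - X.gridValue C.I (dig (2 * C.I + 1) C.i 1) (dig 5 C.j 1))
      (X.gridValue C.I (dig (2 * C.I + 1) C.i 0) (dig 5 C.j 0)) :=
    ⟨hM, hL, rfl, rfl, hu, hv, rfl, by ring⟩
  obtain ⟨huv, h0, hst, h1, hrest⟩ := (cs.inst_segmentCert_iff hI).1 h
  refine ⟨_, _, _, _, huv, h0, hst, h1, ?_, ?_, hrest⟩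
  · exact gridValue_mem_grid (dig_lt (by omega) _ _) (dig_lt (by omega) _ _)
  · rw [sub_sub_cancel]
    exact gridValue_mem_grid (dig_lt (by omega) _ _) (dig_lt (by omega) _ _)

theorem exists_inst_segmentCert {I : ℕ} (h : DeltaTour.SegmentCert X.G X.δ X.K I)
    (hI : 2 + 4 * X.δ ≤ I) : ∃ u < X.n ^ 2, ∃ v < X.n ^ 2, ∃ i < (2 * I + 1) ^ 2, ∃ j < 5 ^ 2,
      X.SegmentCert ⟨I, 0, 0, 2, u, v, i, j⟩ := by
  obtain ⟨a, b, s, t, hab, h0, hst, h1, ⟨i₀, j₀, hi₀, hj₀, ht⟩, ⟨i₁, j₁, hi₁, hj₁, hs⟩, hrest⟩ := h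
  obtain ⟨u, hu, huk⟩ := exists_code 2 fun k => if k = 0 then a else b
  obtain ⟨v, hv, hvk⟩ := exists_code 2 fun k => if k = 0 then b else a
  obtain ⟨i, hi, hik⟩ := exists_dig (L := 2) (B := 2 * I + 1) (f := fun k => if k = 0 then i₀ else i₁)
    fun k _ => by split_ifs <;> omega
  obtain ⟨j, hj, hjk⟩ := exists_dig (L := 2) (B := 5) (f := fun k => if k = 0 then j₀ else j₁)
    fun k _ => by split_ifs <;> omega
  have cs : CodesSegment X ⟨I, 0, 0, 2, u, v, i, j⟩ a b s t :=
    { M_eq := rfl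
      L_eq := rfl
      u_zero := huk 0 (by omega)
      v_zero := hvk 0 (by omega)
      u_one := huk 1 (by omega)
      v_one := hvk 1 (by omega)
      α_zero := by
        rw [hik 0 (by omega), hjk 0 (by omega), if_pos rfl, if_pos rfl]
        unfold Inst.gridValue
        linarith
      α_one := by
        rw [hik 1 (by omega), hjk 1 (by omega), if_neg one_ne_zero, if_neg one_ne_zero]
        unfold Inst.gridValue
        linarith }
  exact ⟨u, hu, v, hv, i, hi, j, hj, (cs.inst_segmentCert_iff hI).2 ⟨hab, h0, hst, h1, hrest⟩⟩

/-! ### The size of the search space -/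

noncomputable def gridSize (δ : ℝ) : ℕ := ⌈2 + 4 * δ⌉₊

/-- Without rounding on the machine, the ceiling is found by testing `2 + 4 * δ ≤ i` for `i = 0, 1,
…`. The number of tests depends on `δ` only. -/
theorem NatComp.gridSize : NatComp baseCtx fun X => gridSize X.δ := by
  have hp : ParamBdd baseCtx fun X => RealRAM.gridSize X.δ :=
    ⟨fun _ δ => RealRAM.gridSize δ, fun _ _ => le_rfl⟩
  have hl : NatComp (baseCtx.ext fun X => RealRAM.gridSize X.δ + 1) fun p => p.2 :=
    .last (hp.xpb.add (.const 1))
  refine .search hp.xpb (Dec.real (.const 2) (.const 4) (.const 0) hl (.const 0) (.const 0))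
    (fun X _ i hi => ?_) fun X _ => ?_
  · have := Nat.lt_ceil.1 hi
    push_cast
    change ¬ (2 + 4 * X.δ + 0 * X.K ≤ i + 0 * X.δ + 0 * X.K)
    linarith
  · have := Nat.le_ceil (2 + 4 * X.δ)
    push_cast
    change 2 + 4 * X.δ + 0 * X.K ≤ (RealRAM.gridSize X.δ : ℝ) + 0 * X.δ + 0 * X.K
    unfold RealRAM.gridSize
    linarith

/-- `m` detours of positive grid length are too long. -/
def Exceeds (δ K : ℝ) (m : ℕ) : Prop :=
  ∀ i < 2 * gridSize δ + 1, ∀ j : ℕ, j < 5 → 0 < (i + 4 * δ - 2 * j * δ - gridSize δ : ℝ) →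
    K < m * (i + 4 * δ - 2 * j * δ - gridSize δ : ℝ)

/-- There are finitely many grid indices, and each positive grid value eventually suffices. -/
theorem exists_exceeds (δ K : ℝ) : ∃ m, Exceeds δ K m := by
  have : ∀ᶠ m : ℕ in Filter.atTop, Exceeds δ K m := by
    refine (Filter.eventually_all_finite (Set.finite_lt_nat _)).2 fun i _ =>
      (Filter.eventually_all_finite (Set.finite_lt_nat _)).2 fun j _ => ?_
    by_cases hv : 0 < (i + 4 * δ - 2 * j * δ - gridSize δ : ℝ)
    · exact ((tendsto_natCast_atTop_atTop.atTop_mul_const hv).eventually_gt_atTop K).mono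
        fun m hm _ => hm
    · exact .of_forall fun m h => absurd h hv
  exact this.exists

/-- Taking the least number makes it the outcome of a search from 0 upwards. -/
noncomputable def detourBound (δ K : ℝ) : ℕ := sInf {m | Exceeds δ K m}

theorem Exceeds.lt_of_mem_grid {δ K : ℝ} {m : ℕ} (h : Exceeds δ K m) :
    ∀ α ∈ Grid δ (gridSize δ), 0 < α → K < m * (2 * α) := by
  rintro α ⟨i, j, hi, hj, he⟩ hα
  rw [he]
  exact h i (by omega) j (by omega) (by rw [← he]; linarith)

theorem NatComp.detourBound : NatComp baseCtx fun X => detourBound X.δ X.K := by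
  have hp : ParamBdd baseCtx fun X => RealRAM.detourBound X.δ X.K :=
    ⟨fun K δ => RealRAM.detourBound δ K, fun _ _ => le_rfl⟩
  have c2 : ∀ {Δ : Type} {d : Ctx Δ} {f : Δ → ℕ}, NatComp d f → NatComp d fun γ => 2 * f γ :=
    fun hf => (NatComp.const 2).mul hf
  set c₁ := baseCtx.ext fun X => RealRAM.detourBound X.δ X.K + 1 with hc₁
  have I₁ : NatComp c₁ fun p => RealRAM.gridSize p.1.δ := NatComp.gridSize.lift
  have m₁ : NatComp c₁ fun p => p.2 := .last (hp.xpb.add (.const 1))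
  have b₁ : NatComp c₁ fun p => 2 * RealRAM.gridSize p.1.δ + 1 := (c2 I₁).add (.const 1)
  set c₂ := c₁.ext fun p => 2 * RealRAM.gridSize p.1.δ + 1 with hc₂
  have i₂ : NatComp c₂ fun p => p.2 := .last b₁.1
  set c₃ := c₂.ext fun _ => 5 with hc₃
  have I : NatComp c₃ fun p => RealRAM.gridSize p.1.1.1.δ := I₁.lift.lift
  have m : NatComp c₃ fun p => p.1.1.2 := m₁.lift.lift
  have i : NatComp c₃ fun p => p.1.2 := i₂.lift
  have j : NatComp c₃ fun p => p.2 := .last (.const 5)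
  -- The products with `m` are formed in the natural coefficients, so the test remains linear in `δ`
  -- and `K`.
  have main : Dec c₃ fun p =>
      ¬ p.1.1.1.le p.1.2 4 0 (RealRAM.gridSize p.1.1.1.δ) (2 * p.2) 0 →
      ¬ p.1.1.1.le (p.1.1.2 * p.1.2) (4 * p.1.1.2) 0 (p.1.1.2 * RealRAM.gridSize p.1.1.1.δ)
        (2 * (p.1.1.2 * p.2)) 1 :=
    (Dec.real i (.const 4) (.const 0) I (c2 j) (.const 0)).not.imp
      (Dec.real (m.mul i) ((NatComp.const 4).mul m) (.const 0) (m.mul I) (c2 (m.mul j))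
        (.const 1)).not
  have hex : Dec c₁ fun p => Exceeds p.1.δ p.1.K p.2 := by
    refine Dec.congr (Dec.ball b₁ (Dec.ball (.const 5) main)) fun p _ => ?_
    refine forall₂_congr fun i _ => forall₂_congr fun j _ => imp_congr ?_ ?_ <;>
    · unfold Inst.le
      push_cast
      rw [not_le]
      constructor <;> intro h <;> linarith
  exact .search hp.xpb hex (fun X _ i hi => Nat.notMem_of_lt_sInf hi)
    fun X _ => Nat.sInf_mem (exists_exceeds X.δ X.K)

theorem detourBound_exceeds (δ K : ℝ) : Exceeds δ K (detourBound δ K) :=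
  Nat.sInf_mem (exists_exceeds δ K)

/-! ### The algorithm -/

/-- The summand 3 leaves room for the two detours of a segment code even if `detourBound` is 0.
Every range is bounded by the parameters or is a power whose exponent is. -/
def Inst.HasCode (X : Inst) : Prop :=
  ∃ M < 2 * detourBound X.δ X.K + 1, ∃ w < X.n ^ M, ∃ L < detourBound X.δ X.K + 3,
    ∃ u < X.n ^ L, ∃ v < X.n ^ L, ∃ i < (2 * gridSize X.δ + 1) ^ L, ∃ j < 5 ^ L,
      X.WalkCert ⟨gridSize X.δ, M, w, L, u, v, i, j⟩ ∨
        X.SegmentCert ⟨gridSize X.δ, M, w, L, u, v, i, j⟩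

theorem Inst.hasCode_iff (X : Inst) : X.HasCode ↔
    ∃ T, IsDeltaTour X.G X.δ T ∧ walkLength T ≤ X.K := by
  have hI : 2 + 4 * X.δ ≤ gridSize X.δ := Nat.le_ceil _
  rw [exists_deltaTour_iff_cert X.δ_nonneg hI]
  constructor
  · rintro ⟨M, -, w, hw, L, -, u, -, v, -, i, -, j, -, h | h⟩
    · refine .inl (h.walkCert ?_ hI)
      -- For `n = 0` there is no `w < 0 ^ M`, because a walk code has `M ≥ 1`.
      rcases Nat.eq_zero_or_pos X.n with h0 | h0
      · rw [h0, zero_pow (Nat.one_le_iff_ne_zero.1 h.1.1)] at hw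
        exact absurd hw (Nat.not_lt_zero _)
      · exact h0
    · exact .inr (h.segmentCert hI)
  · rintro (h | h)
    · obtain ⟨M, hM, w, hw, L, hL, u, hu, v, hv, i, hi, j, hj, h⟩ :=
        exists_inst_walkCert h hI (detourBound_exceeds X.δ X.K).lt_of_mem_grid
      exact ⟨M, hM, w, hw, L, by omega, u, hu, v, hv, i, hi, j, hj, .inl h⟩
    · obtain ⟨u, hu, v, hv, i, hi, j, hj, h⟩ := exists_inst_segmentCert h hI
      exact ⟨0, by omega, 0, by simp, 2, by omega, u, hu, v, hv, i, hi, j, hj, .inr h⟩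

theorem Dec.hasCode : Dec baseCtx Inst.HasCode := by
  have c2 : ∀ {Δ : Type} {d : Ctx Δ} {f : Δ → ℕ}, NatComp d f → NatComp d fun γ => 2 * f γ :=
    fun hf => (NatComp.const 2).mul hf
  have n₀ := NatComp.size
  have I₀ := NatComp.gridSize
  have m₀ := NatComp.detourBound
  have Ip₀ : ParamBdd baseCtx fun X => gridSize X.δ := ⟨fun _ δ => gridSize δ, fun _ _ => le_rfl⟩
  have mp₀ : ∀ k l, ParamBdd baseCtx fun X => k * detourBound X.δ X.K + l := fun k l =>
    ⟨fun K δ => k * detourBound δ K + l, fun _ _ => le_rfl⟩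
  have bM : NatComp baseCtx fun X => 2 * detourBound X.δ X.K + 1 := (c2 m₀).add (.const 1)
  set c₁ := baseCtx.ext fun X => 2 * detourBound X.δ X.K + 1 with hc₁
  have M₁ : NatComp c₁ fun p => p.2 := .last bM.1
  have Mp₁ : ParamBdd c₁ fun p => p.2 := .last (mp₀ 2 1)
  have bw : NatComp c₁ fun p => p.1.n ^ p.2 := n₀.lift.pow M₁ Mp₁
  set c₂ := c₁.ext fun p => p.1.n ^ p.2 with hc₂
  have w₂ : NatComp c₂ fun p => p.2 := .last bw.1
  have bL : NatComp c₂ fun p => detourBound p.1.1.δ p.1.1.K + 3 := m₀.lift.lift.add (.const 3)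
  have Lp : ParamBdd c₂ fun p => detourBound p.1.1.δ p.1.1.K + 3 := by
    simpa using (mp₀ 1 3).lift.lift
  set c₃ := c₂.ext fun p => detourBound p.1.1.δ p.1.1.K + 3 with hc₃
  have L₃ : NatComp c₃ fun p => p.2 := .last bL.1
  have Lp₃ : ParamBdd c₃ fun p => p.2 := .last Lp
  have bu : NatComp c₃ fun p => p.1.1.1.n ^ p.2 := n₀.lift.lift.lift.pow L₃ Lp₃
  set c₄ := c₃.ext fun p => p.1.1.1.n ^ p.2 with hc₄
  have u₄ : NatComp c₄ fun p => p.2 := .last bu.1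
  have bv : NatComp c₄ fun p => p.1.1.1.1.n ^ p.1.2 := bu.lift
  set c₅ := c₄.ext fun p => p.1.1.1.1.n ^ p.1.2 with hc₅
  have v₅ : NatComp c₅ fun p => p.2 := .last bv.1
  have bi : NatComp c₅ fun p => (2 * gridSize p.1.1.1.1.1.δ + 1) ^ p.1.1.2 :=
    ((c2 I₀.lift.lift.lift.lift.lift).add (.const 1)).pow L₃.lift.lift Lp₃.lift.lift
  set c₆ := c₅.ext fun p => (2 * gridSize p.1.1.1.1.1.δ + 1) ^ p.1.1.2 with hc₆
  have i₆ : NatComp c₆ fun p => p.2 := .last bi.1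
  have bj : NatComp c₆ fun p => 5 ^ p.1.1.1.2 :=
    (NatComp.const 5).pow L₃.lift.lift.lift Lp₃.lift.lift.lift
  set c₇ := c₆.ext fun p => 5 ^ p.1.1.1.2 with hc₇
  have j₇ : NatComp c₇ fun p => p.2 := .last bj.1
  have h : CodeComp c₇ fun p => ⟨gridSize p.1.1.1.1.1.1.1.δ, p.1.1.1.1.1.1.2, p.1.1.1.1.1.2,
      p.1.1.1.1.2, p.1.1.1.2, p.1.1.2, p.1.2, p.2⟩ :=
    { n := n₀.lift.lift.lift.lift.lift.lift.lift
      I := I₀.lift.lift.lift.lift.lift.lift.lift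
      M := M₁.lift.lift.lift.lift.lift.lift
      w := w₂.lift.lift.lift.lift.lift
      L := L₃.lift.lift.lift.lift
      u := u₄.lift.lift.lift
      v := v₅.lift.lift
      i := i₆.lift
      j := j₇
      Ip := Ip₀.lift.lift.lift.lift.lift.lift.lift
      Mp := Mp₁.lift.lift.lift.lift.lift.lift
      Lp := Lp₃.lift.lift.lift.lift }
  exact .bex bM (.bex bw (.bex bL (.bex bu (.bex bv (.bex bi (.bex bj
    ((Dec.walkCert h).or (Dec.segmentCert h))))))))

end RealRAM

theorem mainTheorem9 :
    ∃ (A : RealRAM.Prog) (f : ℝ → ℝ → ℕ),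
      ∀ (δ K : ℝ), 0 ≤ δ → 0 ≤ K → ∀ (n : ℕ) (G : SimpleGraph (Fin n)),
        ∃ (t : ℕ) (s : RealRAM.State),
          RealRAM.Runs A (RealRAM.inputState G δ K) t s ∧
          t ≤ (max n 2) ^ f K δ ∧
          (((∃ T, DeltaTour.IsDeltaTour G δ T ∧ DeltaTour.walkLength T ≤ K) ∧ s.x 0 = 1) ∨
            ((¬ ∃ T, DeltaTour.IsDeltaTour G δ T ∧ DeltaTour.walkLength T ≤ K) ∧ s.x 0 = 0)) := by
  obtain ⟨A, f, h⟩ := (RealRAM.Dec.hasCode.congr fun X _ => X.hasCode_iff.symm).exists_program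
  exact ⟨A, f, fun δ K hδ hK n G => h ⟨n, G, δ, K, hδ, hK⟩⟩
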